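/- Let $B$ be a Banach space, let $\nu\neq 0$ be a measure on $(0,\infty)$ with $\int_0^\infty\min(1,y)\,\nu(dy)<\infty$, and put $\phi_\nu(\lambda)=\int_0^\infty(1-e^{-\lambda y})\,\nu(dy)$. Let $G_{(\nu)}(t,\cdot)$, $t\ge 0$, be the laws of the driftless subordinator with Lévy measure $\nu$: probability measures on $[0,\infty)$ with characteristic functions $\exp\big(t\int(e^{ipy}-1)\,\nu(dy)\big)$. Let $A$ be the generator of a strongly continuous semigroup $e^{tA}$ of contractions in $B$, and let $a<b$. Let $C^k_{kill(a)}([a,b],B)$ be the space of $C^k$ functions on $(-\infty,b]$ vanishing on $(-\infty,a]$, with $C_{kill(a)}=C^0_{kill(a)}$ carrying the sup norm. Integrals $\int_0^{z}$ are over $[0,z)$ and integrals $\int_z^\infty$ are over $[z,\infty)$. Let $T'_te^{tA}f(x)=\int_0^\infty e^{tA}f(x-y)\,G_{(\nu)}(t,dy)$, and for functions vanishing to the left of $a$ let $$D^{(\nu)}_{a+}f(x)=-\int_0^{x-a}(f(x-y)-f(x))\,\nu(dy)+f(x)\,\nu([x-a,\infty)).$$ Notions of solution of $$(1)\quad D^{(\nu)}_{a+}u=Au+g,\quad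 u(a)=0 .$$ A *classical* solution, for $g\in C_{kill(a)}([a,b],B)$, is a function $u$ in the domain of the generator $\mathcal L$ of $T'_te^{tA}$ on $C_{kill(a)}([a,b],B)$ with $\mathcal Lu=-g$; here $\mathcal Lu=Au-D^{(\nu)}_{a+}u$ whenever $u\in C^1_{kill(a)}([a,b],B)$ takes values in the domain of $A$ and $Au$ is continuous. A *generalized solution by approximation* is a pointwise limit on $[a,b]$ of classical solutions whose right-hand sides $g_n\in C_{kill(a)}([a,b],B)$ are uniformly bounded and converge to $g$ almost everywhere on $[a,b]$. A solution *in the sense of generalized functions* is a $B$-valued distribution $u$ on $(-\infty,b)$, vanishing on $(-\infty,a)$, such that for every test function $\varphi$ on $(-\infty,b)$ the vector $\langle u,\varphi\rangle$ is in the domain of $A$ and $A\langle u,\varphi\rangle=-\langle u,L_\nu\varphi\rangle-\int_a^b\varphi(x)g(x)\,dx$, where $L_\nu\varphi(x)=\int_0^\infty(\varphi(x+y)-\varphi(x))\,\nu(dy)$. Solutions of $$(2)\quad D^{(\nu)}_{a+*}f=Af+g,\quad f(a)=Y$$ are, for $Y$ in the domain of $A$, the functions $f=Y+u$ with $u$ solving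 $(1)$ with $AY+g$ in place of $g$. For arbitrary $Y\in B$, a solution by approximation is a pointwise limit on $[a,b]$ of such solutions by approximation with initial values $Y_n\to Y$ in the domain of $A$; a solution in the sense of generalized functions is $f=Y+u$ with $u$ vanishing on $(-\infty,a)$ and $\langle u,\varphi\rangle+\int_a^b\varphi(x)Y\,dx$ in the domain of $A$, $A\big(\langle u,\varphi\rangle+\int_a^b\varphi(x)Y\,dx\big)=-\langle u,L_\nu\varphi\rangle-\int_a^b\varphi(x)g(x)\,dx$ for all $\varphi$. (i) The $\mathcal L(B,B)$-valued potential measure $U^{(\nu)}_{-A}(M)=\int_0^\infty e^{tA}G_{(\nu)}(t,M)\,dt$ is well defined on bounded Borel sets $M$, is countably additive on them and is carried by $[0,\infty)$, and $\|U^{(\nu)}_{-A}([0,z])\|\le e^{\lambda z}/\phi_\nu(\lambda)$ for all $z,\lambda>0$. The potential operator $g\mapsto\int_0^{x-a}U^{(\nu)}_{-A}(dy)\,g(x-y)=\int_0^\infty T'_te^{tA}g(x)\,dt$ is bounded on $C^k_{kill(a)}([a,b],B)$ for every $k$; it increases the sup norm over $[a,b]$ of each derivative of order at most $k$ by at most the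 factor $e^{\lambda(b-a)}/\phi_\nu(\lambda)$, for every $\lambda>0$. (ii) For $g\in C_{kill(a)}([a,b],B)$ the function $$u(x)=\int_0^{x-a}U^{(\nu)}_{-A}(dy)\,g(x-y)=\int_0^\infty\int_0^{x-a}e^{tA}g(x-y)\,G_{(\nu)}(t,dy)\,dt$$ is the unique classical solution of $(1)$. For $g\in C([a,b],B)$ it satisfies $u(a)=0$ and is the unique generalized solution of $(1)$, both by approximation and in the sense of generalized functions. (iii) For $z>0$ let $E_{(\nu),z}(A)=\int_0^\infty e^{tA}\,\frac{\partial}{\partial t}\Big(\int_z^\infty G_{(\nu)}(t,dy)\Big)dt$, where the derivative of the function in brackets, which increases in $t$, is a positive measure, and let $E_{(\nu),0}(A)=1$. These are well-defined bounded operators. For $g\in C([a,b],B)$ and $Y\in B$ the function $$f(x)=E_{(\nu),x-a}(A)Y+\int_0^{x-a}U^{(\nu)}_{-A}(dy)\,g(x-y)$$ satisfies $f(a)=Y$ and is the unique generalized solution of $(2)$, both by approximation and in the sense of generalized functions; if $Y$ is in the domain of $A$, it equals $Y+\int_0^{x-a}U^{(\nu)}_{-A}(dy)\,(AY+g(x-y))$.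 In (ii) and (iii) uniqueness by approximation means equality almost everywhere on $[a,b]$; if $\nu$ is an infinite measure, the solution is moreover continuous on $[a,b]$ and any continuous solution by approximation coincides with it everywhere on $[a,b]$. -/

import Mathlib

open Set Filter Topology MeasureTheory TopologicalSpace
open scoped Distributions

noncomputable section

namespace GenFrac

/-- `ν` is carried by `(0, ∞)` and satisfies the one-sided Lévy condition `∫ min(1,y) ν(dy) < ∞`. -/
structure IsOneSidedLevy (ν : Measure ℝ) : Prop where
  null_nonpos : ν (Iic 0) = 0
  lintegral_min_lt_top : ∫⁻ y, ENNReal.ofReal (min 1 y) ∂ν < ⊤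

/-- The Laplace exponent `φ_ν(l) = ∫ (1 - e^{-l y}) ν(dy)`. -/
def laplaceExponent (ν : Measure ℝ) (l : ℝ) : ℝ :=
  ∫ y in Ioi 0, (1 - Real.exp (-(l * y))) ∂ν

/-- The symbol `ψ_ν(p) = ∫ (e^{i p y} - 1) ν(dy)` of the operator `L_ν`. -/
def symbol (ν : Measure ℝ) (p : ℝ) : ℂ :=
  ∫ y in Ioi 0, (Complex.exp ((p : ℂ) * (y : ℂ) * Complex.I) - 1) ∂ν

/-- `μ` is the law at time `t` of the (driftless) subordinator with Lévy measure `ν`: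
a probability measure on `[0, ∞)` with characteristic function `exp (t ψ_ν)`. -/
structure IsSubordinatorLaw (ν : Measure ℝ) (t : ℝ) (μ : Measure ℝ) : Prop where
  isProbabilityMeasure : IsProbabilityMeasure μ
  null_neg : μ (Iio 0) = 0
  charFun_eq : ∀ p : ℝ, charFun μ p = Complex.exp ((t : ℂ) * symbol ν p)

open Classical in
/-- The measure `G_{(ν)}(t, ·)`: the unique law of the subordinator at time `t`. -/
def subordinatorLaw (ν : Measure ℝ) (t : ℝ) : Measure ℝ :=
  if h : ∃ μ, IsSubordinatorLaw ν t μ then h.choose else 0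

/-- The operator `L_ν φ (x) = ∫ (φ(x+y) - φ(x)) ν(dy)`, dual to
`L'_ν f (x) = ∫ (f(x-y) - f(x)) ν(dy)`. -/
def dualLevyOp (ν : Measure ℝ) (φ : ℝ → ℝ) (x : ℝ) : ℝ :=
  ∫ y in Ioi 0, (φ (x + y) - φ x) ∂ν

section Banach

variable {B : Type*} [NormedAddCommGroup B] [NormedSpace ℝ B]

/-- `S` (used for times `t ≥ 0` only) is a strongly continuous semigroup of contractions. -/
structure IsContractionSemigroup (S : ℝ → B →L[ℝ] B) : Prop where
  zero : S 0 = ContinuousLinearMap.id ℝ B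
  add : ∀ s t : ℝ, 0 ≤ s → 0 ≤ t → S (s + t) = (S s).comp (S t)
  norm_le_one : ∀ t : ℝ, 0 ≤ t → ‖S t‖ ≤ 1
  tendsto_zero : ∀ Y : B, Tendsto (fun t => S t Y) (𝓝[>] 0) (𝓝 Y)

/-- `A`, with its domain, is the infinitesimal generator of `S`. -/
def IsGenerator (A : B →ₗ.[ℝ] B) (S : ℝ → B →L[ℝ] B) : Prop :=
  ∀ Y Z : B, (Y, Z) ∈ A.graph ↔
    Tendsto (fun t : ℝ => t⁻¹ • (S t Y - Y)) (𝓝[>] 0) (𝓝 Z)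

/-- `f` is a member of `C^k_{kill(a)}([a,b],B)`: of class `C^k` on `(-∞, b]` and zero to the left
of `a`. Values beyond `b` are irrelevant. -/
structure IsKill (k : ℕ) (a b : ℝ) (f : ℝ → B) : Prop where
  contDiffOn : ContDiffOn ℝ k f (Iic b)
  eq_zero : ∀ x ≤ a, f x = 0

/-- The Riemann-Liouville type derivative `D^{(ν)}_{a+} f (x)`, for `f` vanishing left of `a`. -/
def rlDeriv (ν : Measure ℝ) (a : ℝ) (f : ℝ → B) (x : ℝ) : B :=
  -(∫ y in Ioo 0 (x - a), (f (x - y) - f x) ∂ν) + ν.real (Ici (x - a)) • f x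

/-- The semigroup `T'_t e^{tA}`, that is `f ↦ (x ↦ ∫ e^{tA} f(x-y) G_{(ν)}(t,dy))`. -/
def productSemigroup (ν : Measure ℝ) (S : ℝ → B →L[ℝ] B) (t : ℝ) (f : ℝ → B) (x : ℝ) : B :=
  ∫ y in Ici 0, S t (f (x - y)) ∂(subordinatorLaw ν t)

/-- `f` is in the domain of the generator of `T'_t e^{tA}` on `C_{kill(a)}([a,b],B)` (with the sup
norm) and the generator maps it to `h`. -/
structure HasGeneratorValue (ν : Measure ℝ) (S : ℝ → B →L[ℝ] B) (a b : ℝ) (f h : ℝ → B) :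
    Prop where
  mem : IsKill 0 a b f
  mem_value : IsKill 0 a b h
  tendsto : TendstoUniformlyOn
    (fun (t : ℝ) (x : ℝ) => t⁻¹ • (productSemigroup ν S t f x - f x)) h (𝓝[>] 0) (Iic b)

/-- Classical solution of `D^{(ν)}_{a+} f = A f + g`, `f(a) = 0`: the function `f` lies in the
domain of the generator `A - D^{(ν)}_{a+}` of `T'_t e^{tA}`, which maps it to `-g`. -/
def IsClassicalSolution (ν : Measure ℝ) (S : ℝ → B →L[ℝ] B) (a b : ℝ) (g f : ℝ → B) : Prop :=
  HasGeneratorValue ν S a b f (fun x => -g x)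

/-- Generalized solution by approximation of `D^{(ν)}_{a+} f = A f + g`, `f(a) = 0`: a pointwise
limit on `[a,b]` of classical solutions `fₙ` with uniformly bounded right-hand sides
`gₙ ∈ C_{kill(a)}([a,b],B)` that converge to `g` almost everywhere. -/
def IsApproxSolution (ν : Measure ℝ) (S : ℝ → B →L[ℝ] B) (a b : ℝ) (g f : ℝ → B) : Prop :=
  ∃ gn fn : ℕ → ℝ → B,
    (∀ n, IsKill 0 a b (gn n)) ∧
    (∃ K : ℝ, ∀ n, ∀ x ∈ Icc a b, ‖gn n x‖ ≤ K) ∧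
    (∀ᵐ x ∂(volume.restrict (Icc a b)), Tendsto (fun n => gn n x) atTop (𝓝 (g x))) ∧
    (∀ n, IsClassicalSolution ν S a b (gn n) (fn n)) ∧
    ∀ x ∈ Icc a b, Tendsto (fun n => fn n x) atTop (𝓝 (f x))

/-- Generalized solution by approximation of `D^{(ν)}_{a+*} f = A f + g`, `f(a) = Y`, for arbitrary
`Y`: a pointwise limit of functions `fₙ = Yₙ + uₙ` with `Yₙ → Y` in the domain of `A`
(`Zₙ = A Yₙ`) and `uₙ` a solution by approximation of `D^{(ν)}_{a+} u = A u + A Yₙ + g`. -/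
def IsApproxSolutionCaputo (ν : Measure ℝ) (A : B →ₗ.[ℝ] B) (S : ℝ → B →L[ℝ] B) (a b : ℝ) (Y : B)
    (g f : ℝ → B) : Prop :=
  ∃ (Yn Zn : ℕ → B) (fn : ℕ → ℝ → B),
    (∀ n, (Yn n, Zn n) ∈ A.graph) ∧
    Tendsto Yn atTop (𝓝 Y) ∧
    (∀ n, IsApproxSolution ν S a b (fun x => Zn n + g x) (fun x => fn n x - Yn n)) ∧
    ∀ x ∈ Icc a b, Tendsto (fun n => fn n x) atTop (𝓝 (f x))

/-- The open half-line `(-∞, b)`. -/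
def leftHalfLine (b : ℝ) : Opens ℝ := ⟨Iio b, isOpen_Iio⟩

/-- The `B`-valued distribution `T` on `(-∞, b)` vanishes to the left of `a` and solves
`D^{(ν)}_+ T = A (T + Y 1_{(a,b)}) + 1_{(a,b)} g` in the sense of generalized functions. Thus `Y + T`
solves the Caputo type problem with initial value `Y`, and `Y = 0` is the Riemann-Liouville case.
Since `T` vanishes left of `a`, its pairing with the smooth function `L_ν φ`, whose support is
bounded above but not below, is its pairing with any test function `ψ` that equals `L_ν φ`
on a neighbourhood of `[a, ∞)`. -/
structure IsDistribSolution (ν : Measure ℝ) (A : B →ₗ.[ℝ] B) (a b : ℝ) (Y : B) (g : ℝ → B)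
    (T : 𝓓'(leftHalfLine b, B)) : Prop where
  vanishing : Distribution.IsVanishingOn T (Iio a)
  equation : ∀ (φ ψ : 𝓓(leftHalfLine b, ℝ)) (δ : ℝ), 0 < δ →
    (∀ x, a - δ < x → ψ x = dualLevyOp ν φ x) →
    (T φ + ∫ x in Ioo a b, φ x • Y, -T ψ - ∫ x in Ioo a b, φ x • g x) ∈ A.graph

/-- `u` is, as a `B`-valued distribution on `(-∞, b)` (extended by zero left of `a`), the unique
solution in the sense of generalized functions. -/
def IsUniqueDistribSolution (ν : Measure ℝ) (A : B →ₗ.[ℝ] B) (a b : ℝ) (Y : B) (g u : ℝ → B) :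
    Prop :=
  IntegrableOn u (Icc a b) ∧
  ∃ T : 𝓓'(leftHalfLine b, B),
    (∀ φ : 𝓓(leftHalfLine b, ℝ), T φ = ∫ x in Ioo a b, φ x • u x) ∧
    IsDistribSolution ν A a b Y g T ∧
    ∀ T' : 𝓓'(leftHalfLine b, B), IsDistribSolution ν A a b Y g T' → T' = T

/-- `U` is the operator-valued measure `M ↦ ∫_0^∞ e^{tA} G_{(ν)}(t,M) dt` (a strong integral) on the
bounded Borel sets; it is countably additive there and is carried by `[0, ∞)`. -/
structure IsPotentialMeasure (ν : Measure ℝ) (S : ℝ → B →L[ℝ] B) (U : Set ℝ → B →L[ℝ] B) :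
    Prop where
  integrable : ∀ M, MeasurableSet M → Bornology.IsBounded M → ∀ Y : B,
    IntegrableOn (fun t => (subordinatorLaw ν t).real M • S t Y) (Ioi 0)
  apply_eq : ∀ M, MeasurableSet M → Bornology.IsBounded M → ∀ Y : B,
    U M Y = ∫ t in Ioi 0, (subordinatorLaw ν t).real M • S t Y
  hasSum : ∀ M : ℕ → Set ℝ, (∀ i, MeasurableSet (M i)) → Pairwise (Function.onFun Disjoint M) →
    Bornology.IsBounded (⋃ i, M i) → HasSum (fun i => U (M i)) (U (⋃ i, M i))
  null_neg : ∀ M, MeasurableSet M → Bornology.IsBounded M → M ⊆ Iio 0 → U M = 0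

/-- The convolution `∫_0^{x-a} U_{-A}^{(ν)}(dy) g(x-y) = ∫_0^∞ ∫_0^{x-a} e^{tA} g(x-y) G_{(ν)}(t,dy) dt`.
The point `y = x - a` is excluded, i.e. `g` is regarded as vanishing on `(-∞, a]`. -/
def potentialConv (ν : Measure ℝ) (S : ℝ → B →L[ℝ] B) (a : ℝ) (g : ℝ → B) (x : ℝ) : B :=
  ∫ t in Ioi 0, ∫ y in Ico 0 (x - a), S t (g (x - y)) ∂(subordinatorLaw ν t)

/-- The function `t ↦ ∫_z^∞ G_{(ν)}(t,dy)`, extended to `t < 0` by its value at `t = 0`. -/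
def tailFun (ν : Measure ℝ) (z t : ℝ) : ℝ :=
  (subordinatorLaw ν (max t 0)).real (Ici z)

open Classical in
/-- The derivative in `t` of the increasing function `t ↦ ∫_z^∞ G_{(ν)}(t,dy)`, as a positive
measure. -/
def tailDeriv (ν : Measure ℝ) (z : ℝ) : Measure ℝ :=
  if h : Monotone (tailFun ν z) then h.stieltjesFunction.measure else 0

open Classical in
/-- The operator-valued Mittag-Leffler function
`E_{(ν),z}(A) Y = ∫_0^∞ e^{tA} Y ∂_t (∫_z^∞ G_{(ν)}(t,dy)) dt`, `z > 0`, with `E_{(ν),0}(A) = 1`. -/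
def mittagLeffler (ν : Measure ℝ) (S : ℝ → B →L[ℝ] B) (z : ℝ) (Y : B) : B :=
  if 0 < z then ∫ t in Ioi 0, S t Y ∂(tailDeriv ν z) else Y

end Banach

end GenFrac

end

namespace GenFrac

/-! ### Laplace transforms of measures on the half-line -/

/-! The operators `T'_t e^{tA}` act on functions vanishing left of `a`, and on the window `[a,b]`
only jumps of size at most `b - a` are visible. By Chernoff's bound `G(t,[0,z]) ≤ e^{λz - tφ(λ)}`,
with `φ(λ) > 0` since `ν ≠ 0`; so on the window the semigroup decays exponentially, and minus its
generator is inverted by the potential `∫_0^∞ T'_t e^{tA} dt`.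

Everything about the potential is read off from one scalar measure, `dt G(t,dy)` on `(0,∞) × [0,R]`
(`potMeasure`), which is finite with mass at most `e^{λR}/φ(λ)`. Because `e^{tA}` is a contraction,
norm bounds, continuity, differentiation in `x`, countable additivity of `U` and passage to limits
are all dominated convergence against this measure. That the potential is a classical solution comes
from the time shift: applying `T'_h e^{hA}` deletes the stretch `[0,h]` of the time integral.
Uniqueness comes from applying the potential to the difference quotients of a solution. For
approximating right-hand sides that converge only almost everywhere, translation invariance of
Lebesgue measure and Fubini give convergence of the potentials for almost every `x`. If `ν` is
infinite, `G(t,·)` has no atom at a given point for almost every `t`, so the jump of `g` at `a` does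
no harm and solutions are continuous.

The one analytic fact about `ν` is the forward equation `G_t w - w(0) = ∫_0^t G_s L_ν w ds` for `C¹`
functions `w` (`forwardDefect_eq_zero`). It is explicit for `w = e^{-ny}`, and Weierstrass
approximation in the variable `e^{-y}` extends it. It identifies the generator with `A - D` on
regular functions.

For initial values, integration by parts in `t` gives `E_z(A)Y = Y + ∫_{[0,z)} U(dy) AY` on the
domain of `A` (`mittagLeffler_eq`); density of the domain, `‖E_z‖ ≤ 1` and closedness of `A` do the
rest.

For generalized functions, existence follows by moving the semigroup onto the test function and
differentiating at `t = 0`. For uniqueness, if `T` solves the homogeneous problem then `t ↦ e^{tA}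
T(G_t φ)`, with `G_t φ` suitably cut off on the left, has zero right derivative, equals `Tφ` at `t =
0`, and tends to `0` since `G_t φ` decays. -/

lemma norm_exp_mul_le_one {z : ℂ} (hz : z.re ≤ 0) {y : ℝ} (hy : 0 ≤ y) :
    ‖Complex.exp (z * y)‖ ≤ 1 := by
  rw [Complex.norm_exp]
  simpa using mul_nonpos_of_nonpos_of_nonneg hz hy

lemma norm_exp_mul_sub_one_le {z : ℂ} (hz : z.re ≤ 0) {y : ℝ} (hy : 0 ≤ y) :
    ‖Complex.exp (z * y) - 1‖ ≤ 2 * max 1 ‖z‖ * min 1 y := by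
  have h1 : ‖Complex.exp (z * y) - 1‖ ≤ 2 := by
    refine (norm_sub_le _ _).trans ?_
    have := norm_exp_mul_le_one hz hy
    simp only [norm_one]
    linarith
  have h2 : ‖z * (y : ℂ)‖ = ‖z‖ * y := by simp [abs_of_nonneg hy]
  have h3 : ‖Complex.exp (z * y) - 1‖ ≤ 2 * (‖z‖ * y) := by
    by_cases h : ‖z * (y : ℂ)‖ ≤ 1
    · exact h2 ▸ Complex.norm_exp_sub_one_le h
    · rw [h2] at h
      push Not at h
      linarith
  have m1 : (1 : ℝ) ≤ max 1 ‖z‖ := le_max_left _ _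
  have m2 : ‖z‖ ≤ max 1 ‖z‖ := le_max_right _ _
  rcases le_total 1 y with h | h
  · rw [min_eq_left h]; linarith
  · rw [min_eq_right h]
    have := mul_le_mul_of_nonneg_right m2 hy
    linarith

lemma ae_nonneg_of_null_neg {μ : Measure ℝ} (h : μ (Iio 0) = 0) : ∀ᵐ y ∂μ, 0 ≤ y := by
  rw [ae_iff]; simpa [Iio_def] using h

lemma integrable_exp_mul {μ : Measure ℝ} [IsFiniteMeasure μ] (h : μ (Iio 0) = 0) {z : ℂ}
    (hz : z.re ≤ 0) : Integrable (fun y : ℝ => Complex.exp (z * y)) μ := by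
  refine Integrable.of_bound (C := 1) (by fun_prop) ?_
  filter_upwards [ae_nonneg_of_null_neg h] with y hy using norm_exp_mul_le_one hz hy

lemma conv_null_neg {μ ρ : Measure ℝ} [SFinite μ] [SFinite ρ] (hμ : μ (Iio 0) = 0)
    (hρ : ρ (Iio 0) = 0) : (μ ∗ ρ) (Iio 0) = 0 := by
  rw [Measure.conv, Measure.map_apply (by fun_prop) measurableSet_Iio]
  have : (fun x : ℝ × ℝ => x.1 + x.2) ⁻¹' Iio 0 ⊆ (Iio 0 ×ˢ univ) ∪ (univ ×ˢ Iio 0) := by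
    rintro ⟨x, y⟩ h
    simp only [mem_preimage, mem_Iio, mem_union, mem_prod, mem_univ, and_true, true_and] at h ⊢
    by_contra! h'
    linarith
  refine measure_mono_null this ?_
  rw [measure_union_null_iff, Measure.prod_prod, Measure.prod_prod]
  simp [hμ, hρ]

lemma integral_exp_mul_conv {μ ρ : Measure ℝ} [IsFiniteMeasure μ] [IsFiniteMeasure ρ]
    (hμ : μ (Iio 0) = 0) (hρ : ρ (Iio 0) = 0) {z : ℂ} (hz : z.re ≤ 0) :
    ∫ y : ℝ, Complex.exp (z * y) ∂(μ ∗ ρ) =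
      (∫ y : ℝ, Complex.exp (z * y) ∂μ) * ∫ y : ℝ, Complex.exp (z * y) ∂ρ := by
  rw [integral_conv (integrable_exp_mul (conv_null_neg hμ hρ) hz)]
  simp only [Complex.ofReal_add, mul_add, Complex.exp_add]
  simp_rw [integral_const_mul, integral_mul_const]

/-! ### Compound Poisson laws -/

/-- The convolution powers of a measure on `ℝ`. -/
noncomputable def convPow (μ : Measure ℝ) : ℕ → Measure ℝ
  | 0 => Measure.dirac 0
  | n + 1 => convPow μ n ∗ μ

instance isFiniteMeasure_convPow (μ : Measure ℝ) [IsFiniteMeasure μ] (n : ℕ) :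
    IsFiniteMeasure (convPow μ n) := by
  induction n with
  | zero => unfold convPow; infer_instance
  | succ n ih => unfold convPow; infer_instance

lemma convPow_null_neg {μ : Measure ℝ} [IsFiniteMeasure μ] (h : μ (Iio 0) = 0) (n : ℕ) :
    convPow μ n (Iio 0) = 0 := by
  induction n with
  | zero => simp [convPow]
  | succ n ih => exact conv_null_neg ih h

lemma integral_exp_mul_convPow {μ : Measure ℝ} [IsFiniteMeasure μ] (h : μ (Iio 0) = 0) {z : ℂ}
    (hz : z.re ≤ 0) (n : ℕ) :
    ∫ y : ℝ, Complex.exp (z * y) ∂(convPow μ n) = (∫ y : ℝ, Complex.exp (z * y) ∂μ) ^ n := by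
  induction n with
  | zero => simp [convPow]
  | succ n ih => rw [convPow, integral_exp_mul_conv (convPow_null_neg h n) h hz, ih, pow_succ]

lemma convPow_univ (μ : Measure ℝ) [IsFiniteMeasure μ] (n : ℕ) :
    convPow μ n univ = ENNReal.ofReal (μ.real univ ^ n) := by
  induction n with
  | zero => simp [convPow]
  | succ n ih =>
    rw [convPow, Measure.conv, Measure.map_apply (by fun_prop) MeasurableSet.univ, preimage_univ,
      ← univ_prod_univ, Measure.prod_prod, ih, pow_succ, ENNReal.ofReal_mul (by positivity),
      ofReal_measureReal]

/-- The compound Poisson law at time `t` with finite jump measure `μ`. -/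
noncomputable def compoundPoisson (μ : Measure ℝ) (t : ℝ) : Measure ℝ :=
  Measure.sum fun n : ℕ =>
    ENNReal.ofReal (Real.exp (-(t * μ.real univ)) * (t ^ n / n.factorial)) • convPow μ n

lemma compoundPoisson_univ (μ : Measure ℝ) [IsFiniteMeasure μ] {t : ℝ} (ht : 0 ≤ t) :
    compoundPoisson μ t univ = 1 := by
  have hs : HasSum (fun n : ℕ => Real.exp (-(t * μ.real univ)) *
      ((t * μ.real univ) ^ n / n.factorial)) 1 := by
    have := (NormedSpace.expSeries_div_hasSum_exp (𝔸 := ℝ) (t * μ.real univ)).mul_left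
      (Real.exp (-(t * μ.real univ)))
    rwa [← Real.exp_eq_exp_ℝ, ← Real.exp_add, neg_add_cancel, Real.exp_zero] at this
  rw [compoundPoisson, Measure.sum_apply _ MeasurableSet.univ]
  simp only [Measure.smul_apply, smul_eq_mul, convPow_univ]
  have : ∀ n : ℕ, ENNReal.ofReal (Real.exp (-(t * μ.real univ)) * (t ^ n / n.factorial)) *
      ENNReal.ofReal (μ.real univ ^ n) = ENNReal.ofReal (Real.exp (-(t * μ.real univ)) *
      ((t * μ.real univ) ^ n / n.factorial)) := fun n => by
    rw [← ENNReal.ofReal_mul (by positivity)]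
    congr 1
    rw [mul_pow]; ring
  simp_rw [this]
  rw [← ENNReal.ofReal_tsum_of_nonneg (fun n => by positivity) hs.summable, hs.tsum_eq,
    ENNReal.ofReal_one]

lemma compoundPoisson_null_neg {μ : Measure ℝ} [IsFiniteMeasure μ] (h : μ (Iio 0) = 0) (t : ℝ) :
    compoundPoisson μ t (Iio 0) = 0 := by
  rw [compoundPoisson, Measure.sum_apply _ measurableSet_Iio]
  simp [convPow_null_neg h]

/-- If `F` is the transform of `μ` and `m` its mass, the `n`-th summand contributes `e^{-tm} (tF)^n
/ n!`. The series sums to `e^{t(F - m)}`, and `F - m` is the integral of `e^{zy} - 1`. -/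
lemma integral_exp_mul_compoundPoisson {μ : Measure ℝ} [IsFiniteMeasure μ] (h : μ (Iio 0) = 0)
    {t : ℝ} (ht : 0 ≤ t) {z : ℂ} (hz : z.re ≤ 0) :
    ∫ y : ℝ, Complex.exp (z * y) ∂(compoundPoisson μ t) =
      Complex.exp (t * ∫ y : ℝ, (Complex.exp (z * y) - 1) ∂μ) := by
  have : IsFiniteMeasure (compoundPoisson μ t) := ⟨by rw [compoundPoisson_univ μ ht]; simp⟩
  have h1 := hasSum_integral_measure
    (integrable_exp_mul (compoundPoisson_null_neg h t) hz)
  change HasSum _ (∫ y : ℝ, Complex.exp (z * y) ∂(compoundPoisson μ t)) at h1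
  refine h1.unique ?_
  set F := ∫ y : ℝ, Complex.exp (z * y) ∂μ with hF
  have h2 : ∫ y : ℝ, (Complex.exp (z * y) - 1) ∂μ = F - μ.real univ := by
    rw [integral_sub (integrable_exp_mul h hz) (integrable_const _)]
    simp [hF]
  rw [h2, mul_sub, sub_eq_add_neg, add_comm, Complex.exp_add]
  have h3 := (NormedSpace.expSeries_div_hasSum_exp (𝔸 := ℂ) ((t : ℂ) * F)).mul_left
    (Complex.exp (-(t * (μ.real univ : ℂ))))
  rw [← Complex.exp_eq_exp_ℂ] at h3
  convert! h3 using 2 with n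
  rw [integral_smul_measure, integral_exp_mul_convPow h hz, ENNReal.toReal_ofReal (by positivity),
    mul_pow]
  simp only [Complex.real_smul]
  push_cast
  ring

/-! ### Existence of the subordinator laws -/

variable {ν : Measure ℝ}

namespace IsOneSidedLevy

lemma integrable_min (hν : IsOneSidedLevy ν) : Integrable (fun y : ℝ => min 1 y) ν := by
  refine ⟨by fun_prop, ?_⟩
  rw [hasFiniteIntegral_iff_norm]
  refine lt_of_le_of_lt (lintegral_mono_ae ?_) hν.lintegral_min_lt_top
  have : ∀ᵐ y ∂ν, 0 < y := by
    rw [ae_iff]; simpa [Iic_def] using hν.null_nonpos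
  filter_upwards [this] with y hy
  rw [Real.norm_of_nonneg (by positivity)]

lemma ae_pos (hν : IsOneSidedLevy ν) : ∀ᵐ y ∂ν, 0 < y := by
  rw [ae_iff]; simpa [Iic_def] using hν.null_nonpos

lemma restrict_Ioi (hν : IsOneSidedLevy ν) : ν.restrict (Ioi 0) = ν :=
  Measure.restrict_eq_self_of_ae_mem hν.ae_pos

lemma integrable_of_norm_le {E : Type*} [NormedAddCommGroup E] (hν : IsOneSidedLevy ν)
    {f : ℝ → E} (hf : AEStronglyMeasurable f ν) {C : ℝ}
    (h : ∀ y, 0 < y → ‖f y‖ ≤ C * min 1 y) : Integrable f ν :=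
  (hν.integrable_min.const_mul C).mono' hf (hν.ae_pos.mono h)

lemma integrable_exp_sub_one (hν : IsOneSidedLevy ν) {z : ℂ} (hz : z.re ≤ 0) :
    Integrable (fun y : ℝ => Complex.exp (z * y) - 1) ν :=
  hν.integrable_of_norm_le (by fun_prop) fun _ hy => norm_exp_mul_sub_one_le hz hy.le

lemma measure_Ici_lt_top (hν : IsOneSidedLevy ν) {r : ℝ} (hr : 0 < r) : ν (Ici r) < ⊤ := by
  have h := hν.integrable_min.measure_norm_ge_lt_top (ε := min 1 r) (by positivity)
  refine lt_of_le_of_lt (measure_mono fun y (hy : r ≤ y) => ?_) h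
  have : 0 < y := hr.trans_le hy
  simp only [mem_ofPred_eq]
  rw [Real.norm_of_nonneg (by positivity)]
  exact min_le_min le_rfl hy

lemma sigmaFinite (hν : IsOneSidedLevy ν) : SigmaFinite ν := by
  rw [← hν.restrict_Ioi]
  -- The null half-line `(-∞, 0]` is adjoined to every set, because the cover has to exhaust the
  -- whole line.
  refine ⟨⟨⟨fun n => Iic 0 ∪ Ici (1 / ((n : ℝ) + 1)), fun _ => trivial, fun n => ?_, ?_⟩⟩⟩
  · refine (measure_union_le _ _).trans_lt (ENNReal.add_lt_top.2 ⟨?_, ?_⟩)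
    · rw [hν.restrict_Ioi, hν.null_nonpos]; simp
    · rw [hν.restrict_Ioi]
      exact hν.measure_Ici_lt_top (by positivity)
  · refine eq_univ_of_forall fun y => mem_iUnion.2 ?_
    rcases le_or_gt y 0 with h | h
    · exact ⟨0, Or.inl h⟩
    · obtain ⟨n, hn⟩ := exists_nat_one_div_lt h
      exact ⟨n, Or.inr hn.le⟩

/-- The subordinator laws exist, and their Laplace transforms extend to the left half-plane. -/
theorem exists_law (hν : IsOneSidedLevy ν) {t : ℝ} (ht : 0 ≤ t) :
    ∃ μ : Measure ℝ, IsProbabilityMeasure μ ∧ μ (Iio 0) = 0 ∧ ∀ z : ℂ, z.re ≤ 0 →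
      ∫ y : ℝ, Complex.exp (z * y) ∂μ =
        Complex.exp (t * ∫ y : ℝ, (Complex.exp (z * y) - 1) ∂ν) := by
  -- Discarding the jumps smaller than `1/(n+1)` leaves a finite jump measure, hence a compound
  -- Poisson law; the sought law is a weak limit of these.
  set s : ℕ → Set ℝ := fun n => Ici (1 / ((n : ℝ) + 1)) with hs
  have hfin : ∀ n, IsFiniteMeasure (ν.restrict (s n)) := fun n =>
    ⟨by rw [Measure.restrict_apply_univ]; exact hν.measure_Ici_lt_top (by positivity)⟩
  have hneg : ∀ n, ν.restrict (s n) (Iio 0) = 0 := fun n =>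
    le_antisymm ((Measure.restrict_apply_le _ _).trans
      ((measure_mono Iio_subset_Iic_self).trans hν.null_nonpos.le)) (zero_le)
  set μ : ℕ → ProbabilityMeasure ℝ := fun n =>
    ⟨compoundPoisson (ν.restrict (s n)) t, ⟨compoundPoisson_univ _ ht⟩⟩ with hμ
  have hμneg : ∀ n, (μ n : Measure ℝ) (Iio 0) = 0 := fun n =>
    compoundPoisson_null_neg (hneg n) t
  have hsmono : Monotone s := by
    intro m n hmn
    refine Ici_subset_Ici.2 (one_div_le_one_div_of_le (by positivity) ?_)
    have : (m : ℝ) ≤ n := by exact_mod_cast hmn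
    linarith
  have hsU : ⋃ n, s n = Ioi 0 := by
    ext y
    simp only [hs, mem_iUnion, mem_Ici, mem_Ioi]
    refine ⟨fun ⟨n, hn⟩ => lt_of_lt_of_le (by positivity) hn, fun h => ?_⟩
    obtain ⟨n, hn⟩ := exists_nat_one_div_lt h
    exact ⟨n, hn.le⟩
  have hlim : ∀ z : ℂ, z.re ≤ 0 → Tendsto (fun n => ∫ y : ℝ, Complex.exp (z * y) ∂(μ n : Measure ℝ))
      atTop (𝓝 (Complex.exp (t * ∫ y : ℝ, (Complex.exp (z * y) - 1) ∂ν))) := fun z hz => by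
    have h1 : ∀ n, ∫ y : ℝ, Complex.exp (z * y) ∂(μ n : Measure ℝ) =
        Complex.exp (t * ∫ y in s n, (Complex.exp (z * y) - 1) ∂ν) := fun n =>
      integral_exp_mul_compoundPoisson (hneg n) ht hz
    simp_rw [h1]
    refine (Complex.continuous_exp.tendsto _).comp (Tendsto.const_mul _ ?_)
    have h2 := tendsto_setIntegral_of_monotone (μ := ν) (fun n => measurableSet_Ici) hsmono
      (f := fun y : ℝ => Complex.exp (z * y) - 1) (hν.integrable_exp_sub_one hz).integrableOn
    rwa [hsU, hν.restrict_Ioi] at h2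
  -- Pointwise convergence of characteristic functions to a limit continuous at `0` forces
  -- tightness, so Prokhorov's theorem yields a convergent subsequence.
  have htight : IsTightMeasureSet (Set.range fun n => (μ n : Measure ℝ)) := by
    refine isTightMeasureSet_of_tendsto_charFun (f := fun p : ℝ =>
      Complex.exp (t * ∫ y : ℝ, (Complex.exp ((p * Complex.I) * y) - 1) ∂ν)) ?_ ?_
    · refine ContinuousAt.cexp (ContinuousAt.const_mul ?_ _)
      refine continuousAt_of_dominated (bound := fun y => 2 * max 1 1 * min 1 y) ?_ ?_ ?_ ?_
      · exact Eventually.of_forall fun p => by fun_prop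
      · filter_upwards [Metric.ball_mem_nhds (0 : ℝ) one_pos] with p hp
        filter_upwards [hν.ae_pos] with y hy
        refine (norm_exp_mul_sub_one_le (by simp) hy.le).trans ?_
        gcongr
        simpa using (mem_ball_zero_iff.1 hp).le
      · exact hν.integrable_min.const_mul _
      · exact Eventually.of_forall fun y => by fun_prop
    · intro p
      have := hlim (p * Complex.I) (by simp)
      refine this.congr fun n => ?_
      rw [charFun_apply_real]
      congr with y
      ring_nf
  have hcomp : IsCompact (closure (Set.range μ)) := by
    apply isCompact_closure_of_isTightMeasureSet
    convert! htight using 1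
    ext m
    simp
  obtain ⟨ρ, -, k, hk, hρ⟩ := hcomp.tendsto_subseq (fun n => subset_closure (mem_range_self n))
  have hweak := (ProbabilityMeasure.tendsto_iff_forall_integral_rclike_tendsto ℂ).1 hρ
  have hρneg : (ρ : Measure ℝ) (Iio 0) = 0 := by
    have h0 := ProbabilityMeasure.le_liminf_measure_open_of_tendsto hρ (isOpen_Iio (a := (0 : ℝ)))
    have h1 : (fun i => ((μ ∘ k) i : Measure ℝ) (Iio 0)) = fun _ => 0 := by
      ext i; exact hμneg _
    rw [h1] at h0
    simpa using h0
  refine ⟨ρ, inferInstance, hρneg, fun z hz => ?_⟩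
  -- Weak convergence only tests bounded continuous functions, while `e^{zy}` may be unbounded for
  -- `y < 0`. Replacing `y` by `max y 0` changes no integral, as all measures involved are carried
  -- by `[0,∞)`.
  let F : BoundedContinuousFunction ℝ ℂ := BoundedContinuousFunction.ofNormedAddCommGroup
    (fun y : ℝ => Complex.exp (z * (max y 0 : ℝ))) (by fun_prop) 1
    (fun y => norm_exp_mul_le_one hz (le_max_right _ _))
  have hF : ∀ {m : Measure ℝ}, m (Iio 0) = 0 → ∫ y, F y ∂m = ∫ y : ℝ, Complex.exp (z * y) ∂m :=
    fun hm => integral_congr_ae <| by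
      filter_upwards [ae_nonneg_of_null_neg hm] with y hy
      simp [F, hy]
  have h2 := hweak F
  rw [hF hρneg] at h2
  refine tendsto_nhds_unique h2 ?_
  refine ((hlim z hz).comp hk.tendsto_atTop).congr fun n => ?_
  exact (hF (hμneg _)).symm

end IsOneSidedLevy

end GenFrac

namespace GenFrac

variable {ν : Measure ℝ}

/-! ### The convolution semigroup of subordinator laws -/

namespace IsOneSidedLevy

lemma isSubordinatorLaw (hν : IsOneSidedLevy ν) {t : ℝ} (ht : 0 ≤ t) :
    IsSubordinatorLaw ν t (subordinatorLaw ν t) := by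
  have h : ∃ μ, IsSubordinatorLaw ν t μ := by
    obtain ⟨μ, h1, h2, h3⟩ := hν.exists_law ht
    refine ⟨μ, h1, h2, fun p => ?_⟩
    have := h3 (p * Complex.I) (by simp)
    rw [charFun_apply_real, symbol, hν.restrict_Ioi]
    simpa only [mul_right_comm _ Complex.I] using this
  rw [subordinatorLaw, dif_pos h]
  exact h.choose_spec

lemma isProb (hν : IsOneSidedLevy ν) {t : ℝ} (ht : 0 ≤ t) :
    IsProbabilityMeasure (subordinatorLaw ν t) := (hν.isSubordinatorLaw ht).isProbabilityMeasure

lemma law_null_neg (hν : IsOneSidedLevy ν) {t : ℝ} (ht : 0 ≤ t) :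
    subordinatorLaw ν t (Iio 0) = 0 := (hν.isSubordinatorLaw ht).null_neg

lemma law_ae_nonneg (hν : IsOneSidedLevy ν) {t : ℝ} (ht : 0 ≤ t) :
    ∀ᵐ y ∂(subordinatorLaw ν t), 0 ≤ y := ae_nonneg_of_null_neg (hν.law_null_neg ht)

end IsOneSidedLevy

lemma IsSubordinatorLaw.unique {t : ℝ} {μ ρ : Measure ℝ} (hμ : IsSubordinatorLaw ν t μ)
    (hρ : IsSubordinatorLaw ν t ρ) : μ = ρ := by
  have := hμ.isProbabilityMeasure
  have := hρ.isProbabilityMeasure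
  exact Measure.ext_of_charFun (funext fun p => by rw [hμ.charFun_eq, hρ.charFun_eq])

namespace IsOneSidedLevy

lemma law_zero (hν : IsOneSidedLevy ν) : subordinatorLaw ν 0 = Measure.dirac 0 :=
  (hν.isSubordinatorLaw le_rfl).unique
    ⟨inferInstance, by simp, fun p => by simp⟩

lemma law_add (hν : IsOneSidedLevy ν) {s t : ℝ} (hs : 0 ≤ s) (ht : 0 ≤ t) :
    subordinatorLaw ν (s + t) = subordinatorLaw ν s ∗ subordinatorLaw ν t := by
  have := hν.isProb hs
  have := hν.isProb ht
  refine (hν.isSubordinatorLaw (add_nonneg hs ht)).unique ⟨inferInstance,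
    conv_null_neg (hν.law_null_neg hs) (hν.law_null_neg ht), fun p => ?_⟩
  rw [charFun_conv, (hν.isSubordinatorLaw hs).charFun_eq, (hν.isSubordinatorLaw ht).charFun_eq,
    ← Complex.exp_add]
  push_cast
  ring_nf

/-! ### Laplace transforms and tail bounds of the subordinator laws -/

lemma integrable_one_sub_exp (hν : IsOneSidedLevy ν) {l : ℝ} (hl : 0 ≤ l) :
    Integrable (fun y : ℝ => 1 - Real.exp (-(l * y))) ν := by
  refine hν.integrable_of_norm_le (C := 2 * max 1 ‖-(l : ℂ)‖) (by fun_prop) fun y hy => ?_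
  have := norm_exp_mul_sub_one_le (z := -(l : ℂ)) (by simpa using hl) hy.le
  rw [norm_sub_rev] at this
  refine le_trans (le_of_eq ?_) this
  rw [← Complex.norm_real]
  push_cast
  ring_nf

/-- The definition prescribes only the characteristic function. By uniqueness the law is the one
built in `exists_law`, whose transform is known on the whole closed left half-plane, in particular
at `z = -l`. -/
lemma laplace (hν : IsOneSidedLevy ν) {t : ℝ} (ht : 0 ≤ t) {l : ℝ} (hl : 0 ≤ l) :
    ∫ y, Real.exp (-(l * y)) ∂(subordinatorLaw ν t) = Real.exp (-(t * laplaceExponent ν l)) := by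
  obtain ⟨μ, h1, h2, h3⟩ := hν.exists_law ht
  have hμ : subordinatorLaw ν t = μ := by
    refine (hν.isSubordinatorLaw ht).unique ⟨h1, h2, fun p => ?_⟩
    have := h3 (p * Complex.I) (by simp)
    rw [charFun_apply_real, symbol, hν.restrict_Ioi]
    simpa only [mul_right_comm _ Complex.I] using this
  have := h3 (-(l : ℂ)) (by simpa using hl)
  rw [hμ, laplaceExponent, hν.restrict_Ioi, ← Complex.ofReal_inj, ← integral_complex_ofReal]
  push_cast
  rw [← integral_complex_ofReal]
  push_cast
  simp_rw [neg_mul] at this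
  rw [this, ← mul_neg, ← integral_neg]
  simp

lemma integrable_exp_law (hν : IsOneSidedLevy ν) {t : ℝ} (ht : 0 ≤ t) {l : ℝ} (hl : 0 ≤ l) :
    Integrable (fun y => Real.exp (-(l * y))) (subordinatorLaw ν t) := by
  have := hν.isProb ht
  refine Integrable.of_bound (C := 1) (by fun_prop) ?_
  filter_upwards [hν.law_ae_nonneg ht] with y hy
  simpa using mul_nonneg hl hy

lemma laplaceExponent_pos (hν : IsOneSidedLevy ν) (hν0 : ν ≠ 0) {l : ℝ} (hl : 0 < l) :
    0 < laplaceExponent ν l := by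
  rw [laplaceExponent, hν.restrict_Ioi, integral_pos_iff_support_of_nonneg_ae _
    (hν.integrable_one_sub_exp hl.le)]
  · have : 0 < ν (Ioi 0) := by
      rw [pos_iff_ne_zero]
      intro h
      apply hν0
      rw [← hν.restrict_Ioi]
      exact Measure.restrict_eq_zero.2 h
    refine this.trans_le (measure_mono fun y (hy : 0 < y) => ?_)
    have : Real.exp (-(l * y)) < 1 := by simpa using mul_pos hl hy
    exact (sub_pos.2 this).ne'
  · filter_upwards [hν.ae_pos] with y hy
    have : Real.exp (-(l * y)) ≤ 1 := by simpa using (mul_pos hl hy).le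
    simpa using mul_nonneg hl.le hy.le

/-- Chernoff's bound, from `1_{y ≤ z} ≤ e^{l(z - y)}`. The exponential decay in `t` is what makes
the potential converge. -/
lemma law_real_Iic_le (hν : IsOneSidedLevy ν) {t : ℝ} (ht : 0 ≤ t) {l : ℝ} (hl : 0 ≤ l) (z : ℝ) :
    (subordinatorLaw ν t).real (Iic z) ≤
      Real.exp (l * z) * Real.exp (-(t * laplaceExponent ν l)) := by
  have := hν.isProb ht
  rw [← hν.laplace ht hl, ← integral_const_mul, ← integral_indicator_one measurableSet_Iic]
  refine integral_mono ((integrable_const _).indicator measurableSet_Iic)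
    ((hν.integrable_exp_law ht hl).const_mul _) fun y => ?_
  by_cases hy : y ∈ Iic z
  · simp only [hy, indicator_of_mem, Pi.one_apply, ← Real.exp_add]
    rw [Real.one_le_exp_iff]
    have := mul_le_mul_of_nonneg_left (mem_Iic.1 hy) hl
    linarith
  · simp only [hy, not_false_eq_true, indicator_of_notMem]
    positivity

/-- Markov's inequality for `1 - e^{-y}`: this function is at least `1 - e^{-r}` on `[r,∞)`, and its
mean `1 - e^{-tφ(1)}` is at most `tφ(1)`. -/
lemma law_real_Ici_le (hν : IsOneSidedLevy ν) {t : ℝ} (ht : 0 ≤ t) {r : ℝ} (hr : 0 < r) :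
    (subordinatorLaw ν t).real (Ici r) ≤ t * laplaceExponent ν 1 / (1 - Real.exp (-r)) := by
  have := hν.isProb ht
  have h1 : 0 < 1 - Real.exp (-r) := by simpa using hr
  rw [le_div_iff₀ h1, mul_comm]
  have h2 : 1 - Real.exp (-(t * laplaceExponent ν 1)) ≤ t * laplaceExponent ν 1 := by
    have := Real.add_one_le_exp (-(t * laplaceExponent ν 1))
    linarith
  refine le_trans ?_ h2
  rw [← hν.laplace ht zero_le_one, ← integral_indicator_one measurableSet_Ici,
    ← integral_const_mul]
  have h3 : 1 - ∫ y, Real.exp (-(1 * y)) ∂(subordinatorLaw ν t) =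
      ∫ y, (1 - Real.exp (-(1 * y))) ∂(subordinatorLaw ν t) := by
    rw [integral_sub (integrable_const _) (hν.integrable_exp_law ht zero_le_one)]
    simp
  rw [h3]
  refine integral_mono_ae (((integrable_const _).indicator measurableSet_Ici).const_mul _)
    ((integrable_const _).sub (hν.integrable_exp_law ht zero_le_one)) ?_
  filter_upwards [hν.law_ae_nonneg ht] with y hy
  by_cases hy' : y ∈ Ici r
  · simp only [hy', indicator_of_mem, Pi.one_apply, mul_one, one_mul]
    have : Real.exp (-y) ≤ Real.exp (-r) := Real.exp_le_exp.2 (neg_le_neg hy')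
    linarith
  · simp only [hy', not_false_eq_true, indicator_of_notMem, mul_zero, one_mul]
    have : Real.exp (-y) ≤ 1 := by simpa using hy
    linarith

lemma tendsto_law_real_Ici (hν : IsOneSidedLevy ν) {r : ℝ} (hr : 0 < r) :
    Tendsto (fun t => (subordinatorLaw ν t).real (Ici r)) (𝓝[>] 0) (𝓝 0) := by
  have h : Tendsto (fun t => t * laplaceExponent ν 1 / (1 - Real.exp (-r))) (𝓝[>] 0) (𝓝 0) := by
    have : Continuous fun t : ℝ => t * laplaceExponent ν 1 / (1 - Real.exp (-r)) := by fun_prop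
    simpa using (this.tendsto 0).mono_left nhdsWithin_le_nhds
  refine squeeze_zero' (Eventually.of_forall fun t => measureReal_nonneg) ?_ h
  filter_upwards [self_mem_nhdsWithin] with t ht
  exact hν.law_real_Ici_le (le_of_lt ht) hr

/-- Passing from time `s` to time `t` convolves with a law on `[0,∞)`, which moves mass only to the
right. -/
lemma law_Ici_mono (hν : IsOneSidedLevy ν) {s t : ℝ} (hs : 0 ≤ s) (hst : s ≤ t) (z : ℝ) :
    subordinatorLaw ν s (Ici z) ≤ subordinatorLaw ν t (Ici z) := by
  obtain ⟨r, rfl⟩ := exists_add_of_le hst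
  have hr : 0 ≤ r := by linarith
  have := hν.isProb hs
  have := hν.isProb hr
  rw [hν.law_add hs hr, Measure.conv, Measure.map_apply (by fun_prop) measurableSet_Ici]
  calc subordinatorLaw ν s (Ici z) = ((subordinatorLaw ν s).prod (subordinatorLaw ν r))
        (Ici z ×ˢ Ici 0) := by
        have h0 : subordinatorLaw ν r (Ici 0) = 1 := by
          rw [← compl_Iio, prob_compl_eq_one_iff measurableSet_Iio, hν.law_null_neg hr]
        rw [Measure.prod_prod, h0, mul_one]
    _ ≤ _ := measure_mono fun p hp => by
        have h1 : z ≤ p.1 := hp.1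
        have h2 : 0 ≤ p.2 := hp.2
        simp only [mem_preimage, mem_Ici]
        linarith

lemma tailFun_mono (hν : IsOneSidedLevy ν) (z : ℝ) : Monotone (tailFun ν z) := fun s t hst => by
  have := hν.isProb (le_max_right t 0)
  exact ENNReal.toReal_mono (measure_ne_top _ _)
    (hν.law_Ici_mono (le_max_right _ _) (max_le_max_right 0 hst) z)

/-- The laws of the subordinator as a Markov kernel in the time variable. -/
noncomputable def lawKernel (hν : IsOneSidedLevy ν) : ProbabilityTheory.Kernel ℝ ℝ where
  toFun t := subordinatorLaw ν (max t 0)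
  measurable' := by
    have : ∀ t : ℝ, IsProbabilityMeasure (subordinatorLaw ν (max t 0)) :=
      fun t => hν.isProb (le_max_right _ _)
    -- Measurability in `t` need only be checked on the π-system of half-lines `[z,∞)`, where it
    -- follows from monotonicity.
    refine Measurable.measure_of_isPiSystem_of_isProbabilityMeasure
      ((BorelSpace.measurable_eq (α := ℝ)).trans (borel_eq_generateFrom_Ici ℝ)) isPiSystem_Ici ?_
    rintro _ ⟨z, rfl⟩
    exact Monotone.measurable fun s t hst =>
      hν.law_Ici_mono (le_max_right _ _) (max_le_max_right 0 hst) z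

lemma lawKernel_apply (hν : IsOneSidedLevy ν) {t : ℝ} (ht : 0 ≤ t) :
    hν.lawKernel t = subordinatorLaw ν t := by
  change subordinatorLaw ν (max t 0) = _
  rw [max_eq_left ht]

instance (hν : IsOneSidedLevy ν) : ProbabilityTheory.IsMarkovKernel hν.lawKernel :=
  ⟨fun _ => hν.isProb (le_max_right _ _)⟩

/-- Chernoff's bound integrated over `t`: the origin of the constant `e^{lz}/φ_ν(l)` in every later
estimate. -/
lemma lintegral_law_Iic_le (hν : IsOneSidedLevy ν) (hν0 : ν ≠ 0) {l : ℝ} (hl : 0 < l) (z : ℝ) :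
    ∫⁻ t in Ioi 0, hν.lawKernel t (Iic z) ≤
      ENNReal.ofReal (Real.exp (l * z) / laplaceExponent ν l) := by
  have hφ := hν.laplaceExponent_pos hν0 hl
  have hinteg : IntegrableOn (fun t => Real.exp (l * z) * Real.exp (-laplaceExponent ν l * t))
      (Ioi 0) := (integrableOn_exp_mul_Ioi (by linarith) 0).const_mul _
  calc ∫⁻ t in Ioi 0, hν.lawKernel t (Iic z)
      ≤ ∫⁻ t in Ioi 0,
          ENNReal.ofReal (Real.exp (l * z) * Real.exp (-laplaceExponent ν l * t)) := by
        refine setLIntegral_mono' measurableSet_Ioi fun t (ht : 0 < t) => ?_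
        have := hν.isProb ht.le
        rw [hν.lawKernel_apply ht.le, ← ofReal_measureReal]
        refine ENNReal.ofReal_le_ofReal ((hν.law_real_Iic_le ht.le hl.le z).trans (le_of_eq ?_))
        ring_nf
    _ = ENNReal.ofReal (Real.exp (l * z) / laplaceExponent ν l) := by
        rw [← ofReal_integral_eq_lintegral_ofReal hinteg
          (Eventually.of_forall fun t => by positivity), integral_const_mul,
          integral_exp_mul_Ioi (by linarith)]
        simp [div_eq_mul_inv]

/-- The measure `dt G(t, dy)` on `(0, ∞) × [0, R]`. -/
noncomputable def potMeasure (hν : IsOneSidedLevy ν) (R : ℝ) : Measure (ℝ × ℝ) :=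
  (volume.restrict (Ioi (0 : ℝ))).compProd
    (hν.lawKernel.restrict (measurableSet_Icc (a := (0 : ℝ)) (b := R)))

lemma potMeasure_univ_le (hν : IsOneSidedLevy ν) (hν0 : ν ≠ 0) {l : ℝ} (hl : 0 < l) (R : ℝ) :
    hν.potMeasure R univ ≤ ENNReal.ofReal (Real.exp (l * R) / laplaceExponent ν l) := by
  refine le_trans ?_ (hν.lintegral_law_Iic_le hν0 hl R)
  rw [potMeasure, ← univ_prod_univ, Measure.compProd_apply_prod MeasurableSet.univ
    MeasurableSet.univ, Measure.restrict_univ]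
  refine lintegral_mono fun t => ?_
  rw [ProbabilityTheory.Kernel.restrict_apply, Measure.restrict_apply_univ]
  exact measure_mono Icc_subset_Iic_self

lemma potMeasure_finite (hν : IsOneSidedLevy ν) (hν0 : ν ≠ 0) (R : ℝ) :
    IsFiniteMeasure (hν.potMeasure R) :=
  ⟨(hν.potMeasure_univ_le hν0 one_pos R).trans_lt ENNReal.ofReal_lt_top⟩

lemma potMeasure_real_univ_le (hν : IsOneSidedLevy ν) (hν0 : ν ≠ 0) {l : ℝ} (hl : 0 < l) (R : ℝ) :
    (hν.potMeasure R).real univ ≤ Real.exp (l * R) / laplaceExponent ν l :=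
  ENNReal.toReal_le_of_le_ofReal
    (div_nonneg (Real.exp_nonneg _) (hν.laplaceExponent_pos hν0 hl).le)
    (hν.potMeasure_univ_le hν0 hl R)

lemma potMeasure_ae (hν : IsOneSidedLevy ν) (R : ℝ) :
    ∀ᵐ p ∂(hν.potMeasure R), 0 < p.1 ∧ 0 ≤ p.2 ∧ p.2 ≤ R := by
  refine Measure.ae_compProd_of_ae_ae (by measurability) ?_
  filter_upwards [ae_restrict_mem measurableSet_Ioi] with t ht
  rw [ProbabilityTheory.Kernel.restrict_apply]
  filter_upwards [ae_restrict_mem measurableSet_Icc] with y hy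
  exact ⟨ht, hy.1, hy.2⟩

end IsOneSidedLevy

end GenFrac

namespace GenFrac

variable {B : Type*} [NormedAddCommGroup B] [NormedSpace ℝ B]

/-! ### Contraction semigroups and their generators -/

lemma norm_average_sub_le [CompleteSpace B] {F : ℝ → B} {t ε : ℝ} {c : B} (ht : 0 < t)
    (hF : IntervalIntegrable F volume 0 t) (h : ∀ s, 0 < s → s ≤ t → ‖F s - c‖ ≤ ε) :
    ‖t⁻¹ • (∫ s in (0 : ℝ)..t, F s) - c‖ ≤ ε := by
  have h1 : t⁻¹ • (∫ s in (0 : ℝ)..t, F s) - c = t⁻¹ • ∫ s in (0 : ℝ)..t, (F s - c) := by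
    rw [intervalIntegral.integral_sub hF (by simp), intervalIntegral.integral_const, sub_zero,
      smul_sub, smul_smul, inv_mul_cancel₀ ht.ne', one_smul]
  have h2 : ‖∫ s in (0 : ℝ)..t, (F s - c)‖ ≤ ε * |t - 0| :=
    intervalIntegral.norm_integral_le_of_norm_le_const fun s hs => by
      rw [uIoc_of_le ht.le] at hs
      exact h s hs.1 hs.2
  rw [h1, norm_smul, norm_inv, Real.norm_of_nonneg ht.le, inv_mul_le_iff₀ ht]
  rw [sub_zero, abs_of_pos ht] at h2
  linarith

namespace IsContractionSemigroup

variable {S : ℝ → B →L[ℝ] B}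

lemma norm_apply_le (hS : IsContractionSemigroup S) {t : ℝ} (ht : 0 ≤ t) (Y : B) :
    ‖S t Y‖ ≤ ‖Y‖ :=
  ((S t).le_of_opNorm_le (hS.norm_le_one t ht) Y).trans (one_mul _).le

lemma add_apply (hS : IsContractionSemigroup S) {s t : ℝ} (hs : 0 ≤ s) (ht : 0 ≤ t) (Y : B) :
    S (s + t) Y = S s (S t Y) := by rw [hS.add s t hs ht]; rfl

lemma zero_apply (hS : IsContractionSemigroup S) (Y : B) : S 0 Y = Y := by rw [hS.zero]; rfl

/-- Factoring out the contraction at the earlier time bounds every increment of the orbit by an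
increment starting at time `0`. -/
lemma norm_sub_apply_le (hS : IsContractionSemigroup S) {s t : ℝ} (hs : 0 ≤ s) (ht : 0 ≤ t)
    (Y : B) : ‖S t Y - S s Y‖ ≤ ‖S |t - s| Y - Y‖ := by
  wlog h : s ≤ t generalizing s t
  · rw [norm_sub_rev, abs_sub_comm]
    exact this ht hs (le_of_not_ge h)
  rw [abs_of_nonneg (sub_nonneg.2 h)]
  have : S t Y - S s Y = S s (S (t - s) Y - Y) := by
    rw [map_sub, ← hS.add_apply hs (sub_nonneg.2 h), add_sub_cancel]
  rw [this]
  exact hS.norm_apply_le hs _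

lemma continuous_max_apply (hS : IsContractionSemigroup S) (Y : B) :
    Continuous fun t : ℝ => S (max t 0) Y := by
  rw [continuous_iff_continuousAt]
  intro t₀
  have h0 : Tendsto (fun r => S r Y) (𝓝[≥] 0) (𝓝 Y) := by
    rw [← Ioi_insert, nhdsWithin_insert, tendsto_sup]
    refine ⟨?_, hS.tendsto_zero Y⟩
    rw [tendsto_pure_left]
    intro s hs
    rw [hS.zero_apply]
    exact mem_of_mem_nhds hs
  have h1 : Tendsto (fun t : ℝ => |max t 0 - max t₀ 0|) (𝓝 t₀) (𝓝[≥] 0) := by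
    refine tendsto_nhdsWithin_iff.2 ⟨?_, Eventually.of_forall fun t => mem_Ici.2 (abs_nonneg _)⟩
    have : Continuous fun t : ℝ => |max t 0 - max t₀ 0| := by fun_prop
    simpa using this.tendsto t₀
  have h2 := h0.comp h1
  rw [tendsto_iff_norm_sub_tendsto_zero] at h2
  rw [ContinuousAt, tendsto_iff_norm_sub_tendsto_zero]
  exact squeeze_zero (fun _ => norm_nonneg _)
    (fun t => hS.norm_sub_apply_le (le_max_right _ _) (le_max_right _ _) Y) h2

/-- Strong continuity together with the uniform bound `‖S t‖ ≤ 1`. The truncation `max t 0` is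
needed because nothing is assumed about `S` at negative times. -/
lemma continuous_uncurry (hS : IsContractionSemigroup S) :
    Continuous fun p : ℝ × B => S (max p.1 0) p.2 := by
  rw [continuous_iff_continuousAt]
  rintro ⟨t₀, Y₀⟩
  rw [ContinuousAt, tendsto_iff_norm_sub_tendsto_zero]
  have h1 : Tendsto (fun p : ℝ × B => ‖p.2 - Y₀‖ + ‖S (max p.1 0) Y₀ - S (max t₀ 0) Y₀‖)
      (𝓝 (t₀, Y₀)) (𝓝 0) := by
    have := hS.continuous_max_apply Y₀
    have : Continuous fun p : ℝ × B => ‖p.2 - Y₀‖ + ‖S (max p.1 0) Y₀ - S (max t₀ 0) Y₀‖ :=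
      (continuous_snd.sub continuous_const).norm.add
        ((this.comp continuous_fst).sub continuous_const).norm
    simpa using this.tendsto (t₀, Y₀)
  refine squeeze_zero (fun _ => norm_nonneg _) (fun p => ?_) h1
  have : S (max p.1 0) p.2 - S (max t₀ 0) Y₀ = S (max p.1 0) (p.2 - Y₀) +
      (S (max p.1 0) Y₀ - S (max t₀ 0) Y₀) := by
    rw [map_sub]; abel
  rw [this]
  refine (norm_add_le _ _).trans ?_
  gcongr
  exact hS.norm_apply_le (le_max_right _ _) _

lemma continuousOn_apply (hS : IsContractionSemigroup S) (Y : B) :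
    ContinuousOn (fun t => S t Y) (Ici 0) :=
  (hS.continuous_max_apply Y).continuousOn.congr fun t (ht : 0 ≤ t) => by
    simp only [max_eq_left ht]

lemma intervalIntegrable (hS : IsContractionSemigroup S) (Y : B) {s t : ℝ} (hs : 0 ≤ s)
    (ht : 0 ≤ t) : IntervalIntegrable (fun r => S r Y) volume s t :=
  ((hS.continuousOn_apply Y).mono fun _ hx => (le_min hs ht).trans hx.1).intervalIntegrable

/-- Joint continuity makes convergence at `t = 0` uniform over compact sets. Applied to the compact
range of a clamped function, this gives estimates uniform in `x`. -/
lemma eventually_norm_sub_lt (hS : IsContractionSemigroup S) {K : Set B} (hK : IsCompact K)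
    {ε : ℝ} (hε : 0 < ε) : ∀ᶠ t in 𝓝[>] (0 : ℝ), ∀ Y ∈ K, ‖S t Y - Y‖ < ε := by
  have h : ∀ᶠ t in 𝓝 (0 : ℝ), ∀ Y ∈ K, ‖S (max t 0) Y - Y‖ < ε := by
    refine hK.eventually_forall_of_forall_eventually fun Y _ => ?_
    have hc : Continuous fun p : ℝ × B => ‖S (max p.1 0) p.2 - p.2‖ :=
      (hS.continuous_uncurry.sub continuous_snd).norm
    have h0 : ‖S (max (0 : ℝ) 0) Y - Y‖ < ε := by simpa [hS.zero_apply] using hε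
    exact hc.continuousAt.eventually_lt continuousAt_const h0
  filter_upwards [h.filter_mono nhdsWithin_le_nhds, self_mem_nhdsWithin] with t ht ht'
  intro Y hY
  simpa [max_eq_left (le_of_lt (mem_Ioi.1 ht'))] using ht Y hY

variable [CompleteSpace B]

lemma tendsto_average (hS : IsContractionSemigroup S) (Y : B) :
    Tendsto (fun t : ℝ => t⁻¹ • ∫ s in (0 : ℝ)..t, S s Y) (𝓝[>] 0) (𝓝 Y) := by
  rw [Metric.tendsto_nhds]
  intro ε hε
  have h := hS.eventually_norm_sub_lt (isCompact_singleton (x := Y)) (half_pos hε)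
  obtain ⟨r, hr, h'⟩ := mem_nhdsGT_iff_exists_Ioc_subset.1 h
  filter_upwards [Ioc_mem_nhdsGT hr] with t ht
  rw [dist_eq_norm]
  refine lt_of_le_of_lt (norm_average_sub_le ht.1
    (hS.intervalIntegrable Y le_rfl ht.1.le) fun s hs hst => ?_) (half_lt_self hε)
  exact (h' ⟨hs, hst.trans ht.2⟩ Y rfl).le

variable {A : B →ₗ.[ℝ] B}

/-- At `x` the orbit has right derivative `S x Z`, because `S y = S x ∘ S (y - x)` for `y > x`; the
fundamental theorem of calculus asks for no more than a right derivative. -/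
lemma apply_sub_eq_integral (hS : IsContractionSemigroup S) (hA : IsGenerator A S) {Y Z : B}
    (h : (Y, Z) ∈ A.graph) {t : ℝ} (ht : 0 ≤ t) : S t Y - Y = ∫ s in (0 : ℝ)..t, S s Z := by
  have hd : ∀ x ∈ Ioo 0 t, HasDerivWithinAt (fun s => S s Y) (S x Z) (Ioi x) x := fun x hx => by
    have h1 := (hA Y Z).1 h
    have h2 : Tendsto (fun r : ℝ => S x (r⁻¹ • (S r Y - Y))) (𝓝[>] 0) (𝓝 (S x Z)) :=
      ((S x).continuous.tendsto _).comp h1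
    rw [hasDerivWithinAt_iff_tendsto_slope' (by simp)]
    have h3 : Tendsto (fun y => y - x) (𝓝[>] x) (𝓝[>] 0) := by
      refine tendsto_nhdsWithin_iff.2 ⟨?_, ?_⟩
      · have : Continuous fun y : ℝ => y - x := by fun_prop
        simpa using (this.tendsto x).mono_left nhdsWithin_le_nhds
      · filter_upwards [self_mem_nhdsWithin] with y hy
        exact mem_Ioi.2 (sub_pos.2 hy)
    refine (h2.comp h3).congr' ?_
    filter_upwards [self_mem_nhdsWithin] with y hy
    simp only [Function.comp, slope_def_module, map_smul, map_sub]
    rw [← hS.add_apply hx.1.le (sub_nonneg.2 (le_of_lt hy)), add_sub_cancel]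
  have := intervalIntegral.integral_eq_sub_of_hasDeriv_right_of_le ht
    ((hS.continuousOn_apply Y).mono fun x hx => hx.1) hd
    (hS.intervalIntegrable Z le_rfl ht)
  rw [this, hS.zero_apply]

lemma mem_graph_of_forall (hS : IsContractionSemigroup S) (hA : IsGenerator A S) {Y Z : B}
    (h : ∀ t : ℝ, 0 < t → S t Y - Y = ∫ s in (0 : ℝ)..t, S s Z) : (Y, Z) ∈ A.graph := by
  rw [hA]
  refine (hS.tendsto_average Z).congr' ?_
  filter_upwards [self_mem_nhdsWithin] with t ht
  rw [h t ht]

/-- The generator is closed: the integrated identity `S t Y - Y = ∫_0^t S s Z ds` passes to the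
limit, and it characterizes the graph. -/
lemma mem_graph_of_tendsto (hS : IsContractionSemigroup S) (hA : IsGenerator A S) {Y Z : B}
    {Yn Zn : ℕ → B} (h : ∀ n, (Yn n, Zn n) ∈ A.graph) (hY : Tendsto Yn atTop (𝓝 Y))
    (hZ : Tendsto Zn atTop (𝓝 Z)) : (Y, Z) ∈ A.graph := by
  refine hS.mem_graph_of_forall hA fun t ht => ?_
  have h1 : Tendsto (fun n => S t (Yn n) - Yn n) atTop (𝓝 (S t Y - Y)) :=
    (((S t).continuous.tendsto _).comp hY).sub hY
  have h2 : Tendsto (fun n => ∫ s in (0 : ℝ)..t, S s (Zn n)) atTop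
      (𝓝 (∫ s in (0 : ℝ)..t, S s Z)) := by
    rw [tendsto_iff_norm_sub_tendsto_zero] at hZ ⊢
    have h3 : Tendsto (fun n => ‖Zn n - Z‖ * |t - 0|) atTop (𝓝 0) := by
      simpa using hZ.mul_const |t - 0|
    refine squeeze_zero (fun _ => norm_nonneg _) (fun n => ?_) h3
    rw [← intervalIntegral.integral_sub (hS.intervalIntegrable _ le_rfl ht.le)
      (hS.intervalIntegrable _ le_rfl ht.le)]
    refine intervalIntegral.norm_integral_le_of_norm_le_const fun s hs => ?_
    rw [uIoc_of_le ht.le] at hs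
    rw [← map_sub]
    exact hS.norm_apply_le hs.1.le _
  refine tendsto_nhds_unique h1 (h2.congr fun n => ?_)
  exact (hS.apply_sub_eq_integral hA (h n) ht.le).symm

/-- Both `S_r ∫_0^t - ∫_0^t` and `S_t ∫_0^r - ∫_0^r`, applied to the orbit of `Y`, equal `∫_t^{t+r}
- ∫_0^r`. So the quotient in `r` can be computed from means over `[0,r]`, which tend to `Y`. -/
lemma average_mem_graph (hS : IsContractionSemigroup S) (hA : IsGenerator A S) (Y : B) {t : ℝ}
    (ht : 0 < t) : (∫ s in (0 : ℝ)..t, S s Y, S t Y - Y) ∈ A.graph := by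
  rw [hA]
  have h1 : ∀ r : ℝ, 0 < r → S r (∫ s in (0 : ℝ)..t, S s Y) - ∫ s in (0 : ℝ)..t, S s Y =
      S t (∫ s in (0 : ℝ)..r, S s Y) - ∫ s in (0 : ℝ)..r, S s Y := fun r hr => by
    have hI := fun {a b : ℝ} (ha : 0 ≤ a) (hb : 0 ≤ b) => hS.intervalIntegrable Y ha hb
    have e : ∀ {p q : ℝ}, 0 ≤ p → 0 ≤ q →
        S p (∫ s in (0 : ℝ)..q, S s Y) = ∫ s in p..p + q, S s Y := fun {p q} hp hq => by
      rw [← ContinuousLinearMap.intervalIntegral_comp_comm _ (hI le_rfl hq)]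
      have : ∫ s in (0 : ℝ)..q, S p (S s Y) = ∫ s in (0 : ℝ)..q, S (p + s) Y := by
        refine intervalIntegral.integral_congr fun s hs => ?_
        rw [uIcc_of_le hq] at hs
        exact (hS.add_apply hp hs.1 Y).symm
      rw [this, intervalIntegral.integral_comp_add_left (fun s => S s Y), add_zero]
    rw [e hr.le ht.le, e ht.le hr.le, sub_eq_sub_iff_add_eq_add, add_comm,
      add_comm (∫ s in t..t + r, S s Y),
      intervalIntegral.integral_add_adjacent_intervals (hI le_rfl hr.le) (hI hr.le (by positivity)),
      intervalIntegral.integral_add_adjacent_intervals (hI le_rfl ht.le) (hI ht.le (by positivity)),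
      add_comm r t]
  have h2 := hS.tendsto_average Y
  have h3 : Tendsto (fun r : ℝ => S t (r⁻¹ • ∫ s in (0 : ℝ)..r, S s Y) -
      r⁻¹ • ∫ s in (0 : ℝ)..r, S s Y) (𝓝[>] 0) (𝓝 (S t Y - Y)) :=
    (((S t).continuous.tendsto _).comp h2).sub h2
  refine h3.congr' ?_
  filter_upwards [self_mem_nhdsWithin] with r hr
  rw [h1 r hr, map_smul, smul_sub]

lemma exists_seq_graph (hS : IsContractionSemigroup S) (hA : IsGenerator A S) (Y : B) :
    ∃ Yn Zn : ℕ → B, (∀ n, (Yn n, Zn n) ∈ A.graph) ∧ Tendsto Yn atTop (𝓝 Y) := by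
  have hp : ∀ n : ℕ, (0 : ℝ) < 1 / ((n : ℝ) + 1) := fun n => by positivity
  have hlim : Tendsto (fun n : ℕ => 1 / ((n : ℝ) + 1)) atTop (𝓝[>] 0) :=
    tendsto_nhdsWithin_iff.2 ⟨tendsto_one_div_add_atTop_nhds_zero_nat,
      Eventually.of_forall fun n => hp n⟩
  refine ⟨_, fun n => (1 / ((n : ℝ) + 1))⁻¹ • (S (1 / ((n : ℝ) + 1)) Y - Y), fun n => ?_,
    (hS.tendsto_average Y).comp hlim⟩
  exact A.graph.smul_mem ((1 / ((n : ℝ) + 1))⁻¹) (hS.average_mem_graph hA Y (hp n))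

end IsContractionSemigroup

end GenFrac

namespace GenFrac

variable {ν : Measure ℝ} {B : Type*} [NormedAddCommGroup B] [NormedSpace ℝ B]
  {S : ℝ → B →L[ℝ] B}

/-! ### Clamping functions to an interval -/

section clamp

variable {E : Type*} [NormedAddCommGroup E]

/-- The function that agrees with `g` on `[a, b]` and is constant on either side of it. -/
def clamp {E : Type*} (a b : ℝ) (g : ℝ → E) (x : ℝ) : E := g (max a (min b x))

lemma clamp_of_mem {E : Type*} {a b : ℝ} {g : ℝ → E} {x : ℝ} (hx : x ∈ Icc a b) :
    clamp a b g x = g x := by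
  rw [clamp, min_eq_right hx.2, max_eq_right hx.1]

lemma max_min_mem_Icc {a b : ℝ} (hab : a ≤ b) (x : ℝ) : max a (min b x) ∈ Icc a b :=
  ⟨le_max_left _ _, max_le hab (min_le_left _ _)⟩

lemma continuous_clamp {a b : ℝ} (hab : a ≤ b) {g : ℝ → E} (hg : ContinuousOn g (Icc a b)) :
    Continuous (clamp a b g) :=
  hg.comp_continuous (by fun_prop) (max_min_mem_Icc hab)

lemma exists_isCompact_clamp {a b : ℝ} (hab : a ≤ b) {g : ℝ → E} (hg : ContinuousOn g (Icc a b)) :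
    ∃ C, IsCompact C ∧ ∀ x, clamp a b g x ∈ C :=
  ⟨g '' Icc a b, isCompact_Icc.image_of_continuousOn hg,
    fun x => mem_image_of_mem _ (max_min_mem_Icc hab x)⟩

lemma exists_norm_clamp_le {a b : ℝ} (hab : a ≤ b) {g : ℝ → E} (hg : ContinuousOn g (Icc a b)) :
    ∃ K, 0 ≤ K ∧ ∀ x, ‖clamp a b g x‖ ≤ K := by
  obtain ⟨C, hC, h⟩ := exists_isCompact_clamp hab hg
  obtain ⟨K, hK⟩ := hC.isBounded.exists_norm_le
  exact ⟨K, (norm_nonneg _).trans (hK _ (h 0)), fun x => hK _ (h x)⟩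

lemma uniformContinuous_clamp {a b : ℝ} (hab : a ≤ b) {g : ℝ → E}
    (hg : ContinuousOn g (Icc a b)) : UniformContinuous (clamp a b g) := by
  have h1 := isCompact_Icc.uniformContinuousOn_of_continuous hg
  have h2 : UniformContinuous fun x : ℝ => max a (min b x) := by
    have : LipschitzWith 1 fun x : ℝ => max a (min b x) :=
      (LipschitzWith.id.const_min b).const_max a
    exact this.uniformContinuous
  rw [Metric.uniformContinuousOn_iff] at h1
  rw [Metric.uniformContinuous_iff] at h2 ⊢
  intro ε hε
  obtain ⟨δ, hδ, h⟩ := h1 ε hε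
  obtain ⟨δ', hδ', hclose⟩ := h2 δ hδ
  exact ⟨δ', hδ', fun x y hxy => h _ (max_min_mem_Icc hab _) _ (max_min_mem_Icc hab _) (hclose hxy)⟩

/-- The extension of `g` from `(a, b]` that vanishes on `(-∞, a]` and is constant on `[b, ∞)`. -/
noncomputable def cutExt (a b : ℝ) (g : ℝ → E) : ℝ → E := (Ioi a).indicator (clamp a b g)

lemma eqOn_cutExt {a b : ℝ} (g : ℝ → E) : EqOn g (cutExt a b g) (Ioc a b) := fun x hx => by
  rw [cutExt, indicator_of_mem (by exact hx.1), clamp_of_mem (Ioc_subset_Icc_self hx)]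

lemma cutExt_eq_zero {a b : ℝ} (g : ℝ → E) {x : ℝ} (hx : x ≤ a) : cutExt a b g x = 0 :=
  indicator_of_notMem (by simpa using hx) _

lemma stronglyMeasurable_cutExt {a b : ℝ} (hab : a ≤ b) {g : ℝ → E}
    (hg : ContinuousOn g (Icc a b)) : StronglyMeasurable (cutExt a b g) :=
  (continuous_clamp hab hg).stronglyMeasurable.indicator measurableSet_Ioi

lemma exists_norm_cutExt_le {a b : ℝ} (hab : a ≤ b) {g : ℝ → E} (hg : ContinuousOn g (Icc a b)) :
    ∃ K, 0 ≤ K ∧ ∀ x, ‖cutExt a b g x‖ ≤ K := by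
  obtain ⟨K, hK0, hK⟩ := exists_norm_clamp_le hab hg
  exact ⟨K, hK0, fun x => (norm_indicator_le_norm_self _ _).trans (hK x)⟩

end clamp

namespace IsKill

variable {k : ℕ} {a b : ℝ} {g : ℝ → B}

lemma continuousOn (hg : IsKill k a b g) : ContinuousOn g (Iic b) := hg.contDiffOn.continuousOn

lemma continuousOn_Icc (hg : IsKill k a b g) : ContinuousOn g (Icc a b) :=
  hg.continuousOn.mono fun _ hx => hx.2

lemma clamp_eq_zero (hg : IsKill k a b g) (hab : a ≤ b) {x : ℝ} (hx : x ≤ a) :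
    clamp a b g x = 0 := by
  rw [clamp, min_eq_right (hx.trans hab), max_eq_left hx]
  exact hg.eq_zero a le_rfl

lemma clamp_eq (hg : IsKill k a b g) (hab : a ≤ b) {x : ℝ} (hx : x ≤ b) :
    clamp a b g x = g x := by
  rcases le_total x a with h | h
  · rw [hg.clamp_eq_zero hab h, hg.eq_zero x h]
  · exact clamp_of_mem ⟨h, hx⟩

lemma of_continuousOn (hg : ContinuousOn g (Iic b)) (h0 : ∀ x ≤ a, g x = 0) : IsKill 0 a b g :=
  ⟨by simpa using hg, h0⟩

lemma of_le {j : ℕ} (hg : IsKill k a b g) (hj : j ≤ k) : IsKill j a b g :=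
  ⟨hg.contDiffOn.of_le (by exact_mod_cast hj), hg.eq_zero⟩

lemma derivWithin (hg : IsKill (k + 1) a b g) (hab : a < b) :
    IsKill k a b (derivWithin g (Iic b)) := by
  have hd : ContDiffOn ℝ k (_root_.derivWithin g (Iic b)) (Iic b) :=
    ((contDiffOn_succ_iff_derivWithin (uniqueDiffOn_Iic b)).1
      (by simpa using hg.contDiffOn)).2.2
  refine ⟨hd, fun x hx => ?_⟩
  have hlt : ∀ y < a, _root_.derivWithin g (Iic b) y = 0 := fun y hy => by
    have : g =ᶠ[𝓝 y] fun _ => 0 := by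
      filter_upwards [Iio_mem_nhds hy] with z hz using hg.eq_zero z (le_of_lt hz)
    rw [_root_.derivWithin_of_mem_nhds (Iic_mem_nhds (hy.trans hab)), this.deriv_eq]
    simp
  rcases hx.lt_or_eq with h | rfl
  · exact hlt x h
  -- At the endpoint `a` itself the value of the derivative is forced by its continuity from the
  -- left, where it is zero.
  · have h1 : Tendsto (_root_.derivWithin g (Iic b)) (𝓝[<] x)
        (𝓝 (_root_.derivWithin g (Iic b) x)) :=
      ((hd.continuousOn x hab.le).mono fun z hz => (le_of_lt hz).trans hab.le)
    refine tendsto_nhds_unique h1 (tendsto_const_nhds.congr' ?_)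
    filter_upwards [self_mem_nhdsWithin] with y hy using (hlt y hy).symm

end IsKill

/-- A `C¹` function on the line with bounded derivative that vanishes on `(-∞, a]`. -/
structure IsC1Kill (a K : ℝ) (u u' : ℝ → B) : Prop where
  hasDerivAt : ∀ x, HasDerivAt u (u' x) x
  continuous_deriv : Continuous u'
  norm_deriv_le : ∀ x, ‖u' x‖ ≤ K
  eq_zero : ∀ x ≤ a, u x = 0

lemma IsC1Kill.continuous {a K : ℝ} {u u' : ℝ → B} (hu : IsC1Kill a K u u') : Continuous u :=
  continuous_iff_continuousAt.2 fun x => (hu.hasDerivAt x).continuousAt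

/-- Integrating the clamped derivative extends `g` beyond `b` with a globally bounded derivative.
Differentiation under the integral can then be done on the whole line, without regard to the
endpoint `b`. -/
lemma IsKill.exists_isC1Kill [CompleteSpace B] {a b : ℝ} (hab : a < b) {g : ℝ → B}
    (hg : IsKill 1 a b g) :
    ∃ (K : ℝ) (u u' : ℝ → B), IsC1Kill a K u u' ∧ EqOn g u (Iic b) := by
  have hg' : IsKill 0 a b (_root_.derivWithin g (Iic b)) := hg.derivWithin hab
  set w := clamp a b (_root_.derivWithin g (Iic b)) with hw
  have hwc : Continuous w := continuous_clamp hab.le hg'.continuousOn_Icc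
  obtain ⟨K, -, hK⟩ := exists_norm_clamp_le hab.le hg'.continuousOn_Icc
  have hH0 : ∀ x ≤ a, ∫ s in a..x, w s = 0 := fun x hx => by
    have : ∫ s in a..x, w s = ∫ s in a..x, (0 : B) :=
      intervalIntegral.integral_congr fun s hs => by
        rw [uIcc_of_ge hx] at hs
        exact hg'.clamp_eq_zero hab.le hs.2
    simp [this]
  refine ⟨K, fun x => ∫ s in a..x, w s, w,
    ⟨fun x => (hwc.integral_hasStrictDerivAt a x).hasDerivAt, hwc, hK, hH0⟩, fun x hx => ?_⟩
  have hx : x ≤ b := hx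
  rcases le_total x a with h | h
  · simp only [hH0 x h, hg.eq_zero x h]
  · have h1 : ∫ s in a..x, w s = g x - g a := by
      refine intervalIntegral.integral_eq_sub_of_hasDeriv_right_of_le h
        (hg.continuousOn.mono fun y hy => mem_Iic.2 (hy.2.trans hx)) (fun y hy => ?_)
        (hwc.intervalIntegrable _ _)
      have hyb : y < b := hy.2.trans_le hx
      rw [hw, hg'.clamp_eq hab.le hyb.le]
      exact ((hg.contDiffOn.differentiableOn (by simp) y hyb.le).hasDerivWithinAt.hasDerivAt
        (Iic_mem_nhds hyb)).hasDerivWithinAt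
    simp [h1, hg.eq_zero a le_rfl]

/-! ### The potential operator -/

/-- The potential operator `g ↦ ∫_0^R U(dy) g(x-y)`. -/
noncomputable def potOp (hν : IsOneSidedLevy ν) (S : ℝ → B →L[ℝ] B) (R : ℝ) (g : ℝ → B) (x : ℝ) :
    B :=
  ∫ p, S (max p.1 0) (g (x - p.2)) ∂(hν.potMeasure R)

lemma stronglyMeasurable_semigroup (hS : IsContractionSemigroup S) {α : Type*} [MeasurableSpace α]
    {f : α → ℝ} {g : α → B} (hf : Measurable f) (hg : StronglyMeasurable g) :
    StronglyMeasurable fun p => S (max (f p) 0) (g p) :=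
  hS.continuous_uncurry.comp_stronglyMeasurable (hf.stronglyMeasurable.prodMk hg)

variable (hν : IsOneSidedLevy ν) (hν0 : ν ≠ 0) (hS : IsContractionSemigroup S)

section potOp
include hS

lemma potOp_ae_norm_le (R : ℝ) {g : ℝ → B} {x K : ℝ} (hK : ∀ s ∈ Icc (x - R) x, ‖g s‖ ≤ K) :
    ∀ᵐ p ∂(hν.potMeasure R), ‖S (max p.1 0) (g (x - p.2))‖ ≤ K := by
  filter_upwards [hν.potMeasure_ae R] with p hp
  exact (hS.norm_apply_le (le_max_right _ _) _).trans
    (hK _ ⟨by linarith [hp.2.2], by linarith [hp.2.1]⟩)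

lemma stronglyMeasurable_potOp_integrand {g : ℝ → B} (hg : StronglyMeasurable g) (x : ℝ) :
    StronglyMeasurable fun p : ℝ × ℝ => S (max p.1 0) (g (x - p.2)) :=
  stronglyMeasurable_semigroup hS measurable_fst
    (hg.comp_measurable (measurable_const.sub measurable_snd))

include hν0

lemma integrable_potOp (R : ℝ) {g : ℝ → B} (hg : StronglyMeasurable g) {x K : ℝ}
    (hK : ∀ s ∈ Icc (x - R) x, ‖g s‖ ≤ K) :
    Integrable (fun p => S (max p.1 0) (g (x - p.2))) (hν.potMeasure R) := by
  have := hν.potMeasure_finite hν0 R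
  exact Integrable.of_bound (stronglyMeasurable_potOp_integrand hS hg x).aestronglyMeasurable
    K (potOp_ae_norm_le hν hS R hK)

lemma norm_potOp_le (R : ℝ) {g : ℝ → B} {x K : ℝ} (hK : ∀ s ∈ Icc (x - R) x, ‖g s‖ ≤ K) :
    ‖potOp hν S R g x‖ ≤ K * (hν.potMeasure R).real univ := by
  have := hν.potMeasure_finite hν0 R
  exact norm_integral_le_of_norm_le_const (potOp_ae_norm_le hν hS R hK)

lemma continuous_potOp (R : ℝ) {g : ℝ → B} (hg : Continuous g) {K : ℝ} (hK : ∀ x, ‖g x‖ ≤ K) :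
    Continuous (potOp hν S R g) := by
  have := hν.potMeasure_finite hν0 R
  refine continuous_of_dominated (bound := fun _ => K)
    (fun x => (stronglyMeasurable_potOp_integrand hS hg.stronglyMeasurable x).aestronglyMeasurable)
    (fun x => potOp_ae_norm_le hν hS R fun s _ => hK s) (integrable_const _)
    (Eventually.of_forall fun p => by fun_prop)

lemma tendsto_potOp (R : ℝ) {gn : ℕ → ℝ → B} {g : ℝ → B} (hgn : ∀ n, StronglyMeasurable (gn n))
    {K x : ℝ} (hK : ∀ n, ∀ s ∈ Icc (x - R) x, ‖gn n s‖ ≤ K)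
    (hlim : ∀ᵐ p ∂(hν.potMeasure R), Tendsto (fun n => gn n (x - p.2)) atTop (𝓝 (g (x - p.2)))) :
    Tendsto (fun n => potOp hν S R (gn n) x) atTop (𝓝 (potOp hν S R g x)) := by
  have := hν.potMeasure_finite hν0 R
  refine tendsto_integral_of_dominated_convergence (fun _ => K)
    (fun n => (stronglyMeasurable_potOp_integrand hS (hgn n) x).aestronglyMeasurable)
    (integrable_const _) (fun n => potOp_ae_norm_le hν hS R (hK n)) ?_
  filter_upwards [hlim] with p hp
  exact ((S _).continuous.tendsto _).comp hp

lemma hasDerivAt_potOp (R : ℝ) {g g' : ℝ → B} (hg : ∀ x, HasDerivAt g (g' x) x)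
    (hg' : Continuous g') {K : ℝ} (hK : ∀ x, ‖g' x‖ ≤ K) (x : ℝ) :
    HasDerivAt (potOp hν S R g) (potOp hν S R g' x) x := by
  have := hν.potMeasure_finite hν0 R
  have hc : Continuous g := continuous_iff_continuousAt.2 fun x => (hg x).continuousAt
  obtain ⟨C, hC⟩ := (isCompact_Icc (a := x - R) (b := x)).exists_bound_of_continuousOn
    hc.continuousOn
  refine (hasDerivAt_integral_of_dominated_loc_of_deriv_le (F := fun x (p : ℝ × ℝ) =>
    S (max p.1 0) (g (x - p.2))) (F' := fun x (p : ℝ × ℝ) => S (max p.1 0) (g' (x - p.2)))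
    (bound := fun _ => K) (s := univ) univ_mem
    (Eventually.of_forall fun x =>
      (stronglyMeasurable_potOp_integrand hS hc.stronglyMeasurable x).aestronglyMeasurable)
    (integrable_potOp hν hν0 hS R hc.stronglyMeasurable hC)
    (stronglyMeasurable_potOp_integrand hS hg'.stronglyMeasurable x).aestronglyMeasurable
    ?_ (integrable_const _) ?_).2
  · exact Eventually.of_forall fun p y _ =>
      (hS.norm_apply_le (le_max_right _ _) _).trans (hK _)
  · refine Eventually.of_forall fun p y _ => ?_
    exact (S (max p.1 0)).hasFDerivAt.comp_hasDerivAt y ((hg (y - p.2)).comp_sub_const y p.2)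

/-- As `g` vanishes on `(-∞, a]`, enlarging the range of `y` from `[0, x - a)` to `[0, R]` adds only
zeros. The domain no longer depends on `x`, and Fubini turns the iterated integral into one against
a finite measure. -/
lemma potentialConv_eq_potOp {R a x K : ℝ} {g : ℝ → B} (hg : StronglyMeasurable g)
    (h0 : ∀ x ≤ a, g x = 0) (hx : x ≤ a + R) (hK : ∀ s ∈ Icc (x - R) x, ‖g s‖ ≤ K) :
    IntegrableOn (fun t => ∫ y in Ico 0 (x - a), S t (g (x - y)) ∂(subordinatorLaw ν t)) (Ioi 0) ∧
      potentialConv ν S a g x = potOp hν S R g x := by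
  have hinteg := integrable_potOp hν hν0 hS R hg hK
  have hinner : ∀ t ∈ Ioi (0 : ℝ), ∫ y, S (max t 0) (g (x - y))
      ∂(hν.lawKernel.restrict (measurableSet_Icc (a := (0 : ℝ)) (b := R)) t) =
      ∫ y in Ico 0 (x - a), S t (g (x - y)) ∂(subordinatorLaw ν t) := fun t (ht : 0 < t) => by
    rw [ProbabilityTheory.Kernel.restrict_apply, hν.lawKernel_apply ht.le, max_eq_left ht.le]
    refine setIntegral_eq_of_subset_of_forall_sdiff_eq_zero measurableSet_Icc
      (fun y hy => ⟨hy.1, by linarith [hy.2]⟩) fun y hy => ?_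
    rw [h0, map_zero]
    by_contra! h
    exact hy.2 ⟨hy.1.1, by linarith⟩
  constructor
  · refine IntegrableOn.congr_fun ?_ hinner measurableSet_Ioi
    -- The integrability statement concerns compositions of kernels, so Lebesgue measure enters as a
    -- constant kernel on a one-point space.
    exact Integrable.integral_compProd (a := ())
      (κ := ProbabilityTheory.Kernel.const Unit (volume.restrict (Ioi (0 : ℝ))))
      (η := ProbabilityTheory.Kernel.prodMkLeft Unit
        (hν.lawKernel.restrict (measurableSet_Icc (a := (0 : ℝ)) (b := R)))) hinteg
  · rw [potOp, IsOneSidedLevy.potMeasure, Measure.integral_compProd hinteg]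
    exact (setIntegral_congr_fun measurableSet_Ioi hinner).symm

end potOp

lemma inner_potentialConv_congr {μ : Measure ℝ} {a b x : ℝ} {f g : ℝ → B} {T : B →L[ℝ] B}
    (h : EqOn f g (Ioc a b)) (hx : x ≤ b) :
    ∫ y in Ico 0 (x - a), T (f (x - y)) ∂μ = ∫ y in Ico 0 (x - a), T (g (x - y)) ∂μ :=
  setIntegral_congr_fun measurableSet_Ico fun y hy => by
    simp only [h (⟨by linarith [hy.2], by linarith [hy.1]⟩ : x - y ∈ Ioc a b)]

lemma potentialConv_congr {a b x : ℝ} {f g : ℝ → B} (h : EqOn f g (Ioc a b)) (hx : x ≤ b) :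
    potentialConv ν S a f x = potentialConv ν S a g x := by
  unfold potentialConv
  simp_rw [inner_potentialConv_congr h hx]

lemma potentialConv_eq_zero {a x : ℝ} {g : ℝ → B} (hx : x ≤ a) :
    potentialConv ν S a g x = 0 := by
  simp [potentialConv, Ico_eq_empty (by linarith : ¬ (0 : ℝ) < x - a)]

include hν hν0 hS

/-- The extension of `g` by zero may jump at `a`. It is measurable and bounded, which suffices for
integrals and bounds; continuity in `x` requires the continuous extension `clamp`, available when
`g` vanishes at `a`. -/
lemma potentialConv_eq_potOp_cutExt {a b x : ℝ} (hab : a ≤ b) {g : ℝ → B}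
    (hg : ContinuousOn g (Icc a b)) (hx : x ≤ b) :
    IntegrableOn (fun t => ∫ y in Ico 0 (x - a), S t (g (x - y)) ∂(subordinatorLaw ν t)) (Ioi 0) ∧
      potentialConv ν S a g x = potOp hν S (b - a) (cutExt a b g) x := by
  obtain ⟨K, -, hK⟩ := exists_norm_cutExt_le hab hg
  have := potentialConv_eq_potOp hν hν0 hS (R := b - a) (stronglyMeasurable_cutExt hab hg)
    (fun x hx => cutExt_eq_zero g hx) (by linarith) (fun s _ => hK s) (x := x)
  rw [potentialConv_congr (eqOn_cutExt g) hx]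
  simp_rw [inner_potentialConv_congr (eqOn_cutExt g) hx]
  exact this

lemma potentialConv_eq_potOp_clamp {a b x : ℝ} (hab : a ≤ b) {g : ℝ → B} (hg : IsKill 0 a b g)
    (hx : x ≤ b) : potentialConv ν S a g x = potOp hν S (b - a) (clamp a b g) x := by
  obtain ⟨K, -, hK⟩ := exists_norm_clamp_le hab hg.continuousOn_Icc
  rw [← (potentialConv_eq_potOp hν hν0 hS (R := b - a)
    (continuous_clamp hab hg.continuousOn_Icc).stronglyMeasurable
    (fun x hx => hg.clamp_eq_zero hab hx) (by linarith) (fun s _ => hK s) (x := x)).2]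
  exact potentialConv_congr (fun y hy => (hg.clamp_eq hab hy.2).symm) hx

lemma norm_potentialConv_le {a b x l K : ℝ} (hab : a ≤ b) (hl : 0 < l) {g : ℝ → B}
    (hg : ContinuousOn g (Icc a b)) (hK : ∀ x ∈ Icc a b, ‖g x‖ ≤ K) (hx : x ≤ b) :
    ‖potentialConv ν S a g x‖ ≤ Real.exp (l * (b - a)) / laplaceExponent ν l * K := by
  have hK0 : 0 ≤ K := (norm_nonneg _).trans (hK a ⟨le_rfl, hab⟩)
  rw [(potentialConv_eq_potOp_cutExt hν hν0 hS hab hg hx).2, mul_comm]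
  refine (norm_potOp_le hν hν0 hS _ (K := K) fun s hs => ?_).trans
    (mul_le_mul_of_nonneg_left (hν.potMeasure_real_univ_le hν0 hl _) hK0)
  exact (norm_indicator_le_norm_self _ _).trans (hK _ (max_min_mem_Icc hab _))

/-- The potential operator commutes with differentiation. -/
lemma hasDerivWithinAt_potentialConv [CompleteSpace B] {a b x : ℝ} (hab : a < b) {g : ℝ → B}
    (hg : IsKill 1 a b g) (hx : x ≤ b) :
    HasDerivWithinAt (potentialConv ν S a g)
      (potentialConv ν S a (derivWithin g (Iic b)) x) (Iic b) x := by
  have hg' : IsKill 0 a b (derivWithin g (Iic b)) := hg.derivWithin hab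
  obtain ⟨K, u, u', hu, hgu⟩ := hg.exists_isC1Kill hab
  have huc := hu.continuous
  have hP : ∀ x ≤ b, potentialConv ν S a g x = potOp hν S (b - a) u x := fun x hx => by
    obtain ⟨C, hC⟩ := (isCompact_Icc (a := x - (b - a)) (b := x)).exists_bound_of_continuousOn
      huc.continuousOn
    rw [← (potentialConv_eq_potOp hν hν0 hS (R := b - a) huc.stronglyMeasurable hu.eq_zero
      (by linarith) hC).2]
    exact potentialConv_congr (hgu.mono Ioc_subset_Iic_self) hx
  have hd : EqOn (derivWithin g (Iic b)) u' (Iic b) := fun y hy =>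
    ((hu.hasDerivAt y).hasDerivWithinAt.congr hgu (hgu hy)).derivWithin (uniqueDiffOn_Iic b y hy)
  rw [potentialConv_congr (hd.mono Ioc_subset_Iic_self) hx,
    (potentialConv_eq_potOp hν hν0 hS (R := b - a) hu.continuous_deriv.stronglyMeasurable
      (fun y hy => by rw [← hd (mem_Iic.2 (hy.trans hab.le)), hg'.eq_zero y hy]) (by linarith)
      fun s _ => hu.norm_deriv_le s).2]
  exact (hasDerivAt_potOp hν hν0 hS (b - a) hu.hasDerivAt hu.continuous_deriv hu.norm_deriv_le
    x).hasDerivWithinAt.congr (fun y hy => hP y hy) (hP x hx)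

lemma continuousOn_potentialConv {a b : ℝ} (hab : a ≤ b) {g : ℝ → B} (hg : IsKill 0 a b g) :
    ContinuousOn (potentialConv ν S a g) (Iic b) := by
  obtain ⟨K, -, hK⟩ := exists_norm_clamp_le hab hg.continuousOn_Icc
  exact (continuous_potOp hν hν0 hS (b - a) (continuous_clamp hab hg.continuousOn_Icc)
    hK).continuousOn.congr fun x hx => potentialConv_eq_potOp_clamp hν hν0 hS hab hg hx

lemma isKill_potentialConv [CompleteSpace B] {a b : ℝ} (hab : a < b) (k : ℕ) {g : ℝ → B}
    (hg : IsKill k a b g) : IsKill k a b (potentialConv ν S a g) := by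
  refine ⟨?_, fun x hx => potentialConv_eq_zero hx⟩
  induction k generalizing g with
  | zero => simpa using continuousOn_potentialConv hν hν0 hS hab.le hg
  | succ k ih =>
    have hg1 : IsKill 1 a b g := hg.of_le (by omega)
    have hd := fun x (hx : x ≤ b) => hasDerivWithinAt_potentialConv hν hν0 hS hab hg1 hx
    have := (contDiffOn_succ_iff_derivWithin (n := k) (f := potentialConv ν S a g)
      (uniqueDiffOn_Iic b)).2 ⟨fun x hx => (hd x hx).differentiableWithinAt, by simp,
        (ih (hg.derivWithin hab)).congr fun x hx => (hd x hx).derivWithin (uniqueDiffOn_Iic b x hx)⟩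
    simpa using this

lemma iteratedDerivWithin_potentialConv [CompleteSpace B] {a b : ℝ} (hab : a < b) {k j : ℕ}
    (hj : j ≤ k) {g : ℝ → B} (hg : IsKill k a b g) :
    IsKill 0 a b (iteratedDerivWithin j g (Iic b)) ∧
    EqOn (iteratedDerivWithin j (potentialConv ν S a g) (Iic b))
      (potentialConv ν S a (iteratedDerivWithin j g (Iic b))) (Iic b) := by
  induction j generalizing g k with
  | zero =>
    simp only [iteratedDerivWithin_zero]
    exact ⟨hg.of_le (by omega), fun x _ => rfl⟩
  | succ j ih =>
    obtain ⟨k, rfl⟩ : ∃ m, k = m + 1 := ⟨k - 1, by omega⟩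
    have hg1 : IsKill 1 a b g := hg.of_le (by omega)
    have hd := fun x (hx : x ≤ b) => hasDerivWithinAt_potentialConv hν hν0 hS hab hg1 hx
    obtain ⟨h1, h2⟩ := ih (by omega) (hg.derivWithin hab)
    rw [iteratedDerivWithin_succ', iteratedDerivWithin_succ']
    refine ⟨h1, fun x hx => ?_⟩
    rw [← h2 hx]
    exact iteratedDerivWithin_congr (fun y hy =>
      (hd y hy).derivWithin (uniqueDiffOn_Iic b y hy)) hx

end GenFrac

namespace GenFrac

variable {ν : Measure ℝ} {B : Type*} [NormedAddCommGroup B] [NormedSpace ℝ B]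
  [CompleteSpace B] {S : ℝ → B →L[ℝ] B}

/-! ### The operator-valued potential measure -/

variable (hν : IsOneSidedLevy ν) (hν0 : ν ≠ 0) (hS : IsContractionSemigroup S)

section
include hν hν0 hS

/-- The same Fubini reduction for a constant vector. Restricting to `[0, R]` loses nothing: `M` lies
below `R`, and its part below `0` is null for every law. -/
lemma integral_law_smul {M : Set ℝ} (hM : MeasurableSet M) {R : ℝ} (hMR : M ⊆ Iic R) (Y : B) :
    IntegrableOn (fun t => (subordinatorLaw ν t).real M • S t Y) (Ioi 0) ∧
    ∫ t in Ioi 0, (subordinatorLaw ν t).real M • S t Y =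
      ∫ p in Prod.snd ⁻¹' M, S (max p.1 0) Y ∂(hν.potMeasure R) := by
  have := hν.potMeasure_finite hν0 R
  have hsnd : MeasurableSet (Prod.snd ⁻¹' M : Set (ℝ × ℝ)) := measurable_snd hM
  have hi : Integrable ((Prod.snd ⁻¹' M).indicator fun p : ℝ × ℝ => S (max p.1 0) Y)
      (hν.potMeasure R) := by
    refine Integrable.indicator ?_ hsnd
    exact integrable_potOp hν hν0 hS R (g := fun _ => Y) stronglyMeasurable_const (x := 0)
      fun _ _ => le_rfl
  have hinner : ∀ t ∈ Ioi (0 : ℝ), ∫ y, (Prod.snd ⁻¹' M).indicator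
      (fun p : ℝ × ℝ => S (max p.1 0) Y) (t, y)
      ∂(hν.lawKernel.restrict (measurableSet_Icc (a := (0 : ℝ)) (b := R)) t) =
      (subordinatorLaw ν t).real M • S t Y := fun t (ht : 0 < t) => by
    have h1 : (fun y => (Prod.snd ⁻¹' M).indicator (fun p : ℝ × ℝ => S (max p.1 0) Y) (t, y)) =
        M.indicator fun _ => S t Y := by
      ext y
      by_cases hy : y ∈ M
      · rw [indicator_of_mem hy, indicator_of_mem (by exact hy), max_eq_left ht.le]
      · rw [indicator_of_notMem hy, indicator_of_notMem (by exact hy)]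
    rw [h1, integral_indicator_const _ hM, ProbabilityTheory.Kernel.restrict_apply,
      hν.lawKernel_apply ht.le]
    congr 1
    rw [measureReal_restrict_apply hM]
    refine measureReal_congr ?_
    filter_upwards [hν.law_ae_nonneg ht.le] with y hy
    refine propext ⟨fun h => h.1, fun h => ⟨h, hy, hMR h⟩⟩
  rw [← integral_indicator hsnd]
  constructor
  · refine IntegrableOn.congr_fun ?_ hinner measurableSet_Ioi
    exact Integrable.integral_compProd (a := ())
      (κ := ProbabilityTheory.Kernel.const Unit (volume.restrict (Ioi (0 : ℝ))))
      (η := ProbabilityTheory.Kernel.prodMkLeft Unit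
        (hν.lawKernel.restrict (measurableSet_Icc (a := (0 : ℝ)) (b := R)))) hi
  · rw [IsOneSidedLevy.potMeasure, Measure.integral_compProd hi]
    exact (setIntegral_congr_fun measurableSet_Ioi hinner).symm

lemma norm_integral_law_smul_le {M : Set ℝ} (hM : MeasurableSet M) {R : ℝ} (hMR : M ⊆ Iic R)
    (Y : B) : ‖∫ t in Ioi 0, (subordinatorLaw ν t).real M • S t Y‖ ≤
      (hν.potMeasure R).real (Prod.snd ⁻¹' M) * ‖Y‖ := by
  have := hν.potMeasure_finite hν0 R
  rw [(integral_law_smul hν hν0 hS hM hMR Y).2, mul_comm]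
  exact norm_setIntegral_le_of_norm_le_const (measure_lt_top _ _)
    fun p _ => hS.norm_apply_le (le_max_right _ _) Y

lemma exists_potential_operator {M : Set ℝ} (hM : MeasurableSet M) (hb : Bornology.IsBounded M) :
    ∃ U : B →L[ℝ] B, ∀ Y, U Y = ∫ t in Ioi 0, (subordinatorLaw ν t).real M • S t Y := by
  obtain ⟨R, hR⟩ := hb.bddAbove
  have hMR : M ⊆ Iic R := fun x hx => hR hx
  have hI := fun Y => (integral_law_smul hν hν0 hS hM hMR Y).1
  refine ⟨LinearMap.mkContinuous
    { toFun := fun Y => ∫ t in Ioi 0, (subordinatorLaw ν t).real M • S t Y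
      map_add' := fun Y Z => ?_
      map_smul' := fun c Y => ?_ } ((hν.potMeasure R).real (Prod.snd ⁻¹' M))
    fun Y => norm_integral_law_smul_le hν hν0 hS hM hMR Y, fun Y => rfl⟩
  · simp only [map_add, smul_add]
    exact integral_add (hI Y) (hI Z)
  · simp only [map_smul, RingHom.id_apply]
    rw [← integral_smul]
    simp_rw [smul_comm c]

end

open Classical in
/-- The operator-valued potential measure, set to zero outside the bounded Borel sets. -/
noncomputable def potU (hν : IsOneSidedLevy ν) (hν0 : ν ≠ 0) (hS : IsContractionSemigroup S)
    (M : Set ℝ) : B →L[ℝ] B :=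
  if h : MeasurableSet M ∧ Bornology.IsBounded M then
    (exists_potential_operator hν hν0 hS h.1 h.2).choose else 0

lemma potU_apply {M : Set ℝ} (hM : MeasurableSet M) (hb : Bornology.IsBounded M) (Y : B) :
    potU hν hν0 hS M Y = ∫ t in Ioi 0, (subordinatorLaw ν t).real M • S t Y := by
  rw [potU, dif_pos ⟨hM, hb⟩]
  exact (exists_potential_operator hν hν0 hS hM hb).choose_spec Y

lemma potU_apply_eq_setIntegral {M : Set ℝ} (hM : MeasurableSet M) (hb : Bornology.IsBounded M)
    {R : ℝ} (hMR : M ⊆ Iic R) (Y : B) :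
    potU hν hν0 hS M Y = ∫ p in Prod.snd ⁻¹' M, S (max p.1 0) Y ∂(hν.potMeasure R) := by
  rw [potU_apply hν hν0 hS hM hb, (integral_law_smul hν hν0 hS hM hMR Y).2]

lemma norm_potU_le {M : Set ℝ} (hM : MeasurableSet M) (hb : Bornology.IsBounded M)
    {R : ℝ} (hMR : M ⊆ Iic R) :
    ‖potU hν hν0 hS M‖ ≤ (hν.potMeasure R).real (Prod.snd ⁻¹' M) :=
  ContinuousLinearMap.opNorm_le_bound _ measureReal_nonneg fun Y => by
    rw [potU_apply hν hν0 hS hM hb]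
    exact norm_integral_law_smul_le hν hν0 hS hM hMR Y

lemma norm_potU_Icc_le {z l : ℝ} (hl : 0 < l) :
    ‖potU hν hν0 hS (Icc 0 z)‖ ≤ Real.exp (l * z) / laplaceExponent ν l := by
  have := hν.potMeasure_finite hν0 z
  exact (norm_potU_le hν hν0 hS measurableSet_Icc (Metric.isBounded_Icc 0 z)
    Icc_subset_Iic_self).trans ((measureReal_mono (subset_univ _)).trans
      (hν.potMeasure_real_univ_le hν0 hl z))

lemma isPotentialMeasure_potU :
    IsPotentialMeasure ν S (potU hν hν0 hS) where
  integrable M hM hb Y := by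
    obtain ⟨R, hR⟩ := hb.bddAbove
    exact (integral_law_smul hν hν0 hS hM (R := R) (fun x hx => hR hx) Y).1
  apply_eq M hM hb Y := potU_apply hν hν0 hS hM hb Y
  hasSum M hM hd hb := by
    obtain ⟨R, hR⟩ := hb.bddAbove
    have := hν.potMeasure_finite hν0 R
    have hMR : ⋃ i, M i ⊆ Iic R := fun x hx => hR hx
    have hMi : ∀ i, M i ⊆ Iic R := fun i => (subset_iUnion M i).trans hMR
    have hbi : ∀ i, Bornology.IsBounded (M i) := fun i => hb.subset (subset_iUnion M i)
    have hsnd : ∀ i, MeasurableSet (Prod.snd ⁻¹' M i : Set (ℝ × ℝ)) := fun i =>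
      measurable_snd (hM i)
    have hdis : Pairwise (Function.onFun Disjoint fun i => (Prod.snd ⁻¹' M i : Set (ℝ × ℝ))) :=
      fun i j hij => (hd hij).preimage _
    -- Operator norms are dominated by the masses of disjoint sets under the finite measure
    -- `potMeasure R`, so the series converges in operator norm. Its sum can then be identified
    -- vector by vector.
    have hsum : Summable fun i => potU hν hν0 hS (M i) := by
      refine Summable.of_norm_bounded 
        (summable_measure_toReal (μ := hν.potMeasure R) hsnd hdis) fun i => ?_
      exact norm_potU_le hν hν0 hS (hM i) (hbi i) (hMi i)
    refine (hsum.hasSum_iff).2 (ContinuousLinearMap.ext fun Y => ?_)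
    have h1 : HasSum (fun i => potU hν hν0 hS (M i) Y) ((∑' i, potU hν hν0 hS (M i)) Y) :=
      hsum.hasSum.mapL (ContinuousLinearMap.apply ℝ B Y)
    refine h1.unique ?_
    rw [potU_apply_eq_setIntegral hν hν0 hS (MeasurableSet.iUnion hM) hb hMR, preimage_iUnion]
    simp_rw [fun i => potU_apply_eq_setIntegral hν hν0 hS (hM i) (hbi i) (hMi i) Y]
    exact hasSum_integral_iUnion hsnd hdis (integrable_potOp hν hν0 hS R (g := fun _ => Y)
      stronglyMeasurable_const (x := 0) fun _ _ => le_rfl).integrableOn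
  null_neg M hM hb hneg := by
    ext Y
    rw [potU_apply hν hν0 hS hM hb]
    have : ∀ t ∈ Ioi (0 : ℝ), (subordinatorLaw ν t).real M • S t Y = 0 := fun t (ht : 0 < t) => by
      have : subordinatorLaw ν t M = 0 := measure_mono_null hneg (hν.law_null_neg ht.le)
      simp [Measure.real, this]
    rw [setIntegral_congr_fun measurableSet_Ioi this]
    simp

lemma sum_setIntegral_snd_Ico {E : Type*} [NormedAddCommGroup E] [NormedSpace ℝ E]
    {μ : Measure (ℝ × ℝ)} {f : ℝ × ℝ → E} (hf : Integrable f μ) {h : ℝ} (hh : 0 ≤ h) (n : ℕ) :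
    ∑ i ∈ Finset.range n, ∫ p in Prod.snd ⁻¹' Ico ((i : ℝ) * h) (((i : ℝ) + 1) * h), f p ∂μ =
      ∫ p in Prod.snd ⁻¹' Ico 0 ((n : ℝ) * h), f p ∂μ := by
  induction n with
  | zero => simp
  | succ n ih =>
    have hn : (0 : ℝ) ≤ (n : ℝ) * h := by positivity
    rw [Finset.sum_range_succ, ih, ← setIntegral_union _ (measurable_snd measurableSet_Ico)
      hf.integrableOn hf.integrableOn, ← preimage_union, Ico_union_Ico_eq_Ico hn (by nlinarith)]
    · push_cast; rfl
    · exact (Ico_disjoint_Ico_same).preimage _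

/-- On each cell the error is at most the oscillation of `g` times the scalar mass of the cell,
because `U` is dominated in norm by the finite measure `potMeasure`. Uniform continuity of the
clamped function finishes the argument. -/
lemma tendsto_riemannSum_potU {a b x : ℝ} {g : ℝ → B}
    (hg : ContinuousOn g (Icc a b)) (hx : x ∈ Icc a b) :
    Tendsto (fun n : ℕ => ∑ i ∈ Finset.range n,
      potU hν hν0 hS (Ico ((i : ℝ) * ((x - a) / n)) (((i : ℝ) + 1) * ((x - a) / n)))
        (g (x - (i : ℝ) * ((x - a) / n)))) atTop (𝓝 (potentialConv ν S a g x)) := by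
  have hab : a ≤ b := hx.1.trans hx.2
  have hR := hν.potMeasure_finite hν0 (b - a)
  set μ := hν.potMeasure (b - a) with hμ
  have hxa : 0 ≤ x - a := sub_nonneg.2 hx.1
  obtain ⟨K, -, hK⟩ := exists_norm_clamp_le hab hg
  have hc : Continuous (clamp a b g) := continuous_clamp hab hg
  set f : ℝ × ℝ → B := fun p => S (max p.1 0) (clamp a b g (x - p.2)) with hf
  have hfi : Integrable f μ := integrable_potOp hν hν0 hS (b - a) hc.stronglyMeasurable
    fun s _ => hK s
  have hP : potentialConv ν S a g x = ∫ p in Prod.snd ⁻¹' Ico 0 (x - a), f p ∂μ := by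
    rw [(potentialConv_eq_potOp_cutExt hν hν0 hS hab hg hx.2).2, potOp,
      ← integral_indicator (measurable_snd measurableSet_Ico)]
    refine integral_congr_ae ?_
    filter_upwards [hν.potMeasure_ae (b - a)] with p hp
    by_cases h : p.2 < x - a
    · rw [indicator_of_mem (by exact ⟨hp.2.1, h⟩), cutExt, indicator_of_mem]
      exact mem_Ioi.2 (by linarith)
    · rw [indicator_of_notMem (fun h' => h h'.2), cutExt_eq_zero _ (by linarith), map_zero]
  rw [hP, Metric.tendsto_atTop]
  intro ε hε
  have hV : 0 < μ.real univ + 1 := by positivity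
  -- The tolerance is chosen so that its product with the total mass is at most `ε/2`; the summand
  -- `1` covers the case of zero mass.
  obtain ⟨δ, hδ, huc⟩ := Metric.uniformContinuous_iff.1 (uniformContinuous_clamp hab hg)
    (ε / (2 * (μ.real univ + 1))) (by positivity)
  obtain ⟨N, hN⟩ := exists_nat_gt ((x - a) / δ)
  refine ⟨N + 1, fun n hn => ?_⟩
  have hn0 : (0 : ℝ) < n := by exact_mod_cast (by omega : 0 < n)
  set h := (x - a) / n with hh
  have hh0 : 0 ≤ h := by positivity
  have hhδ : h < δ := by
    rw [hh, div_lt_iff₀ hn0]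
    rw [div_lt_iff₀ hδ] at hN
    have : (N : ℝ) < n := by exact_mod_cast (by omega : N < n)
    nlinarith
  have hnh : (n : ℝ) * h = x - a := by rw [hh]; field_simp
  have hs : ∀ i ∈ Finset.range n, (↑i : ℝ) * h ∈ Icc 0 (x - a) ∧
      ((i : ℝ) + 1) * h ≤ x - a := fun i hi => by
    have h1 : (i : ℝ) + 1 ≤ n := by exact_mod_cast Finset.mem_range.1 hi
    have h2 := mul_le_mul_of_nonneg_right h1 hh0
    have h3 : (0 : ℝ) ≤ i * h := by positivity
    exact ⟨⟨h3, by nlinarith⟩, by linarith⟩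
  rw [← hnh, ← sum_setIntegral_snd_Ico hfi hh0, dist_eq_norm, ← Finset.sum_sub_distrib]
  have hterm : ∀ i ∈ Finset.range n, ‖potU hν hν0 hS (Ico ((i : ℝ) * h) (((i : ℝ) + 1) * h))
      (g (x - (i : ℝ) * h)) - ∫ p in Prod.snd ⁻¹' Ico ((i : ℝ) * h) (((i : ℝ) + 1) * h), f p ∂μ‖
      ≤ ∫ p in Prod.snd ⁻¹' Ico ((i : ℝ) * h) (((i : ℝ) + 1) * h),
        ε / (2 * (μ.real univ + 1)) ∂μ := fun i hi => by
    obtain ⟨h1, h2⟩ := hs i hi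
    rw [potU_apply_eq_setIntegral hν hν0 hS measurableSet_Ico (Metric.isBounded_Ico _ _)
      (R := b - a) (fun y hy => mem_Iic.2 (by linarith [hy.2, hx.2])), ← integral_sub _
      hfi.integrableOn]
    · rw [setIntegral_const, smul_eq_mul, mul_comm (μ.real _)]
      refine norm_setIntegral_le_of_norm_le_const (measure_lt_top μ _) fun p hp => ?_
      rw [hf, ← map_sub]
      refine (hS.norm_apply_le (le_max_right _ _) _).trans ?_
      rw [← clamp_of_mem (g := g) (a := a) (b := b) (x := x - i * h)
        ⟨by linarith [h1.2], by linarith [h1.1, hx.2]⟩, ← dist_eq_norm]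
      refine (huc ?_).le
      have hp1 : (i : ℝ) * h ≤ p.2 := hp.1
      have hp2 : p.2 < ((i : ℝ) + 1) * h := hp.2
      rw [Real.dist_eq, abs_lt]
      constructor <;> linarith
    · exact (integrable_potOp hν hν0 hS (b - a) (g := fun _ => g (x - i * h))
        stronglyMeasurable_const (x := 0) fun _ _ => le_rfl).integrableOn
  refine (norm_sum_le_of_le _ hterm).trans_lt ?_
  rw [sum_setIntegral_snd_Ico (integrable_const (μ := μ) _) hh0,
    setIntegral_const, smul_eq_mul]
  have h3 : μ.real (Prod.snd ⁻¹' Ico 0 ((n : ℝ) * h)) ≤ μ.real univ :=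
    measureReal_mono (subset_univ _)
  calc _ ≤ (μ.real univ + 1) * (ε / (2 * (μ.real univ + 1))) := by gcongr; linarith
    _ = ε / 2 := by field_simp
    _ < ε := half_lt_self hε

end GenFrac

namespace GenFrac

variable {ν : Measure ℝ} {B : Type*} [NormedAddCommGroup B] [NormedSpace ℝ B]
  {S : ℝ → B →L[ℝ] B}

/-! ### The product semigroup and classical solutions -/

lemma productSemigroup_congr {b x : ℝ} {f g : ℝ → B} (h : EqOn f g (Iic b)) (hx : x ≤ b)
    (t : ℝ) : productSemigroup ν S t f x = productSemigroup ν S t g x :=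
  setIntegral_congr_fun measurableSet_Ici fun y hy => by
    have hy : 0 ≤ y := hy
    simp only [h (mem_Iic.2 (by linarith) : x - y ∈ Iic b)]

lemma productSemigroup_eq_setIntegral_Ico {a : ℝ} {f : ℝ → B} (h0 : ∀ x ≤ a, f x = 0)
    (t x : ℝ) : productSemigroup ν S t f x =
      ∫ y in Ico 0 (x - a), S t (f (x - y)) ∂(subordinatorLaw ν t) := by
  refine setIntegral_eq_of_subset_of_forall_sdiff_eq_zero measurableSet_Ici
    Ico_subset_Ici_self fun y hy => ?_
  rw [h0, map_zero]
  by_contra! h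
  exact hy.2 ⟨hy.1, by linarith⟩

lemma setIntegral_Ioi_comp_add {E : Type*} [NormedAddCommGroup E] [NormedSpace ℝ E]
    (F : ℝ → E) (h : ℝ) :
    ∫ t in Ioi 0, F (t + h) = ∫ t in Ioi h, F t := by
  have := (measurePreserving_add_right volume h).setIntegral_preimage_emb
    (measurableEmbedding_addRight h) F (Ioi h)
  rw [← this]
  congr 2
  ext t
  simp

lemma potentialConv_smul (a c : ℝ) (f : ℝ → B) (x : ℝ) :
    potentialConv ν S a (c • f) x = c • potentialConv ν S a f x := by
  simp only [potentialConv, Pi.smul_apply, map_smul, integral_smul]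

variable (hν : IsOneSidedLevy ν) (hν0 : ν ≠ 0) (hS : IsContractionSemigroup S)

section
include hν

lemma productSemigroup_eq {t : ℝ} (ht : 0 ≤ t) (f : ℝ → B) (x : ℝ) :
    productSemigroup ν S t f x = ∫ y, S t (f (x - y)) ∂(subordinatorLaw ν t) := by
  rw [productSemigroup, Measure.restrict_eq_self_of_ae_mem]
  exact hν.law_ae_nonneg ht

lemma integrable_comp_sub_law {E : Type*} [NormedAddCommGroup E] {t : ℝ} (ht : 0 ≤ t) {f : ℝ → E}
    (hf : StronglyMeasurable f) {K : ℝ} (hK : ∀ x, ‖f x‖ ≤ K) (x : ℝ) :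
    Integrable (fun y => f (x - y)) (subordinatorLaw ν t) := by
  have := hν.isProb ht
  exact Integrable.of_bound
    (hf.comp_measurable (measurable_const.sub measurable_id)).aestronglyMeasurable K
    (Eventually.of_forall fun y => hK _)

lemma productSemigroup_eq_apply [CompleteSpace B] {t : ℝ} (ht : 0 ≤ t) {f : ℝ → B}
    (hf : StronglyMeasurable f) {K : ℝ} (hK : ∀ x, ‖f x‖ ≤ K) (x : ℝ) :
    productSemigroup ν S t f x = S t (∫ y, f (x - y) ∂(subordinatorLaw ν t)) := by
  rw [productSemigroup_eq hν ht]
  exact (S t).integral_comp_comm (integrable_comp_sub_law hν ht hf hK x)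

include hS

lemma norm_productSemigroup_le_mul {t : ℝ} (ht : 0 ≤ t) {a b x K : ℝ} {f : ℝ → B}
    (h0 : ∀ x ≤ a, f x = 0) (hx : x ≤ b) (hK : ∀ x, ‖f x‖ ≤ K) :
    ‖productSemigroup ν S t f x‖ ≤ K * (subordinatorLaw ν t).real (Iic (b - a)) := by
  have := hν.isProb ht
  have hK0 : 0 ≤ K := (norm_nonneg _).trans (hK 0)
  rw [productSemigroup_eq_setIntegral_Ico h0]
  refine (norm_setIntegral_le_of_norm_le_const (measure_lt_top _ _) fun y _ =>
    (hS.norm_apply_le ht _).trans (hK (x - y))).trans ?_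
  refine mul_le_mul_of_nonneg_left (measureReal_mono fun y hy => ?_) hK0
  exact mem_Iic.2 (by linarith [hy.2])

lemma continuous_productSemigroup {t : ℝ} (ht : 0 ≤ t) {f : ℝ → B} (hf : Continuous f) {K : ℝ}
    (hK : ∀ x, ‖f x‖ ≤ K) : Continuous (productSemigroup ν S t f) := by
  have := hν.isProb ht
  have h1 : productSemigroup ν S t f =
      fun x => ∫ y, S t (f (x - y)) ∂(subordinatorLaw ν t) :=
    funext fun x => productSemigroup_eq hν ht f x
  rw [h1]
  refine continuous_of_dominated (bound := fun _ => K) (fun x => ?_)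
    (fun x => Eventually.of_forall fun y => (hS.norm_apply_le ht _).trans (hK _))
    (integrable_const _) (Eventually.of_forall fun y => by fun_prop)
  exact (by fun_prop : Continuous fun y => S t (f (x - y))).aestronglyMeasurable

lemma isKill_productSemigroup {t : ℝ} (ht : 0 ≤ t) {a b : ℝ} (hab : a ≤ b) {f : ℝ → B}
    (hf : IsKill 0 a b f) : IsKill 0 a b (productSemigroup ν S t f) := by
  obtain ⟨K, -, hK⟩ := exists_norm_clamp_le hab hf.continuousOn_Icc
  refine IsKill.of_continuousOn ((continuous_productSemigroup hν hS ht
    (continuous_clamp hab hf.continuousOn_Icc) hK).continuousOn.congr fun x hx => ?_)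
    fun x hx => ?_
  · exact productSemigroup_congr (fun y hy => (hf.clamp_eq hab hy).symm) hx t
  · rw [productSemigroup_eq_setIntegral_Ico hf.eq_zero,
      Ico_eq_empty (by linarith : ¬ (0 : ℝ) < x - a)]
    simp

lemma productSemigroup_add [CompleteSpace B] {s t : ℝ} (hs : 0 ≤ s) (ht : 0 ≤ t) {f : ℝ → B}
    (hf : StronglyMeasurable f) {K : ℝ} (hK : ∀ x, ‖f x‖ ≤ K) (x : ℝ) :
    productSemigroup ν S s (productSemigroup ν S t f) x = productSemigroup ν S (s + t) f x := by
  have := hν.isProb hs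
  have := hν.isProb ht
  rw [productSemigroup_eq_apply hν (add_nonneg hs ht) hf hK, hν.law_add hs ht,
    productSemigroup_eq hν hs, integral_conv, hS.add_apply hs ht]
  · simp_rw [productSemigroup_eq_apply hν ht hf hK]
    have hI := integrable_comp_sub_law hν (add_nonneg hs ht) hf hK x
    rw [hν.law_add hs ht] at hI
    have hI2 : Integrable (fun y => ∫ z, f (x - (y + z)) ∂(subordinatorLaw ν t))
        (subordinatorLaw ν s) := by
      refine Integrable.integral_prod_left (f := fun p : ℝ × ℝ => f (x - (p.1 + p.2))) ?_
      exact (integrable_map_measure hI.aestronglyMeasurable (by fun_prop)).1 hI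
    rw [← (S t).integral_comp_comm hI2, ← (S s).integral_comp_comm ((S t).integrable_comp hI2)]
    simp_rw [sub_sub]
  · have := integrable_comp_sub_law hν (add_nonneg hs ht) hf hK x
    rwa [hν.law_add hs ht] at this

lemma stronglyMeasurable_productSemigroup {f : ℝ → B} (hf : StronglyMeasurable f) :
    StronglyMeasurable fun p : ℝ × ℝ => productSemigroup ν S (max p.1 0) f p.2 := by
  have h1 : StronglyMeasurable fun q : (ℝ × ℝ) × ℝ => S (max q.1.1 0) (f (q.1.2 - q.2)) :=
    stronglyMeasurable_semigroup hS (measurable_fst.comp measurable_fst)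
      (hf.comp_measurable ((measurable_snd.comp measurable_fst).sub measurable_snd))
  have h2 := h1.integral_kernel_prod_right'
    (κ := ProbabilityTheory.Kernel.prodMkRight ℝ hν.lawKernel)
  have h3 : (fun p : ℝ × ℝ => productSemigroup ν S (max p.1 0) f p.2) = fun p =>
      ∫ y, S (max p.1 0) (f (p.2 - y))
        ∂(ProbabilityTheory.Kernel.prodMkRight ℝ hν.lawKernel p) :=
    funext fun p => productSemigroup_eq hν (le_max_right _ _) f p.2
  rw [h3]
  exact h2

/-- Three errors of size `ε/3`: jumps below `δ` by uniform continuity of `f`, jumps above `δ`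
because `G(t,[δ,∞)) → 0`, and `S t` against the identity uniformly on the compact range of `f`. -/
lemma eventually_norm_productSemigroup_sub_le [CompleteSpace B] {a b : ℝ} (hab : a ≤ b)
    {f : ℝ → B} (hf : IsKill 0 a b f) {ε : ℝ} (hε : 0 < ε) :
    ∀ᶠ t in 𝓝[>] (0 : ℝ), ∀ x ≤ b, ‖productSemigroup ν S t f x - f x‖ ≤ ε := by
  obtain ⟨K, hK0, hK⟩ := exists_norm_clamp_le hab hf.continuousOn_Icc
  obtain ⟨C, hC, hfC⟩ := exists_isCompact_clamp hab hf.continuousOn_Icc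
  have hc := continuous_clamp hab hf.continuousOn_Icc
  obtain ⟨δ, hδ, huc⟩ := Metric.uniformContinuous_iff.1
    (uniformContinuous_clamp hab hf.continuousOn_Icc) (ε / 3) (by positivity)
  have h1 := hS.eventually_norm_sub_lt hC (show 0 < ε / 3 by positivity)
  have h2 : ∀ᶠ t in 𝓝[>] (0 : ℝ), 2 * K * (subordinatorLaw ν t).real (Ici δ) < ε / 3 := by
    have := (hν.tendsto_law_real_Ici hδ).const_mul (2 * K)
    rw [mul_zero] at this
    exact this.eventually (gt_mem_nhds (by positivity))
  filter_upwards [h1, h2, self_mem_nhdsWithin] with t ht1 ht2 ht0 x hx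
  have ht0 : 0 ≤ t := le_of_lt ht0
  have := hν.isProb ht0
  rw [productSemigroup_congr (fun y hy => (hf.clamp_eq hab hy).symm) hx t,
    ← hf.clamp_eq hab hx]
  set g := clamp a b f
  have hI := integrable_comp_sub_law hν ht0 hc.stronglyMeasurable hK x
  have e1 : ∫ y, g (x - y) ∂(subordinatorLaw ν t) - g x =
      ∫ y, (g (x - y) - g x) ∂(subordinatorLaw ν t) := by
    rw [integral_sub hI (integrable_const _)]
    simp
  have e2 : productSemigroup ν S t g x - g x =
      S t (∫ y, g (x - y) ∂(subordinatorLaw ν t) - g x) + (S t (g x) - g x) := by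
    rw [productSemigroup_eq_apply hν ht0 hc.stronglyMeasurable hK, map_sub]
    abel
  have e3 : ‖∫ y, (g (x - y) - g x) ∂(subordinatorLaw ν t)‖ ≤
      ε / 3 + 2 * K * (subordinatorLaw ν t).real (Ici δ) := by
    have : ε / 3 + 2 * K * (subordinatorLaw ν t).real (Ici δ) =
        ∫ y, (ε / 3 + (Ici δ).indicator (fun _ => 2 * K) y) ∂(subordinatorLaw ν t) := by
      rw [integral_add (integrable_const _) ((integrable_const _).indicator measurableSet_Ici),
        integral_indicator_const _ measurableSet_Ici]
      simp [mul_comm]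
    rw [this]
    refine norm_integral_le_of_norm_le
      ((integrable_const _).add ((integrable_const _).indicator measurableSet_Ici)) ?_
    filter_upwards [hν.law_ae_nonneg ht0] with y hy
    by_cases hyδ : y ∈ Ici δ
    · rw [indicator_of_mem hyδ]
      have := (norm_sub_le (g (x - y)) (g x)).trans (add_le_add (hK _) (hK _))
      linarith
    · rw [indicator_of_notMem hyδ, add_zero, ← dist_eq_norm]
      refine (huc ?_).le
      rw [Real.dist_eq, sub_sub_cancel_left, abs_neg, abs_of_nonneg hy]
      simpa using hyδ
  rw [e2, e1]
  refine (norm_add_le _ _).trans ?_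
  have e4 := (hS.norm_apply_le ht0 (∫ y, (g (x - y) - g x) ∂(subordinatorLaw ν t))).trans e3
  have e5 := (ht1 _ (hfC x)).le
  linarith

include hν0

lemma integrableOn_productSemigroup {a b x : ℝ} (hab : a ≤ b) {f : ℝ → B} (hf : IsKill 0 a b f)
    (hx : x ≤ b) : IntegrableOn (fun t => productSemigroup ν S t f x) (Ioi 0) ∧
      potentialConv ν S a f x = ∫ t in Ioi 0, productSemigroup ν S t f x := by
  constructor
  · simp_rw [productSemigroup_eq_setIntegral_Ico hf.eq_zero]
    exact (potentialConv_eq_potOp_cutExt hν hν0 hS hab hf.continuousOn_Icc hx).1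
  · simp_rw [productSemigroup_eq_setIntegral_Ico hf.eq_zero]
    rfl

lemma potentialConv_sub {a b x : ℝ} (hab : a ≤ b) {f g : ℝ → B} (hf : ContinuousOn f (Icc a b))
    (hg : ContinuousOn g (Icc a b)) (hx : x ≤ b) :
    potentialConv ν S a (f - g) x =
      potentialConv ν S a f x - potentialConv ν S a g x := by
  obtain ⟨K, -, hK⟩ := exists_norm_cutExt_le hab hf
  obtain ⟨L, -, hL⟩ := exists_norm_cutExt_le hab hg
  rw [(potentialConv_eq_potOp_cutExt hν hν0 hS hab hf hx).2,
    (potentialConv_eq_potOp_cutExt hν hν0 hS hab hg hx).2,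
    (potentialConv_eq_potOp_cutExt hν hν0 hS hab (hf.sub hg) hx).2, potOp, potOp, potOp,
    ← integral_sub
      (integrable_potOp hν hν0 hS _ (stronglyMeasurable_cutExt hab hf) fun s _ => hK s)
      (integrable_potOp hν hν0 hS _ (stronglyMeasurable_cutExt hab hg) fun s _ => hL s)]
  refine integral_congr_ae (Eventually.of_forall fun p => ?_)
  simp only [← map_sub]
  congr 1
  by_cases h : x - p.2 ∈ Ioi a <;> simp [cutExt, h, clamp]

/-- Shifting time by `h` deletes the stretch `[0,h]` of the integral. Divided by `h`, what is lost
tends to `f`; this is why the potential inverts minus the generator. -/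
lemma integral_Ioi_shift_productSemigroup {a b x h : ℝ} (hab : a ≤ b) {f : ℝ → B}
    (hf : IsKill 0 a b f) (hx : x ≤ b) (hh : 0 ≤ h) :
    (∫ t in Ioi 0, productSemigroup ν S (t + h) f x) - potentialConv ν S a f x =
      -∫ t in (0 : ℝ)..h, productSemigroup ν S t f x := by
  obtain ⟨i1, i2⟩ := integrableOn_productSemigroup hν hν0 hS hab hf hx
  rw [i2, setIntegral_Ioi_comp_add (fun t => productSemigroup ν S t f x) h,
    ← intervalIntegral.integral_interval_add_Ioi i1 (i1.mono_set (Ioi_subset_Ioi hh))]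
  abel

variable [CompleteSpace B]

/-- The semigroup law under the time integral. The exchange of integrals is justified by the
majorant `K G(t, (-∞, b - a])`, which is integrable in `t`. -/
lemma productSemigroup_potentialConv {a b x h : ℝ} (hab : a ≤ b) {f : ℝ → B}
    (hf : IsKill 0 a b f) (hx : x ≤ b) (hh : 0 ≤ h) :
    productSemigroup ν S h (potentialConv ν S a f) x =
      ∫ t in Ioi 0, productSemigroup ν S (t + h) f x := by
  have := hν.isProb hh
  obtain ⟨K, hK0, hK⟩ := exists_norm_clamp_le hab hf.continuousOn_Icc
  have hc := continuous_clamp hab hf.continuousOn_Icc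
  have hcong : ∀ x ≤ b, ∀ t, productSemigroup ν S t f x =
      productSemigroup ν S t (clamp a b f) x := fun x hx t =>
    productSemigroup_congr (fun y hy => (hf.clamp_eq hab hy).symm) hx t
  have h0 : ∀ x ≤ a, clamp a b f x = 0 := fun x hx => hf.clamp_eq_zero hab hx
  rw [productSemigroup_eq hν hh]
  have e1 : ∀ᵐ y ∂(subordinatorLaw ν h), S h (potentialConv ν S a f (x - y)) =
      ∫ t in Ioi 0, S h (productSemigroup ν S t (clamp a b f) (x - y)) := by
    filter_upwards [hν.law_ae_nonneg hh] with y hy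
    have hxy : x - y ≤ b := by linarith
    obtain ⟨i1, i2⟩ := integrableOn_productSemigroup hν hν0 hS hab hf hxy
    rw [i2, ← (S h).integral_comp_comm i1]
    simp_rw [hcong _ hxy]
  rw [integral_congr_ae e1, integral_integral_swap]
  · refine setIntegral_congr_fun measurableSet_Ioi fun t (ht : 0 < t) => ?_
    rw [hcong x hx, add_comm t h, ← productSemigroup_add hν hS hh ht.le hc.stronglyMeasurable hK,
      productSemigroup_eq hν hh]
  -- Scalar integrability of `t ↦ G(t, (-∞, b - a])` is the vector statement for the trivial
  -- semigroup on `ℝ`, applied to the vector `1`.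
  · have hb : Integrable (fun t => K * (subordinatorLaw ν t).real (Iic (b - a)))
        (volume.restrict (Ioi 0)) := by
      have := (integral_law_smul hν hν0 (S := fun _ => ContinuousLinearMap.id ℝ ℝ)
        ⟨rfl, fun _ _ _ _ => rfl, fun _ _ => ContinuousLinearMap.norm_id_le,
          fun Y => tendsto_const_nhds⟩ (measurableSet_Iic (a := b - a)) subset_rfl 1).1
      simpa using this.const_mul K
    refine (hb.comp_snd (subordinatorLaw ν h)).mono' ?_ ?_
    · have m1 : StronglyMeasurable fun p : ℝ × ℝ =>
          S h (productSemigroup ν S (max p.2 0) (clamp a b f) (x - p.1)) :=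
        (S h).continuous.comp_stronglyMeasurable
          ((stronglyMeasurable_productSemigroup hν hS hc.stronglyMeasurable).comp_measurable
            (measurable_snd.prodMk (measurable_const.sub measurable_fst)))
      refine m1.aestronglyMeasurable.congr ?_
      have : ∀ᵐ p ∂((subordinatorLaw ν h).prod (volume.restrict (Ioi (0 : ℝ)))), p.2 ∈ Ioi 0 :=
        Measure.quasiMeasurePreserving_snd.ae (ae_restrict_mem measurableSet_Ioi)
      filter_upwards [this] with p hp
      simp only [Function.uncurry_def, max_eq_left (le_of_lt (mem_Ioi.1 hp))]
    · have hp1 : ∀ᵐ p ∂((subordinatorLaw ν h).prod (volume.restrict (Ioi (0 : ℝ)))),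
          p.2 ∈ Ioi 0 := Measure.quasiMeasurePreserving_snd.ae (ae_restrict_mem measurableSet_Ioi)
      have hp2 : ∀ᵐ p ∂((subordinatorLaw ν h).prod (volume.restrict (Ioi (0 : ℝ)))), 0 ≤ p.1 :=
        Measure.quasiMeasurePreserving_fst.ae (hν.law_ae_nonneg hh)
      filter_upwards [hp1, hp2] with p h1 h2
      exact (hS.norm_apply_le hh _).trans (norm_productSemigroup_le_mul hν hS
        (le_of_lt (mem_Ioi.1 h1)) h0 (by linarith) hK)

lemma eventually_norm_average_sub_le {a b : ℝ} (hab : a ≤ b) {f : ℝ → B} (hf : IsKill 0 a b f)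
    {ε : ℝ} (hε : 0 < ε) : ∀ᶠ h in 𝓝[>] (0 : ℝ), ∀ x ≤ b,
      ‖h⁻¹ • (∫ t in (0 : ℝ)..h, productSemigroup ν S t f x) - f x‖ ≤ ε := by
  obtain ⟨r, hr, h'⟩ := mem_nhdsGT_iff_exists_Ioc_subset.1
    (eventually_norm_productSemigroup_sub_le hν hS hab hf hε)
  filter_upwards [Ioc_mem_nhdsGT hr] with h hh x hx
  refine norm_average_sub_le hh.1 ?_ fun s hs hsh => h' ⟨hs, hsh.trans hh.2⟩ x hx
  rw [intervalIntegrable_iff_integrableOn_Ioc_of_le hh.1.le]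
  exact (integrableOn_productSemigroup hν hν0 hS hab hf hx).1.mono_set Ioc_subset_Ioi_self

/-- The potential of `g` is a classical solution. -/
theorem isClassicalSolution_potentialConv {a b : ℝ} (hab : a ≤ b) {g : ℝ → B}
    (hg : IsKill 0 a b g) : IsClassicalSolution ν S a b g (potentialConv ν S a g) where
  mem := IsKill.of_continuousOn (continuousOn_potentialConv hν hν0 hS hab hg)
    fun _ hx => potentialConv_eq_zero hx
  mem_value := IsKill.of_continuousOn hg.continuousOn.neg fun x hx => by simp [hg.eq_zero x hx]
  tendsto := by
    rw [Metric.tendstoUniformlyOn_iff]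
    intro ε hε
    filter_upwards [eventually_norm_average_sub_le hν hν0 hS hab hg (half_pos hε),
      self_mem_nhdsWithin] with h h1 h2 x hx
    have h2 : 0 < h := h2
    rw [productSemigroup_potentialConv hν hν0 hS hab hg hx h2.le,
      integral_Ioi_shift_productSemigroup hν hν0 hS hab hg hx h2.le, dist_comm, dist_eq_norm,
      smul_neg, ← neg_add', norm_neg]
    refine lt_of_le_of_lt ?_ (half_lt_self hε)
    simpa [sub_eq_add_neg] using h1 x hx

lemma potentialConv_productSemigroup {a b x h : ℝ} (hab : a ≤ b) {f : ℝ → B}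
    (hf : IsKill 0 a b f) (hx : x ≤ b) (hh : 0 ≤ h) :
    potentialConv ν S a (productSemigroup ν S h f) x =
      ∫ t in Ioi 0, productSemigroup ν S (t + h) f x := by
  obtain ⟨K, hK0, hK⟩ := exists_norm_clamp_le hab hf.continuousOn_Icc
  have hc := continuous_clamp hab hf.continuousOn_Icc
  have hcong : ∀ x ≤ b, ∀ t, productSemigroup ν S t f x =
      productSemigroup ν S t (clamp a b f) x := fun x hx t =>
    productSemigroup_congr (fun y hy => (hf.clamp_eq hab hy).symm) hx t
  rw [(integrableOn_productSemigroup hν hν0 hS hab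
    (isKill_productSemigroup hν hS hh hab hf) hx).2]
  refine setIntegral_congr_fun measurableSet_Ioi fun t (ht : 0 < t) => ?_
  rw [hcong x hx, ← productSemigroup_add hν hS ht.le hh hc.stronglyMeasurable hK]
  exact productSemigroup_congr (fun y hy => hcong y hy h) hx t

/-- Classical solutions are unique. -/
theorem IsClassicalSolution.eqOn {a b : ℝ} (hab : a ≤ b) {f g : ℝ → B}
    (hg : IsKill 0 a b g) (h : IsClassicalSolution ν S a b g f) :
    EqOn f (potentialConv ν S a g) (Iic b) := fun x hx => by
  have hx : x ≤ b := hx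
  have hf : IsKill 0 a b f := h.mem
  have hcf := hf.continuousOn_Icc
  have hcg := hg.continuousOn_Icc
  set C := Real.exp (1 * (b - a)) / laplaceExponent ν 1 with hC
  have hC0 : 0 ≤ C := div_nonneg (Real.exp_nonneg _) (hν.laplaceExponent_pos hν0 one_pos).le
  rw [← sub_eq_zero, ← norm_le_zero_iff]
  refine le_of_forall_pos_le_add fun ε hε => ?_
  have hδ : 0 < ε / (2 * (C + 1)) := by positivity
  have h1 := Metric.tendstoUniformlyOn_iff.1 h.tendsto _ hδ
  have h2 := eventually_norm_average_sub_le hν hν0 hS hab hf (half_pos hε)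
  obtain ⟨r, ⟨h3, h4⟩, hr⟩ := ((h1.and h2).and self_mem_nhdsWithin).exists
  have hr : 0 < r := hr
  have hW := isKill_productSemigroup hν hS hr.le hab hf
  have hcW := hW.continuousOn_Icc
  -- The potential of the difference quotient of `f` is minus the mean of `T'_t e^{tA} f` over
  -- `[0,r]`, which is close to `-f`. The quotient itself is uniformly close to `-g`, so by
  -- boundedness its potential is close to minus that of `g`. The tolerance `ε/(2(C+1))` absorbs the
  -- norm bound `C` of the potential operator.
  have e1 : potentialConv ν S a (r⁻¹ • (productSemigroup ν S r f - f) - -g) x =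
      -(r⁻¹ • ∫ t in (0 : ℝ)..r, productSemigroup ν S t f x) + potentialConv ν S a g x := by
    have hneg : potentialConv ν S a (-g) x = -potentialConv ν S a g x := by
      simpa using potentialConv_smul (ν := ν) (S := S) a (-1) g x
    rw [potentialConv_sub hν hν0 hS hab ((hcW.sub hcf).const_smul r⁻¹) hcg.neg hx,
      potentialConv_smul, potentialConv_sub hν hν0 hS hab hcW hcf hx,
      potentialConv_productSemigroup hν hν0 hS hab hf hx hr.le,
      integral_Ioi_shift_productSemigroup hν hν0 hS hab hf hx hr.le, hneg, smul_neg, sub_neg_eq_add]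
  have e2 := norm_potentialConv_le hν hν0 hS hab one_pos (K := ε / (2 * (C + 1)))
    (((hcW.sub hcf).const_smul r⁻¹).sub hcg.neg) (fun y hy => by
      have := h3 y hy.2
      rw [dist_comm, dist_eq_norm] at this
      exact this.le) hx
  rw [← hC, e1] at e2
  have e3 := h4 x hx
  have e4 : f x - potentialConv ν S a g x =
      -(r⁻¹ • (∫ t in (0 : ℝ)..r, productSemigroup ν S t f x) - f x) -
      (-(r⁻¹ • ∫ t in (0 : ℝ)..r, productSemigroup ν S t f x) + potentialConv ν S a g x) := by
    abel
  rw [e4]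
  refine (norm_sub_le _ _).trans ?_
  rw [norm_neg]
  have e5 : C * (ε / (2 * (C + 1))) ≤ ε / 2 := by
    rw [mul_div_assoc', div_le_div_iff₀ (by positivity) (by positivity)]
    nlinarith
  linarith

end

end GenFrac

namespace GenFrac

variable {ν : Measure ℝ}

/-! ### The forward equation for the subordinator laws -/

/-- The increments of the continuous function `w` over `[y, y + r] ⊆ [0, ∞)` are at most
`C min(1, r)`. -/
structure HasTameIncrements (C : ℝ) (w : ℝ → ℝ) : Prop where
  continuous : Continuous w
  norm_le : ∀ y r : ℝ, 0 ≤ y → 0 ≤ r → ‖w (y + r) - w y‖ ≤ C * min 1 r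

/-- Integrating the bound on `w'` gives `C (e^{-y} - e^{-(y+r)}) ≤ C min(1, r)`. The weight `e^{-y}`
is exactly the factor that the chain rule produces for functions of `e^{-y}`. -/
lemma HasTameIncrements.of_deriv {C : ℝ} {w w' : ℝ → ℝ} (hC : 0 ≤ C)
    (hw : ∀ y, HasDerivAt w (w' y) y) (h : ∀ y, 0 ≤ y → ‖w' y‖ ≤ C * Real.exp (-y)) :
    HasTameIncrements C w := by
  have hc : Continuous w := continuous_iff_continuousAt.2 fun y => (hw y).continuousAt
  refine ⟨hc, fun y r hy hr => ?_⟩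
  have h1 : ‖w (y + r) - w y‖ ≤ C * (Real.exp (-y) - Real.exp (-(y + r))) := by
    refine image_norm_le_of_norm_deriv_right_le_deriv_boundary (f := fun s => w s - w y)
      (f' := w') (B := fun s => C * (Real.exp (-y) - Real.exp (-s)))
      (B' := fun s => C * Real.exp (-s)) (by fun_prop)
      (fun s _ => ((hw s).sub_const _).hasDerivWithinAt) (by simp) (fun s => ?_)
      (fun s hs => h s (hy.trans hs.1)) ⟨by linarith, le_rfl⟩
    have h2 : HasDerivAt (fun s : ℝ => Real.exp (-s)) (-Real.exp (-s)) s := by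
      simpa using (hasDerivAt_neg s).exp
    simpa using (h2.const_sub (Real.exp (-y))).const_mul C
  refine h1.trans (mul_le_mul_of_nonneg_left ?_ hC)
  have e0 : Real.exp (-y) ≤ 1 := by simpa using hy
  have e1 : 0 < Real.exp (-(y + r)) := Real.exp_pos _
  refine le_min (by linarith) ?_
  have e2 : Real.exp (-(y + r)) = Real.exp (-y) * Real.exp (-r) := by
    rw [← Real.exp_add]; ring_nf
  have e3 := Real.add_one_le_exp (-r)
  have e4 : 0 < Real.exp (-y) := Real.exp_pos _
  rw [e2]
  nlinarith

lemma HasTameIncrements.add {C D : ℝ} {v w : ℝ → ℝ} (hv : HasTameIncrements C v)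
    (hw : HasTameIncrements D w) : HasTameIncrements (C + D) fun y => v y + w y := by
  refine ⟨hv.continuous.add hw.continuous, fun y r hy hr => ?_⟩
  have : v (y + r) + w (y + r) - (v y + w y) = (v (y + r) - v y) + (w (y + r) - w y) := by ring
  rw [this, add_mul]
  exact (norm_add_le _ _).trans (add_le_add (hv.norm_le y r hy hr) (hw.norm_le y r hy hr))

lemma hasTameIncrements_exp (c : ℝ) (n : ℕ) :
    ∃ C, HasTameIncrements C fun y : ℝ => c * Real.exp (-y) ^ n := by
  have hd : ∀ y : ℝ, HasDerivAt (fun y : ℝ => c * Real.exp (-y) ^ n)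
      (c * (n * Real.exp (-y) ^ (n - 1) * -Real.exp (-y))) y := fun y => by
    have h2 : HasDerivAt (fun s : ℝ => Real.exp (-s)) (-Real.exp (-y)) y := by
      simpa using (hasDerivAt_neg y).exp
    exact (h2.pow n).const_mul c
  refine ⟨|c| * n, HasTameIncrements.of_deriv (by positivity) hd fun y hy => ?_⟩
  have h1 : Real.exp (-y) ≤ 1 := by simpa using hy
  have h2 : Real.exp (-y) ^ (n - 1) ≤ 1 := pow_le_one₀ (Real.exp_nonneg _) h1
  have h3 : ‖c * (n * Real.exp (-y) ^ (n - 1) * -Real.exp (-y))‖ =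
      |c| * n * Real.exp (-y) * Real.exp (-y) ^ (n - 1) := by
    simp only [norm_mul, Real.norm_eq_abs, abs_neg, Nat.abs_cast, abs_pow, Real.abs_exp]
    ring
  rw [h3]
  exact mul_le_of_le_one_right (by positivity) h2

variable (hν : IsOneSidedLevy ν)

section
include hν

lemma dualLevyOp_eq (w : ℝ → ℝ) (y : ℝ) : dualLevyOp ν w y = ∫ r, (w (y + r) - w y) ∂ν := by
  rw [dualLevyOp, hν.restrict_Ioi]

namespace HasTameIncrements

variable {C : ℝ} {w : ℝ → ℝ}

lemma integrable_increment (hw : HasTameIncrements C w) {y : ℝ} (hy : 0 ≤ y) :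
    Integrable (fun r => w (y + r) - w y) ν := by
  have := hw.continuous
  exact hν.integrable_of_norm_le (by fun_prop) fun r hr => hw.norm_le y r hy hr.le

lemma norm_dualLevyOp_le (hw : HasTameIncrements C w) {y : ℝ} (hy : 0 ≤ y) :
    ‖dualLevyOp ν w y‖ ≤ C * ∫ r, min 1 r ∂ν := by
  rw [dualLevyOp_eq hν, ← integral_const_mul]
  refine norm_integral_le_of_norm_le (hν.integrable_min.const_mul C) ?_
  filter_upwards [hν.ae_pos] with r hr using hw.norm_le y r hy hr.le

lemma stronglyMeasurable_dualLevyOp (hw : HasTameIncrements C w) :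
    StronglyMeasurable (dualLevyOp ν w) := by
  have := hν.sigmaFinite
  have hc := hw.continuous
  have h1 : dualLevyOp ν w = fun y => ∫ r, (w (y + r) - w y) ∂ν := funext (dualLevyOp_eq hν w)
  rw [h1]
  have h2 : StronglyMeasurable fun p : ℝ × ℝ => w (p.1 + p.2) - w p.1 :=
    (by fun_prop : Continuous fun p : ℝ × ℝ => w (p.1 + p.2) - w p.1).stronglyMeasurable
  exact h2.integral_prod_right'

lemma integrable_sub_law (hw : HasTameIncrements C w) {t : ℝ} (ht : 0 ≤ t) :
    Integrable (fun y => w y - w 0) (subordinatorLaw ν t) := by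
  have := hν.isProb ht
  have hc := hw.continuous
  have hC : 0 ≤ C := by simpa using (norm_nonneg _).trans (hw.norm_le 0 1 le_rfl zero_le_one)
  refine Integrable.of_bound (C := C) (by fun_prop) ?_
  filter_upwards [hν.law_ae_nonneg ht] with y hy
  have := hw.norm_le 0 y le_rfl hy
  rw [zero_add] at this
  exact this.trans (mul_le_of_le_one_right hC (min_le_left _ _))

lemma integrable_dualLevyOp_law (hw : HasTameIncrements C w) {t : ℝ} (ht : 0 ≤ t) :
    Integrable (dualLevyOp ν w) (subordinatorLaw ν t) := by
  have := hν.isProb ht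
  refine Integrable.of_bound (hw.stronglyMeasurable_dualLevyOp hν).aestronglyMeasurable
    (C * ∫ r, min 1 r ∂ν) ?_
  filter_upwards [hν.law_ae_nonneg ht] with y hy using hw.norm_dualLevyOp_le hν hy

lemma norm_integral_dualLevyOp_le (hw : HasTameIncrements C w) {t : ℝ} (ht : 0 ≤ t) :
    ‖∫ y, dualLevyOp ν w y ∂(subordinatorLaw ν t)‖ ≤ C * ∫ r, min 1 r ∂ν := by
  have := hν.isProb ht
  refine (norm_integral_le_of_norm_le_const (C := C * ∫ r, min 1 r ∂ν) ?_).trans (by simp)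
  filter_upwards [hν.law_ae_nonneg ht] with y hy using hw.norm_dualLevyOp_le hν hy

lemma intervalIntegrable_dualLevyOp (hw : HasTameIncrements C w) {t : ℝ} (ht : 0 ≤ t) :
    IntervalIntegrable (fun s => ∫ y, dualLevyOp ν w y ∂(subordinatorLaw ν s)) volume 0 t := by
  rw [intervalIntegrable_iff_integrableOn_Ioc_of_le ht]
  have h1 : StronglyMeasurable fun s => ∫ y, dualLevyOp ν w y ∂(hν.lawKernel s) :=
    StronglyMeasurable.integral_kernel_prod_right' (κ := hν.lawKernel)
      (f := fun p : ℝ × ℝ => dualLevyOp ν w p.2)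
      ((hw.stronglyMeasurable_dualLevyOp hν).comp_measurable measurable_snd)
  have h2 : IntegrableOn (fun s => ∫ y, dualLevyOp ν w y ∂(hν.lawKernel s)) (Ioc 0 t) := by
    refine Integrable.of_bound h1.aestronglyMeasurable (C * ∫ r, min 1 r ∂ν) ?_
    refine Eventually.of_forall fun s => hw.norm_integral_dualLevyOp_le hν (le_max_right s 0)
  refine h2.congr_fun (fun s hs => ?_) measurableSet_Ioc
  simp only [hν.lawKernel_apply hs.1.le]

end HasTameIncrements

/-- The defect in the forward equation `G_t w - w(0) = ∫_0^t G_s L_ν w ds`. -/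
noncomputable def forwardDefect (ν : Measure ℝ) (t : ℝ) (w : ℝ → ℝ) : ℝ :=
  ∫ y, (w y - w 0) ∂(subordinatorLaw ν t) -
    ∫ s in (0 : ℝ)..t, ∫ y, dualLevyOp ν w y ∂(subordinatorLaw ν s)

variable {t : ℝ}

/-- The defect is controlled by the increment constant alone. An approximation of derivatives in the
weight `e^{-y}` therefore suffices to extend the forward equation. -/
lemma norm_forwardDefect_le (ht : 0 ≤ t) {C : ℝ} {w : ℝ → ℝ} (hw : HasTameIncrements C w) :
    ‖forwardDefect ν t w‖ ≤ C * (1 + t * ∫ r, min 1 r ∂ν) := by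
  have := hν.isProb ht
  have hC : 0 ≤ C := by simpa using (norm_nonneg _).trans (hw.norm_le 0 1 le_rfl zero_le_one)
  have h1 : ‖∫ y, (w y - w 0) ∂(subordinatorLaw ν t)‖ ≤ C := by
    refine (norm_integral_le_of_norm_le_const (C := C) ?_).trans (by simp)
    filter_upwards [hν.law_ae_nonneg ht] with y hy
    have := hw.norm_le 0 y le_rfl hy
    rw [zero_add] at this
    exact this.trans (mul_le_of_le_one_right hC (min_le_left _ _))
  have h2 : ‖∫ s in (0 : ℝ)..t, ∫ y, dualLevyOp ν w y ∂(subordinatorLaw ν s)‖ ≤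
      (C * ∫ r, min 1 r ∂ν) * |t - 0| := by
    refine intervalIntegral.norm_integral_le_of_norm_le_const fun s hs => ?_
    rw [uIoc_of_le ht] at hs
    exact hw.norm_integral_dualLevyOp_le hν hs.1.le
  rw [sub_zero, abs_of_nonneg ht] at h2
  refine (norm_sub_le _ _).trans ?_
  nlinarith

lemma forwardDefect_add (ht : 0 ≤ t) {C D : ℝ} {v w : ℝ → ℝ} (hv : HasTameIncrements C v)
    (hw : HasTameIncrements D w) : forwardDefect ν t (fun y => v y + w y) =
      forwardDefect ν t v + forwardDefect ν t w := by
  have e1 : ∫ y, (v y + w y - (v 0 + w 0)) ∂(subordinatorLaw ν t) =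
      ∫ y, (v y - v 0) ∂(subordinatorLaw ν t) + ∫ y, (w y - w 0) ∂(subordinatorLaw ν t) := by
    rw [← integral_add (hv.integrable_sub_law hν ht) (hw.integrable_sub_law hν ht)]
    congr with y
    ring
  have e2 : ∀ s, 0 ≤ s → ∫ y, dualLevyOp ν (fun y => v y + w y) y ∂(subordinatorLaw ν s) =
      ∫ y, dualLevyOp ν v y ∂(subordinatorLaw ν s) +
        ∫ y, dualLevyOp ν w y ∂(subordinatorLaw ν s) := fun s hs => by
    rw [← integral_add (hv.integrable_dualLevyOp_law hν hs) (hw.integrable_dualLevyOp_law hν hs)]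
    refine integral_congr_ae ?_
    filter_upwards [hν.law_ae_nonneg hs] with y hy
    simp only [dualLevyOp_eq hν]
    rw [← integral_add (hv.integrable_increment hν hy) (hw.integrable_increment hν hy)]
    congr with r
    ring
  have e3 : ∫ s in (0 : ℝ)..t, ∫ y, dualLevyOp ν (fun y => v y + w y) y ∂(subordinatorLaw ν s) =
      (∫ s in (0 : ℝ)..t, ∫ y, dualLevyOp ν v y ∂(subordinatorLaw ν s)) +
        ∫ s in (0 : ℝ)..t, ∫ y, dualLevyOp ν w y ∂(subordinatorLaw ν s) := by
    rw [← intervalIntegral.integral_add (hv.intervalIntegrable_dualLevyOp hν ht)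
      (hw.intervalIntegrable_dualLevyOp hν ht)]
    refine intervalIntegral.integral_congr fun s hs => ?_
    rw [uIcc_of_le ht] at hs
    exact e2 s hs.1
  simp only [forwardDefect]
  rw [e1, e3]
  ring

/-- Exponentials are eigenfunctions, `L_ν e^{-n·} = -φ(n) e^{-n·}`, and `G_s` takes `e^{-n·}` to
`e^{-sφ(n)}`. The forward equation becomes the integrated derivative of `e^{-sφ(n)}`. -/
lemma forwardDefect_exp (ht : 0 ≤ t) (c : ℝ) (n : ℕ) :
    forwardDefect ν t (fun y : ℝ => c * Real.exp (-y) ^ n) = 0 := by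
  have := hν.isProb ht
  set φ := laplaceExponent ν n with hφ
  have hpow : ∀ y : ℝ, Real.exp (-y) ^ n = Real.exp (-(n * y)) := fun y => by
    rw [← Real.exp_nat_mul]; ring_nf
  have hn : (0 : ℝ) ≤ n := by positivity
  simp only [forwardDefect, hpow]
  have e1 : ∫ y, (c * Real.exp (-(n * y)) - c * Real.exp (-(n * 0))) ∂(subordinatorLaw ν t) =
      c * (Real.exp (-(t * φ)) - 1) := by
    rw [integral_sub ((hν.integrable_exp_law ht hn).const_mul c) (integrable_const _),
      integral_const_mul, hν.laplace ht hn]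
    simp
    ring
  have e2 : dualLevyOp ν (fun y => c * Real.exp (-(n * y))) =
      fun y => -(c * φ) * Real.exp (-(n * y)) := by
    ext y
    rw [dualLevyOp_eq hν, hφ, laplaceExponent, hν.restrict_Ioi]
    have : ∀ r : ℝ, c * Real.exp (-(n * (y + r))) - c * Real.exp (-(n * y)) =
        -(c * Real.exp (-(n * y))) * (1 - Real.exp (-(n * r))) := fun r => by
      rw [mul_add, neg_add, Real.exp_add]; ring
    simp_rw [this]
    rw [integral_const_mul]
    ring
  have e3 : ∫ s in (0 : ℝ)..t,
      ∫ y, dualLevyOp ν (fun y => c * Real.exp (-(n * y))) y ∂(subordinatorLaw ν s) =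
      ∫ s in (0 : ℝ)..t, c * (-φ * Real.exp (-(s * φ))) := by
    refine intervalIntegral.integral_congr fun s hs => ?_
    rw [uIcc_of_le ht] at hs
    simp only [e2]
    rw [integral_const_mul, hν.laplace hs.1 hn]
    ring
  have e4 : ∫ s in (0 : ℝ)..t, c * (-φ * Real.exp (-(s * φ))) =
      c * Real.exp (-(t * φ)) - c * Real.exp (-(0 * φ)) := by
    refine intervalIntegral.integral_eq_sub_of_hasDerivAt
      (f := fun s => c * Real.exp (-(s * φ))) (fun s _ => ?_)
      ((by fun_prop : Continuous fun s : ℝ => c * (-φ * Real.exp (-(s * φ)))).intervalIntegrable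
        _ _)
    have : HasDerivAt (fun s : ℝ => -(s * φ)) (-φ) s := by
      simpa using ((hasDerivAt_id s).mul_const φ).fun_neg
    have := this.exp.const_mul c
    rwa [mul_comm (Real.exp _)] at this
  rw [e1, e3, e4]
  simp
  ring

lemma forwardDefect_polynomial (ht : 0 ≤ t) (Q : Polynomial ℝ) :
    (∃ C, HasTameIncrements C fun y : ℝ => Q.eval (Real.exp (-y))) ∧
      forwardDefect ν t (fun y : ℝ => Q.eval (Real.exp (-y))) = 0 := by
  induction Q using Polynomial.induction_on' with
  | add p q hp hq =>
    obtain ⟨⟨C, hC⟩, h1⟩ := hp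
    obtain ⟨⟨D, hD⟩, h2⟩ := hq
    simp only [Polynomial.eval_add]
    exact ⟨⟨_, hC.add hD⟩, by rw [forwardDefect_add hν ht hC hD, h1, h2, add_zero]⟩
  | monomial n c =>
    simp only [Polynomial.eval_monomial]
    exact ⟨hasTameIncrements_exp c n, forwardDefect_exp hν ht c n⟩

end

lemma exists_polynomial_derivative_eq (p : Polynomial ℝ) :
    ∃ Q : Polynomial ℝ, Polynomial.derivative Q = p := by
  induction p using Polynomial.induction_on' with
  | add p q hp hq =>
    obtain ⟨P, rfl⟩ := hp
    obtain ⟨Q, rfl⟩ := hq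
    exact ⟨P + Q, by simp⟩
  | monomial n c =>
    refine ⟨Polynomial.monomial (n + 1) (c / (n + 1)), ?_⟩
    rw [Polynomial.derivative_monomial]
    congr 1
    push_cast
    field_simp

/-- The forward equation for `C¹` functions that are eventually constant. -/
theorem forwardDefect_eq_zero (hν : IsOneSidedLevy ν) {t : ℝ} (ht : 0 ≤ t) {v v' : ℝ → ℝ}
    (hv : ∀ y, HasDerivAt v (v' y) y) (hv' : Continuous v') {R : ℝ} (hR : ∀ y, R ≤ y → v' y = 0) :
    (∃ C, HasTameIncrements C v) ∧ forwardDefect ν t v = 0 := by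
  have hvC : ∃ C, HasTameIncrements C v := by
    obtain ⟨K, hK⟩ := (isCompact_Icc (a := (0 : ℝ)) (b := R)).exists_bound_of_continuousOn
      hv'.continuousOn
    refine ⟨|K| * Real.exp R, HasTameIncrements.of_deriv (by positivity) hv fun y hy => ?_⟩
    rcases le_total R y with h | h
    · rw [hR y h, norm_zero]; positivity
    · have h1 : 1 ≤ Real.exp R * Real.exp (-y) := by
        rw [← Real.exp_add, Real.one_le_exp_iff]; linarith
      have h2 := (hK y ⟨hy, h⟩).trans (le_abs_self K)
      rw [mul_assoc]
      exact h2.trans (le_mul_of_one_le_right (abs_nonneg _) h1)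
  refine ⟨hvC, ?_⟩
  set M := 1 + t * ∫ r, min 1 r ∂ν with hM
  have hM0 : 0 < M := by
    have : 0 ≤ ∫ r, min 1 r ∂ν := integral_nonneg_of_ae (by
      filter_upwards [hν.ae_pos] with r hr
      exact le_min zero_le_one hr.le)
    positivity
  rw [← norm_le_zero_iff]
  refine le_of_forall_pos_le_add fun ε hε => ?_
  rw [zero_add]
  -- In the variable `q = e^{-y}` one has `v'(y) = e^{-y} H(e^{-y})`. Freezing `q` below `e^{-R}`
  -- keeps `H` continuous at `q = 0`, and is consistent since `v'` vanishes from `R` on.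
  set H : ℝ → ℝ := fun q => v' (-Real.log (max q (Real.exp (-R)))) / max q (Real.exp (-R)) with hH
  have hpos : ∀ q : ℝ, 0 < max q (Real.exp (-R)) := fun q =>
    lt_max_of_lt_right (Real.exp_pos _)
  have hHc : Continuous H := by
    have h1 : Continuous fun q : ℝ => max q (Real.exp (-R)) := by fun_prop
    exact (hv'.comp (h1.log fun q => (hpos q).ne').neg).div h1 fun q => (hpos q).ne'
  have hHe : ∀ y, v' y = Real.exp (-y) * H (Real.exp (-y)) := fun y => by
    rcases le_total R y with h | h
    · have : max (Real.exp (-y)) (Real.exp (-R)) = Real.exp (-R) :=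
        max_eq_right (Real.exp_le_exp.2 (neg_le_neg h))
      simp only [hH, this, Real.log_exp, neg_neg, hR R le_rfl, hR y h]
      simp
    · have : max (Real.exp (-y)) (Real.exp (-R)) = Real.exp (-y) :=
        max_eq_left (Real.exp_le_exp.2 (neg_le_neg h))
      simp only [hH, this, Real.log_exp, neg_neg]
      field_simp
  -- Weierstrass approximation is applied to `H`, that is to the derivative. With `Q` a primitive of
  -- `p`, the derivative of `Q(e^{-y})` is `-e^{-y} p(e^{-y})`, so it is the sum `v + Q(e^{-y})`
  -- whose derivative is at most `(ε/M) e^{-y}`.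
  obtain ⟨p, hp⟩ := exists_polynomial_near_of_continuousOn 0 1 H hHc.continuousOn (ε / M)
    (by positivity)
  obtain ⟨Q, rfl⟩ := exists_polynomial_derivative_eq p
  obtain ⟨⟨D, hD⟩, hQ⟩ := forwardDefect_polynomial hν ht Q
  have hw : HasTameIncrements (ε / M) fun y => v y + Q.eval (Real.exp (-y)) := by
    refine HasTameIncrements.of_deriv (by positivity) (w' := fun y =>
      v' y + (Polynomial.derivative Q).eval (Real.exp (-y)) * -Real.exp (-y)) (fun y => ?_)
      fun y hy => ?_
    · have h2 : HasDerivAt (fun s : ℝ => Real.exp (-s)) (-Real.exp (-y)) y := by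
        simpa using (hasDerivAt_neg y).exp
      exact (hv y).add ((Q.hasDerivAt _).comp y h2)
    · have h3 := hp (Real.exp (-y)) ⟨Real.exp_nonneg _, by simpa using hy⟩
      have h4 : v' y + (Polynomial.derivative Q).eval (Real.exp (-y)) * -Real.exp (-y) =
          -(((Polynomial.derivative Q).eval (Real.exp (-y)) - H (Real.exp (-y))) *
            Real.exp (-y)) := by
        rw [hHe y]; ring
      rw [h4, norm_neg, norm_mul, Real.norm_eq_abs, Real.norm_of_nonneg (Real.exp_nonneg _)]
      exact mul_le_mul_of_nonneg_right h3.le (Real.exp_nonneg _)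
  obtain ⟨C, hC⟩ := hvC
  have h5 := norm_forwardDefect_le hν ht hw
  rw [forwardDefect_add hν ht hC hD, hQ, add_zero, ← hM] at h5
  rwa [div_mul_cancel₀ _ hM0.ne'] at h5

end GenFrac

namespace GenFrac

variable {ν : Measure ℝ} {B : Type*} [NormedAddCommGroup B] [NormedSpace ℝ B]
  {S : ℝ → B →L[ℝ] B}

/-! ### The generator on `C¹` functions -/

/-- The operator `L'_ν f (x) = ∫ (f(x-y) - f(x)) ν(dy)`. -/
noncomputable def levyOp (ν : Measure ℝ) (f : ℝ → B) (x : ℝ) : B := ∫ y, (f (x - y) - f x) ∂ν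

lemma isContractionSemigroup_id : IsContractionSemigroup fun _ => ContinuousLinearMap.id ℝ B :=
  ⟨rfl, fun _ _ _ _ => rfl, fun _ _ => ContinuousLinearMap.norm_id_le, fun _ => tendsto_const_nhds⟩

namespace IsC1Kill

variable {a b K : ℝ} {u u' : ℝ → B}

lemma nonneg (hu : IsC1Kill a K u u') : 0 ≤ K := (norm_nonneg _).trans (hu.norm_deriv_le 0)

lemma norm_sub_le (hu : IsC1Kill a K u u') (x y : ℝ) : ‖u x - u y‖ ≤ K * |x - y| := by
  have := Convex.norm_image_sub_le_of_norm_hasDerivWithin_le (s := univ) (f := u) (f' := u')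
    (fun x _ => (hu.hasDerivAt x).hasDerivWithinAt) (fun x _ => hu.norm_deriv_le x) convex_univ
    (mem_univ y) (mem_univ x)
  rwa [Real.norm_eq_abs] at this

lemma deriv_eq_zero (hu : IsC1Kill a K u u') {x : ℝ} (hx : x ≤ a) : u' x = 0 := by
  have h1 : HasDerivWithinAt u (u' x) (Iic x) x := (hu.hasDerivAt x).hasDerivWithinAt
  have h2 : HasDerivWithinAt u 0 (Iic x) x :=
    (hasDerivWithinAt_const x (Iic x) (0 : B)).congr (fun y hy => hu.eq_zero y (le_trans hy hx))
      (hu.eq_zero x hx)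
  exact (uniqueDiffWithinAt_Iic x).eq_deriv _ h1 h2

lemma norm_le (hu : IsC1Kill a K u u') (hab : a ≤ b) {x : ℝ} (hx : x ≤ b) :
    ‖u x‖ ≤ K * (b - a) := by
  have hK := hu.nonneg
  rcases le_total x a with h | h
  · rw [hu.eq_zero x h, norm_zero]
    exact mul_nonneg hK (sub_nonneg.2 hab)
  · have := hu.norm_sub_le x a
    rw [hu.eq_zero a le_rfl, sub_zero, abs_of_nonneg (sub_nonneg.2 h)] at this
    exact this.trans (mul_le_mul_of_nonneg_left (by linarith) hK)

lemma norm_increment_le (hu : IsC1Kill a K u u') (hab : a ≤ b) {x : ℝ} (hx : x ≤ b) {y : ℝ}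
    (hy : 0 ≤ y) : ‖u (x - y) - u x‖ ≤ (K + 2 * (K * (b - a))) * min 1 y := by
  have hK := hu.nonneg
  have hKb : 0 ≤ K * (b - a) := mul_nonneg hK (sub_nonneg.2 hab)
  rcases le_total 1 y with h | h
  · rw [min_eq_left h]
    have := (_root_.norm_sub_le (u (x - y)) (u x)).trans
      (add_le_add (hu.norm_le hab (by linarith : x - y ≤ b)) (hu.norm_le hab hx))
    linarith
  · rw [min_eq_right h]
    have := hu.norm_sub_le (x - y) x
    rw [sub_sub_cancel_left, abs_neg, abs_of_nonneg hy] at this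
    nlinarith

lemma integrable_increment (hν : IsOneSidedLevy ν) (hu : IsC1Kill a K u u') (hab : a ≤ b) {x : ℝ}
    (hx : x ≤ b) : Integrable (fun y => u (x - y) - u x) ν := by
  have := hu.continuous
  exact hν.integrable_of_norm_le (by fun_prop : Continuous _).aestronglyMeasurable
    fun y hy => hu.norm_increment_le hab hx hy.le

lemma isKill_levyOp (hν : IsOneSidedLevy ν) (hu : IsC1Kill a K u u') (hab : a ≤ b) :
    IsKill 0 a b (levyOp ν u) := by
  have hc := hu.continuous
  refine IsKill.of_continuousOn ?_ fun x hx => ?_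
  · refine continuousOn_of_dominated (bound := fun y => (K + 2 * (K * (b - a))) * min 1 y)
      (fun x _ => (by fun_prop : Continuous fun y => u (x - y) - u x).aestronglyMeasurable)
      (fun x hx => hν.ae_pos.mono fun y hy => hu.norm_increment_le hab hx hy.le)
      (hν.integrable_min.const_mul _)
      (Eventually.of_forall fun y => by fun_prop)
  · rw [levyOp]
    refine integral_eq_zero_of_ae ?_
    filter_upwards [hν.ae_pos] with y hy
    simp [hu.eq_zero x hx, hu.eq_zero (x - y) (by linarith)]

/-- A jump `y ≥ x - a` lands where `u` vanishes, so these jumps contribute `-ν([x-a,∞)) u(x)`: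
exactly the boundary term of the Riemann-Liouville form. -/
lemma rlDeriv_eq [CompleteSpace B] (hν : IsOneSidedLevy ν) (hu : IsC1Kill a K u u') (x : ℝ) :
    rlDeriv ν a u x = -levyOp ν u x := by
  rcases le_or_gt x a with h | h
  · have h1 : levyOp ν u x = 0 := (hu.isKill_levyOp hν (b := a) le_rfl).eq_zero x h
    rw [h1, rlDeriv, hu.eq_zero x h, Ioo_eq_empty (by linarith)]
    simp
  · have hI := hu.integrable_increment hν (b := x) h.le le_rfl
    have hfin := hν.measure_Ici_lt_top (sub_pos.2 h)
    have hun : ν = ν.restrict (Ioo 0 (x - a)) + ν.restrict (Ici (x - a)) := by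
      rw [← Measure.restrict_union _ measurableSet_Ici]
      · rw [Ioo_union_Ici_eq_Ioi (sub_pos.2 h), hν.restrict_Ioi]
      · exact disjoint_left.2 fun y hy hy' => not_lt.2 hy' hy.2
    have h2 : ∫ y in Ici (x - a), (u (x - y) - u x) ∂ν = -(ν.real (Ici (x - a)) • u x) := by
      have : ∀ y ∈ Ici (x - a), u (x - y) - u x = -u x := fun y hy => by
        have hy : x - a ≤ y := hy
        rw [hu.eq_zero (x - y) (by linarith), zero_sub]
      rw [setIntegral_congr_fun measurableSet_Ici this, setIntegral_const, smul_neg]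
    rw [levyOp]
    conv_rhs => rw [hun]
    rw [integral_add_measure hI.restrict hI.restrict, h2, rlDeriv, neg_add, neg_neg]

/-- The forward equation for Banach space valued `C¹` functions. -/
lemma law_integral_sub_eq [CompleteSpace B] (hν : IsOneSidedLevy ν) (hν0 : ν ≠ 0)
    (hu : IsC1Kill a K u u') (hab : a ≤ b) {x : ℝ} (hx : x ≤ b) {t : ℝ} (ht : 0 ≤ t) :
    ∫ y, u (x - y) ∂(subordinatorLaw ν t) - u x =
      ∫ s in (0 : ℝ)..t, productSemigroup ν (fun _ => ContinuousLinearMap.id ℝ B) s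
        (levyOp ν u) x := by
  have hP := hν.isProb ht
  have hc := hu.continuous
  have hL := hu.isKill_levyOp hν hab
  have hI1 : Integrable (fun y => u (x - y)) (subordinatorLaw ν t) := by
    refine Integrable.of_bound (by fun_prop : Continuous _).aestronglyMeasurable (K * (b - a)) ?_
    filter_upwards [hν.law_ae_nonneg ht] with y hy using hu.norm_le hab (by linarith)
  have hI2 : IntervalIntegrable (fun s => productSemigroup ν
      (fun _ => ContinuousLinearMap.id ℝ B) s (levyOp ν u) x) volume 0 t := by
    rw [intervalIntegrable_iff_integrableOn_Ioc_of_le ht]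
    exact (integrableOn_productSemigroup hν hν0 isContractionSemigroup_id hab hL hx).1.mono_set
      Ioc_subset_Ioi_self
  obtain ⟨M, -, hM⟩ := exists_norm_clamp_le hab hL.continuousOn_Icc
  have hcl := continuous_clamp hab hL.continuousOn_Icc
  -- Functionals reduce the identity to the scalar case: `y ↦ l(u(x - y))` is `C¹` and vanishes for
  -- `y ≥ x - a`, as the scalar forward equation requires.
  refine (SeparatingDual.eq_iff_forall_dual_eq (R := ℝ)).2 fun l => ?_
  set v : ℝ → ℝ := fun y => l (u (x - y)) with hv
  have hvd : ∀ y, HasDerivAt v (-(l (u' (x - y)))) y := fun y => by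
    have h1 : HasDerivAt (fun y => u (x - y)) (-u' (x - y)) y := by
      have := (hu.hasDerivAt (x - y)).scomp y ((hasDerivAt_id y).const_sub x)
      rwa [neg_one_smul] at this
    have := l.hasFDerivAt.comp_hasDerivAt y h1
    rwa [map_neg] at this
  have hvc : Continuous fun y => -(l (u' (x - y))) := by
    have := hu.continuous_deriv
    fun_prop
  obtain ⟨-, hfd⟩ := forwardDefect_eq_zero hν ht hvd hvc (R := x - a) fun y hy => by
    rw [hu.deriv_eq_zero (by linarith), map_zero, neg_zero]
  rw [forwardDefect, sub_eq_zero] at hfd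
  have e1 : l (∫ y, u (x - y) ∂(subordinatorLaw ν t) - u x) =
      ∫ y, (v y - v 0) ∂(subordinatorLaw ν t) := by
    rw [integral_sub (l.integrable_comp hI1) (integrable_const _), map_sub,
      ← l.integral_comp_comm hI1]
    simp [hv]
  rw [e1, hfd, ← l.intervalIntegral_comp_comm hI2]
  refine intervalIntegral.integral_congr fun s hs => ?_
  rw [uIcc_of_le ht] at hs
  have hs0 := hs.1
  have e2 : productSemigroup ν (fun _ => ContinuousLinearMap.id ℝ B) s (levyOp ν u) x =
      ∫ y, clamp a b (levyOp ν u) (x - y) ∂(subordinatorLaw ν s) := by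
    rw [productSemigroup_congr (fun y hy => (hL.clamp_eq hab hy).symm) hx s,
      productSemigroup_eq hν hs0]
    rfl
  rw [e2, ← l.integral_comp_comm (integrable_comp_sub_law hν hs0 hcl.stronglyMeasurable hM x)]
  refine integral_congr_ae ?_
  filter_upwards [hν.law_ae_nonneg hs0] with y hy
  have hxy : x - y ≤ b := by linarith
  rw [hL.clamp_eq hab hxy, levyOp, dualLevyOp_eq hν,
    ← l.integral_comp_comm (hu.integrable_increment hν hab hxy)]
  simp only [hv, map_sub, sub_sub]

end IsC1Kill

variable {A : B →ₗ.[ℝ] B}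

lemma rlDeriv_congr {a b x : ℝ} {f g : ℝ → B} (h : EqOn f g (Iic b)) (hx : x ≤ b) :
    rlDeriv ν a f x = rlDeriv ν a g x := by
  rw [rlDeriv, rlDeriv, h hx]
  congr 2
  refine setIntegral_congr_fun measurableSet_Ioo fun y hy => ?_
  rw [h (mem_Iic.2 (by linarith [hy.1]) : x - y ∈ Iic b)]

/-- On `C¹` functions with values in the domain of `A` the generator is `A - D`. -/
theorem hasGeneratorValue_of_isKill_one [CompleteSpace B] (hν : IsOneSidedLevy ν) (hν0 : ν ≠ 0)
    (hS : IsContractionSemigroup S) (hA : IsGenerator A S) {a b : ℝ} (hab : a < b) {u w : ℝ → B}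
    (hu : IsKill 1 a b u) (hw : ContinuousOn w (Iic b)) (hg : ∀ x ∈ Iic b, (u x, w x) ∈ A.graph) :
    HasGeneratorValue ν S a b u (fun x => w x - rlDeriv ν a u x) := by
  obtain ⟨K, v, v', hv, huv⟩ := hu.exists_isC1Kill hab
  have hL := hv.isKill_levyOp hν hab.le
  have hw0 : IsKill 0 a b w := IsKill.of_continuousOn hw fun x hx => by
    have h1 := hg x (mem_Iic.2 (hx.trans hab.le))
    rw [hu.eq_zero x hx] at h1
    have h2 := (hA 0 (w x)).1 h1
    simp only [map_zero, sub_zero, smul_zero] at h2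
    exact tendsto_nhds_unique h2 tendsto_const_nhds
  have heq : ∀ x ≤ b, w x - rlDeriv ν a u x = w x + levyOp ν v x := fun x hx => by
    rw [rlDeriv_congr huv hx, hv.rlDeriv_eq hν, sub_neg_eq_add]
  refine ⟨hu.of_le (by omega), ?_, ?_⟩
  · refine IsKill.of_continuousOn ((hw.add hL.continuousOn).congr fun x hx => heq x hx)
      fun x hx => ?_
    rw [heq x (hx.trans hab.le), hw0.eq_zero x hx, hL.eq_zero x hx, add_zero]
  rw [Metric.tendstoUniformlyOn_iff]
  intro ε hε
  have hε4 : 0 < ε / 4 := by positivity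
  obtain ⟨C, hC, hLC⟩ := exists_isCompact_clamp hab.le hL.continuousOn_Icc
  obtain ⟨D, hD, hwD⟩ := exists_isCompact_clamp hab.le hw0.continuousOn_Icc
  have h1 := eventually_norm_average_sub_le hν hν0 (isContractionSemigroup_id (B := B)) hab.le hL
    hε4
  have h2 := hS.eventually_norm_sub_lt hC hε4
  obtain ⟨r, hr, h3⟩ := mem_nhdsGT_iff_exists_Ioc_subset.1 (hS.eventually_norm_sub_lt hD hε4)
  filter_upwards [h1, h2, Ioc_mem_nhdsGT hr] with t ht1 ht2 ht x hx
  have hx : x ≤ b := hx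
  have ht0 := ht.1.le
  have := hν.isProb ht0
  have hvc := hv.continuous
  have hI1 : Integrable (fun y => v (x - y)) (subordinatorLaw ν t) := by
    refine Integrable.of_bound (by fun_prop : Continuous _).aestronglyMeasurable (K * (b - a)) ?_
    filter_upwards [hν.law_ae_nonneg ht0] with y hy using hv.norm_le hab.le (by linarith)
  have e1 : productSemigroup ν S t u x = S t (∫ y, v (x - y) ∂(subordinatorLaw ν t)) := by
    rw [productSemigroup_congr huv hx, productSemigroup_eq hν ht0]
    exact (S t).integral_comp_comm hI1
  set avg := t⁻¹ • ∫ s in (0 : ℝ)..t, productSemigroup ν (fun _ => ContinuousLinearMap.id ℝ B) s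
        (levyOp ν v) x with havg
  -- The increment splits as `S t (G_t u - u) + (S t u - u)`. The forward equation makes the first
  -- part a mean of averages of `levyOp ν v`, and the generator makes the second a mean of `S s (w
  -- x)`; both means converge uniformly.
  have e2 : t⁻¹ • (productSemigroup ν S t u x - u x) =
      S t avg + t⁻¹ • ∫ s in (0 : ℝ)..t, S s (w x) := by
    rw [havg, ← hv.law_integral_sub_eq hν hν0 hab.le hx ht0, map_smul, map_sub,
      ← hS.apply_sub_eq_integral hA (hg x hx) ht0, ← smul_add, e1, huv hx]
    congr 1
    abel
  rw [dist_comm, dist_eq_norm, e2, heq x hx]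
  have e3 : S t avg + t⁻¹ • (∫ s in (0 : ℝ)..t, S s (w x)) - (w x + levyOp ν v x) =
      S t (avg - levyOp ν v x) + (S t (levyOp ν v x) - levyOp ν v x) +
        (t⁻¹ • (∫ s in (0 : ℝ)..t, S s (w x)) - w x) := by
    rw [map_sub]; abel
  have e4 : ‖S t (avg - levyOp ν v x)‖ ≤ ε / 4 := (hS.norm_apply_le ht0 _).trans (ht1 x hx)
  have e5 : ‖S t (levyOp ν v x) - levyOp ν v x‖ < ε / 4 := by
    rw [← hL.clamp_eq hab.le hx]
    exact ht2 _ (hLC x)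
  have e6 : ‖t⁻¹ • (∫ s in (0 : ℝ)..t, S s (w x)) - w x‖ ≤ ε / 4 := by
    refine norm_average_sub_le ht.1 (hS.intervalIntegrable _ le_rfl ht0) fun s hs hst => ?_
    rw [← hw0.clamp_eq hab.le hx]
    exact (h3 ⟨hs, hst.trans ht.2⟩ _ (hwD x)).le
  rw [e3]
  calc _ ≤ _ := norm_add₃_le
    _ < ε := by linarith

end GenFrac

namespace GenFrac

/-! ### Infinite Lévy measures: the subordinator has no atoms in time average -/

namespace IsOneSidedLevy

variable {ν : Measure ℝ}

/-- Monotone convergence: `1 - e^{-ny}` increases to `1` for `y > 0`, so `φ_ν(n)` increases to the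
total mass of `ν`. -/
lemma tendsto_laplaceExponent (hν : IsOneSidedLevy ν) (htop : ν univ = ⊤) :
    Tendsto (fun n : ℕ => laplaceExponent ν n) atTop atTop := by
  have hlim : Tendsto (fun n : ℕ => ∫⁻ y, ENNReal.ofReal (1 - Real.exp (-(n * y))) ∂ν) atTop
      (𝓝 (∫⁻ _, 1 ∂ν)) := by
    refine lintegral_tendsto_of_tendsto_of_monotone (fun n => by fun_prop) ?_ ?_
    · filter_upwards [hν.ae_pos] with y hy m n hmn
      have : (m : ℝ) * y ≤ n * y := by gcongr
      dsimp only
      gcongr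
    · filter_upwards [hν.ae_pos] with y hy
      rw [← ENNReal.ofReal_one]
      refine ENNReal.tendsto_ofReal ?_
      have h1 : Tendsto (fun n : ℕ => (n : ℝ) * y) atTop atTop :=
        tendsto_natCast_atTop_atTop.atTop_mul_const hy
      simpa using (Real.tendsto_exp_neg_atTop_nhds_zero.comp h1).const_sub 1
  have heq : ∀ n : ℕ, ∫⁻ y, ENNReal.ofReal (1 - Real.exp (-(n * y))) ∂ν =
      ENNReal.ofReal (laplaceExponent ν n) := fun n => by
    rw [laplaceExponent, hν.restrict_Ioi, ofReal_integral_eq_lintegral_ofReal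
      (hν.integrable_one_sub_exp n.cast_nonneg)]
    filter_upwards [hν.ae_pos] with y hy
    have : Real.exp (-(n * y)) ≤ 1 := by
      rw [Real.exp_le_one_iff]; have : 0 ≤ (n : ℝ) * y := by positivity
      linarith
    simpa using this
  simp_rw [heq, lintegral_one, htop] at hlim
  refine tendsto_atTop.2 fun C => ?_
  filter_upwards [hlim.eventually (lt_mem_nhds (ENNReal.ofReal_lt_top (r := max C 0)))] with n hn
  exact (le_max_left _ _).trans (ENNReal.ofReal_lt_ofReal_iff_of_nonneg (le_max_right _ _) |>.1 hn).le

/-- Chernoff's bound at `z = 0` reads `G(t,(-∞,0]) ≤ e^{-tφ(n)}` for every `n`: an infinite Lévy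
measure makes the subordinator leave `0` at once. -/
lemma law_Iic_zero (hν : IsOneSidedLevy ν) (htop : ν univ = ⊤) {t : ℝ} (ht : 0 < t) :
    subordinatorLaw ν t (Iic 0) = 0 := by
  have := hν.isProb ht.le
  have h1 : Tendsto (fun n : ℕ => Real.exp (-(t * laplaceExponent ν n))) atTop (𝓝 0) :=
    Real.tendsto_exp_neg_atTop_nhds_zero.comp
      ((hν.tendsto_laplaceExponent htop).const_mul_atTop ht)
  have h2 : (subordinatorLaw ν t).real (Iic 0) ≤ 0 := by
    refine ge_of_tendsto h1 (Eventually.of_forall fun n => ?_)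
    simpa using hν.law_real_Iic_le ht.le n.cast_nonneg 0
  exact (measureReal_eq_zero_iff).1 (le_antisymm h2 measureReal_nonneg)

/-- For infinite `ν` the increment over a positive time is strictly positive almost surely. -/
lemma law_Ici_le_law_Ioi (hν : IsOneSidedLevy ν) (htop : ν univ = ⊤) {s t : ℝ} (hs : 0 ≤ s)
    (hst : s < t) (z : ℝ) : subordinatorLaw ν s (Ici z) ≤ subordinatorLaw ν t (Ioi z) := by
  obtain ⟨r, rfl⟩ := exists_add_of_le hst.le
  have hr : 0 < r := by linarith
  have := hν.isProb hs
  have := hν.isProb hr.le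
  rw [hν.law_add hs hr.le, Measure.conv, Measure.map_apply (by fun_prop) measurableSet_Ioi]
  calc subordinatorLaw ν s (Ici z) = ((subordinatorLaw ν s).prod (subordinatorLaw ν r))
        (Ici z ×ˢ Ioi 0) := by
        have h0 : subordinatorLaw ν r (Ioi 0) = 1 := by
          rw [← compl_Iic, prob_compl_eq_one_iff measurableSet_Iic, hν.law_Iic_zero htop hr]
        rw [Measure.prod_prod, h0, mul_one]
    _ ≤ _ := measure_mono fun p hp => by
        have h1 : z ≤ p.1 := hp.1
        have h2 : 0 < p.2 := hp.2
        simp only [mem_preimage, mem_Ioi]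
        linarith

/-- Letting `s` increase to a continuity point `t` of the tail in `G(s,[z,∞)) ≤ G(t,(z,∞))` gives
`G(t,[z,∞)) ≤ G(t,(z,∞))`, hence no atom at `z`. A monotone function has only countably many
discontinuities. -/
lemma ae_law_singleton (hν : IsOneSidedLevy ν) (htop : ν univ = ⊤) (z : ℝ) :
    ∀ᵐ t ∂(volume.restrict (Ioi (0 : ℝ))), subordinatorLaw ν t {z} = 0 := by
  have hc : ∀ᵐ t : ℝ, ContinuousAt (tailFun ν z) t := by
    rw [ae_iff]
    exact (hν.tailFun_mono z).countable_not_continuousAt.measure_zero _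
  filter_upwards [ae_restrict_of_ae hc, ae_restrict_mem measurableSet_Ioi] with t htc ht
  have ht : 0 < t := ht
  have := hν.isProb ht.le
  have h1 : Tendsto (tailFun ν z) (𝓝[<] t) (𝓝 (tailFun ν z t)) :=
    htc.tendsto.mono_left nhdsWithin_le_nhds
  have h2 : tailFun ν z t ≤ (subordinatorLaw ν t).real (Ioi z) := by
    refine le_of_tendsto h1 ?_
    filter_upwards [Ioo_mem_nhdsLT ht] with s hs
    rw [tailFun, max_eq_left hs.1.le]
    exact ENNReal.toReal_mono (measure_ne_top _ _) (hν.law_Ici_le_law_Ioi htop hs.1.le hs.2 z)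
  rw [tailFun, max_eq_left ht.le] at h2
  have h3 : (subordinatorLaw ν t).real (Ici z) =
      (subordinatorLaw ν t).real {z} + (subordinatorLaw ν t).real (Ioi z) := by
    rw [← measureReal_union (by simp) measurableSet_Ioi, singleton_union, Ioi_insert]
  exact (measureReal_eq_zero_iff).1 (le_antisymm (by linarith) measureReal_nonneg)

lemma potMeasure_ae_ne (hν : IsOneSidedLevy ν) (htop : ν univ = ⊤) (R z : ℝ) :
    ∀ᵐ p ∂(hν.potMeasure R), p.2 ≠ z := by
  refine Measure.ae_compProd_of_ae_ae (by measurability) ?_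
  filter_upwards [ae_restrict_mem measurableSet_Ioi, hν.ae_law_singleton htop z] with t ht h
  rw [ProbabilityTheory.Kernel.restrict_apply, hν.lawKernel_apply (le_of_lt ht)]
  refine ae_restrict_of_ae ?_
  rw [ae_iff]
  simpa using h

end IsOneSidedLevy

/-! ### Generalized solutions by approximation -/

variable {ν : Measure ℝ} {B : Type*} [NormedAddCommGroup B] [NormedSpace ℝ B]
  {S : ℝ → B →L[ℝ] B} (hν : IsOneSidedLevy ν) (hν0 : ν ≠ 0) (hS : IsContractionSemigroup S)
  {a b : ℝ} (hab : a ≤ b)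

/-- Continuous functions vanishing on `(-∞, a]` that converge to `g` on `(a, b]`. -/
noncomputable def killApprox (a b : ℝ) (g : ℝ → B) (n : ℕ) (x : ℝ) : B :=
  min 1 (n * max (x - a) 0) • clamp a b g x

lemma norm_killApprox_le {g : ℝ → B} {K : ℝ} (hK : ∀ x, ‖clamp a b g x‖ ≤ K) (n : ℕ) (x : ℝ) :
    ‖killApprox a b g n x‖ ≤ K := by
  have h0 : 0 ≤ min 1 ((n : ℝ) * max (x - a) 0) := by positivity
  rw [killApprox, norm_smul, Real.norm_of_nonneg h0, ← one_mul K]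
  exact mul_le_mul (min_le_left _ _) (hK x) (norm_nonneg _) zero_le_one

include hab in
lemma isKill_killApprox {g : ℝ → B} (hg : ContinuousOn g (Icc a b)) (n : ℕ) :
    IsKill 0 a b (killApprox a b g n) := by
  refine IsKill.of_continuousOn (Continuous.continuousOn ?_) fun x hx => ?_
  · have := continuous_clamp hab hg
    unfold killApprox
    fun_prop
  · simp [killApprox, max_eq_right (by linarith : x - a ≤ 0)]

lemma tendsto_killApprox (g : ℝ → B) {x : ℝ} (hx : x ∈ Ioc a b) :
    Tendsto (fun n => killApprox a b g n x) atTop (𝓝 (g x)) := by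
  refine tendsto_const_nhds.congr' ?_
  have hxa : 0 < x - a := by linarith [hx.1]
  filter_upwards [(tendsto_natCast_atTop_atTop.atTop_mul_const hxa).eventually_ge_atTop 1]
    with n hn
  rw [killApprox, max_eq_left hxa.le, min_eq_left hn, one_smul,
    clamp_of_mem (Ioc_subset_Icc_self hx)]

include hν hν0 hS hab

lemma tendsto_potentialConv_of_ae {gn : ℕ → ℝ → B} {g : ℝ → B}
    (hgn : ∀ n, ContinuousOn (gn n) (Icc a b)) (hg : ContinuousOn g (Icc a b)) {K : ℝ}
    (hK : ∀ n, ∀ x ∈ Icc a b, ‖gn n x‖ ≤ K) {x : ℝ} (hx : x ≤ b)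
    (hlim : ∀ᵐ p ∂(hν.potMeasure (b - a)), x - p.2 ∈ Ioc a b →
      Tendsto (fun n => gn n (x - p.2)) atTop (𝓝 (g (x - p.2)))) :
    Tendsto (fun n => potentialConv ν S a (gn n) x) atTop (𝓝 (potentialConv ν S a g x)) := by
  rw [(potentialConv_eq_potOp_cutExt hν hν0 hS hab hg hx).2]
  simp_rw [fun n => (potentialConv_eq_potOp_cutExt hν hν0 hS hab (hgn n) hx).2]
  refine tendsto_potOp hν hν0 hS _ (fun n => stronglyMeasurable_cutExt hab (hgn n)) (K := K)
    (fun n s _ => (norm_indicator_le_norm_self _ _).trans (hK n _ (max_min_mem_Icc hab _))) ?_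
  filter_upwards [hlim, hν.potMeasure_ae (b - a)] with p hp hp'
  by_cases h : x - p.2 ≤ a
  · simp [cutExt_eq_zero _ h]
  · have hm : x - p.2 ∈ Ioc a b := ⟨not_le.1 h, by linarith [hp'.2.1]⟩
    rw [← eqOn_cutExt g hm]
    simp_rw [← fun n => eqOn_cutExt (gn n) hm]
    exact hp hm

lemma tendsto_potentialConv {gn : ℕ → ℝ → B} {g : ℝ → B}
    (hgn : ∀ n, ContinuousOn (gn n) (Icc a b)) (hg : ContinuousOn g (Icc a b)) {K : ℝ}
    (hK : ∀ n, ∀ x ∈ Icc a b, ‖gn n x‖ ≤ K)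
    (hlim : ∀ x ∈ Ioc a b, Tendsto (fun n => gn n x) atTop (𝓝 (g x))) {x : ℝ} (hx : x ≤ b) :
    Tendsto (fun n => potentialConv ν S a (gn n) x) atTop (𝓝 (potentialConv ν S a g x)) :=
  tendsto_potentialConv_of_ae hν hν0 hS hab hgn hg hK hx
    (Eventually.of_forall fun _ h => hlim _ h)

/-- Translates of a Lebesgue null set are null. By Fubini, for almost every `x` the points `x - y`
avoid the exceptional set for almost all `(t,y)`, and dominated convergence applies. The laws may
have atoms, so an exceptional set of `x` is unavoidable by this argument. -/
lemma ae_tendsto_potentialConv {gn : ℕ → ℝ → B} {g : ℝ → B}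
    (hgn : ∀ n, ContinuousOn (gn n) (Icc a b)) (hg : ContinuousOn g (Icc a b)) {K : ℝ}
    (hK : ∀ n, ∀ x ∈ Icc a b, ‖gn n x‖ ≤ K)
    (hlim : ∀ᵐ x ∂(volume.restrict (Icc a b)), Tendsto (fun n => gn n x) atTop (𝓝 (g x))) :
    ∀ᵐ x ∂(volume.restrict (Icc a b)), Tendsto (fun n => potentialConv ν S a (gn n) x) atTop
      (𝓝 (potentialConv ν S a g x)) := by
  have := hν.potMeasure_finite hν0 (b - a)
  rw [ae_restrict_iff' measurableSet_Icc] at hlim ⊢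
  -- A measurable hull of the exceptional set, since exchanging the two almost-everywhere
  -- quantifiers requires measurability.
  set N := toMeasurable volume {x | ¬ (x ∈ Icc a b → Tendsto (fun n => gn n x) atTop (𝓝 (g x)))}
    with hN
  have hN0 : volume N = 0 := by rw [hN, measure_toMeasurable]; exact hlim
  have hNm : MeasurableSet N := measurableSet_toMeasurable _ _
  have hmeas : Measurable fun q : (ℝ × ℝ) × ℝ => q.2 - q.1.2 := by fun_prop
  have h1 : ∀ᵐ p ∂(hν.potMeasure (b - a)), ∀ᵐ x : ℝ, x - p.2 ∉ N :=
    Eventually.of_forall fun p =>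
      (measurePreserving_sub_right volume p.2).quasiMeasurePreserving.ae
        (p := fun y => y ∉ N) (by rw [ae_iff]; simpa using hN0)
  rw [Measure.ae_ae_comm (p := fun (p : ℝ × ℝ) (x : ℝ) => x - p.2 ∉ N)
    (show MeasurableSet {q : (ℝ × ℝ) × ℝ | q.2 - q.1.2 ∉ N} from hmeas hNm.compl)] at h1
  filter_upwards [h1] with x hx hxab
  refine tendsto_potentialConv_of_ae hν hν0 hS hab hgn hg hK hxab.2 ?_
  filter_upwards [hx] with p hp hm
  by_contra h
  exact hp (subset_toMeasurable _ _ fun h' => h (h' (Ioc_subset_Icc_self hm)))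

/-- The potential of a continuous function is a solution by approximation. -/
theorem isApproxSolution_potentialConv [CompleteSpace B] {g : ℝ → B} (hg : ContinuousOn g (Icc a b)) :
    IsApproxSolution ν S a b g (potentialConv ν S a g) := by
  obtain ⟨K, -, hK⟩ := exists_norm_clamp_le hab hg
  refine ⟨killApprox a b g, fun n => potentialConv ν S a (killApprox a b g n),
    isKill_killApprox hab hg, ⟨K, fun n x _ => norm_killApprox_le hK n x⟩, ?_,
    fun n => isClassicalSolution_potentialConv hν hν0 hS hab (isKill_killApprox hab hg n),
    fun x hx => tendsto_potentialConv hν hν0 hS hab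
      (fun n => (isKill_killApprox hab hg n).continuousOn_Icc) hg
      (fun n x _ => norm_killApprox_le hK n x) (fun x hx => tendsto_killApprox g hx) hx.2⟩
  rw [← restrict_Ioc_eq_restrict_Icc]
  filter_upwards [ae_restrict_mem measurableSet_Ioc] with x hx
  exact tendsto_killApprox g hx

/-- Solutions by approximation are unique up to null sets. -/
theorem IsApproxSolution.ae_eq [CompleteSpace B] {g f : ℝ → B} (hg : ContinuousOn g (Icc a b))
    (hf : IsApproxSolution ν S a b g f) :
    f =ᵐ[volume.restrict (Icc a b)] potentialConv ν S a g := by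
  obtain ⟨gn, fn, hk, ⟨K, hK⟩, hlim, hcl, hfn⟩ := hf
  filter_upwards [ae_tendsto_potentialConv hν hν0 hS hab (fun n => (hk n).continuousOn_Icc) hg hK
    hlim, ae_restrict_mem measurableSet_Icc] with x hx hxab
  refine tendsto_nhds_unique (hfn x hxab) (hx.congr fun n => ?_)
  exact ((hcl n).eqOn hν hν0 hS hab (hk n) hxab.2).symm

/-- The extended function can jump only at `a`, so the integrand is continuous at `x` unless `y = x
- a`, and this line carries no mass when `ν` is infinite. -/
lemma continuousOn_potentialConv_of_infinite (htop : ν univ = ⊤) {g : ℝ → B}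
    (hg : ContinuousOn g (Icc a b)) : ContinuousOn (potentialConv ν S a g) (Icc a b) := by
  have := hν.potMeasure_finite hν0 (b - a)
  obtain ⟨K, -, hK⟩ := exists_norm_cutExt_le hab hg
  have hcont : Continuous (potOp hν S (b - a) (cutExt a b g)) := by
    refine continuous_iff_continuousAt.2 fun x => ?_
    refine continuousAt_of_dominated (bound := fun _ => K) (Eventually.of_forall fun y =>
      (stronglyMeasurable_potOp_integrand hS (stronglyMeasurable_cutExt hab hg)
        y).aestronglyMeasurable)
      (Eventually.of_forall fun y => potOp_ae_norm_le hν hS _ fun s _ => hK s)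
      (integrable_const _) ?_
    filter_upwards [hν.potMeasure_ae_ne htop (b - a) (x - a)] with p hp
    have hc : ContinuousAt (cutExt a b g) (x - p.2) := by
      rcases lt_or_gt_of_ne (a := x - p.2) (b := a) (fun h => hp (by linarith)) with h | h
      · refine continuousAt_const.congr (f := fun _ => 0) ?_
        filter_upwards [Iio_mem_nhds h] with y hy
        exact (cutExt_eq_zero g (le_of_lt hy)).symm
      · refine (continuous_clamp hab hg).continuousAt.congr ?_
        filter_upwards [Ioi_mem_nhds h] with y hy
        exact (indicator_of_mem hy _).symm
    have hc2 : ContinuousAt (fun y => cutExt a b g (y - p.2)) x :=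
      ContinuousAt.comp (f := fun y : ℝ => y - p.2) hc (by fun_prop)
    exact (S _).continuous.continuousAt.comp hc2
  exact hcont.continuousOn.congr fun x hx =>
    (potentialConv_eq_potOp_cutExt hν hν0 hS hab hg hx.2).2

lemma integrableOn_potentialConv {g : ℝ → B} (hg : ContinuousOn g (Icc a b)) :
    IntegrableOn (potentialConv ν S a g) (Icc a b) := by
  obtain ⟨K, -, hK⟩ := exists_norm_clamp_le hab hg
  have hgK : ∀ x ∈ Icc a b, ‖g x‖ ≤ K := fun x hx => by simpa [clamp_of_mem hx] using hK x
  have hm : AEStronglyMeasurable (potentialConv ν S a g) (volume.restrict (Icc a b)) := by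
    refine aestronglyMeasurable_of_tendsto_ae atTop
      (f := fun n => potentialConv ν S a (killApprox a b g n)) (fun n => ?_) ?_
    · exact ((continuousOn_potentialConv hν hν0 hS hab (isKill_killApprox hab hg n)).mono
        Icc_subset_Iic_self).aestronglyMeasurable measurableSet_Icc
    · filter_upwards [ae_restrict_mem measurableSet_Icc] with x hx
      exact tendsto_potentialConv hν hν0 hS hab
        (fun n => (isKill_killApprox hab hg n).continuousOn_Icc) hg
        (fun n x _ => norm_killApprox_le hK n x) (fun x hx => tendsto_killApprox g hx) hx.2
  refine IntegrableOn.of_bound (by simp) hm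
    (Real.exp (1 * (b - a)) / laplaceExponent ν 1 * K) ?_
  filter_upwards [ae_restrict_mem measurableSet_Icc] with x hx
  exact norm_potentialConv_le hν hν0 hS hab one_pos hg hgK hx.2

end GenFrac

namespace GenFrac

/-! ### The time derivative of the tails of the subordinator -/

namespace IsOneSidedLevy

variable {ν : Measure ℝ}

lemma tailFun_le_one (hν : IsOneSidedLevy ν) (z t : ℝ) : tailFun ν z t ≤ 1 := by
  have := hν.isProb (le_max_right t 0)
  exact measureReal_le_one

lemma tendsto_tailFun (hν : IsOneSidedLevy ν) (hν0 : ν ≠ 0) (z : ℝ) :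
    Tendsto (tailFun ν z) atTop (𝓝 1) := by
  have hφ := hν.laplaceExponent_pos hν0 one_pos
  have h1 : Tendsto (fun t => 1 - Real.exp (1 * z) * Real.exp (-(t * laplaceExponent ν 1))) atTop
      (𝓝 1) := by
    simpa using ((Real.tendsto_exp_neg_atTop_nhds_zero.comp
      (tendsto_id.atTop_mul_const hφ)).const_mul (Real.exp (1 * z))).const_sub 1
  refine tendsto_of_tendsto_of_tendsto_of_le_of_le' h1 tendsto_const_nhds ?_
    (Eventually.of_forall fun t => hν.tailFun_le_one z t)
  filter_upwards [eventually_ge_atTop 0] with t ht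
  have := hν.isProb ht
  have h2 : (subordinatorLaw ν t).real (Ici z) = 1 - (subordinatorLaw ν t).real (Iio z) := by
    rw [← compl_Iio, probReal_compl_eq_one_sub measurableSet_Iio]
  have h3 : (subordinatorLaw ν t).real (Iio z) ≤ (subordinatorLaw ν t).real (Iic z) :=
    measureReal_mono Iio_subset_Iic_self
  rw [tailFun, max_eq_left ht, h2]
  linarith [hν.law_real_Iic_le ht zero_le_one z]

lemma rightLim_tailFun_zero (hν : IsOneSidedLevy ν) {z : ℝ} (hz : 0 < z) :
    Function.rightLim (tailFun ν z) 0 = 0 := by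
  refine tendsto_nhds_unique ((hν.tailFun_mono z).tendsto_rightLim 0) ?_
  refine (hν.tendsto_law_real_Ici hz).congr' ?_
  filter_upwards [self_mem_nhdsWithin] with t ht
  rw [tailFun, max_eq_left (le_of_lt ht)]

lemma tailDeriv_Ioi (hν : IsOneSidedLevy ν) (hν0 : ν ≠ 0) (z s : ℝ) :
    tailDeriv ν z (Ioi s) = ENNReal.ofReal (1 - Function.rightLim (tailFun ν z) s) := by
  have hm := hν.tailFun_mono z
  rw [tailDeriv, dif_pos hm]
  refine StieltjesFunction.measure_Ioi _ ?_ s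
  refine tendsto_of_tendsto_of_tendsto_of_le_of_le (hν.tendsto_tailFun hν0 z) tendsto_const_nhds
    (fun t => hm.le_rightLim le_rfl) fun t => ?_
  exact (hm.rightLim_le (lt_add_one t)).trans (hν.tailFun_le_one z _)

/-- The mass on `(0,∞)` is the limit of the tail at infinity minus its right limit at `0`. These are
`1` and, because `z > 0`, `0`. -/
lemma isProbabilityMeasure_tailDeriv (hν : IsOneSidedLevy ν) (hν0 : ν ≠ 0) {z : ℝ} (hz : 0 < z) :
    IsProbabilityMeasure ((tailDeriv ν z).restrict (Ioi 0)) :=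
  ⟨by rw [Measure.restrict_apply_univ, hν.tailDeriv_Ioi hν0, hν.rightLim_tailFun_zero hz]; simp⟩

/-- Away from the countably many jumps of the tail, the mass of `(s,∞)` is `1 - G(s,[z,∞)) =
G(s,[0,z))`. This links the Mittag-Leffler operators with the potential measure. -/
lemma ae_tailDeriv_Ioi (hν : IsOneSidedLevy ν) (hν0 : ν ≠ 0) (z : ℝ) :
    ∀ᵐ s ∂(volume.restrict (Ioi (0 : ℝ))), ((tailDeriv ν z).restrict (Ioi 0)).real (Ioi s) =
      (subordinatorLaw ν s).real (Ico 0 z) := by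
  have hc : ∀ᵐ t : ℝ, ContinuousAt (tailFun ν z) t := by
    rw [ae_iff]
    exact (hν.tailFun_mono z).countable_not_continuousAt.measure_zero _
  filter_upwards [ae_restrict_of_ae hc, ae_restrict_mem measurableSet_Ioi] with s hsc hs
  have hs : 0 < s := hs
  have := hν.isProb hs.le
  have h1 : Function.rightLim (tailFun ν z) s = tailFun ν z s :=
    tendsto_nhds_unique ((hν.tailFun_mono z).tendsto_rightLim s)
      (hsc.tendsto.mono_left nhdsWithin_le_nhds)
  rw [measureReal_restrict_apply measurableSet_Ioi,
    inter_eq_left.2 (Ioi_subset_Ioi hs.le), measureReal_def, hν.tailDeriv_Ioi hν0, h1,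
    ENNReal.toReal_ofReal (by linarith [hν.tailFun_le_one z s]), tailFun, max_eq_left hs.le,
    ← probReal_compl_eq_one_sub measurableSet_Ici, compl_Ici]
  refine measureReal_congr ?_
  filter_upwards [hν.law_ae_nonneg hs.le] with y hy
  exact propext ⟨fun h => ⟨hy, h⟩, fun h => h.2⟩

end IsOneSidedLevy

/-! ### Operator-valued Mittag-Leffler functions -/

variable {ν : Measure ℝ} {B : Type*} [NormedAddCommGroup B] [NormedSpace ℝ B]
  {S : ℝ → B →L[ℝ] B} (hν : IsOneSidedLevy ν) (hν0 : ν ≠ 0) (hS : IsContractionSemigroup S)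

lemma mittagLeffler_of_nonpos {z : ℝ} (hz : z ≤ 0) (Y : B) : mittagLeffler ν S z Y = Y :=
  if_neg hz.not_gt

lemma IsApproxSolution.congr {a b : ℝ} {g f f' : ℝ → B} (h : IsApproxSolution ν S a b g f)
    (hf : EqOn f f' (Icc a b)) : IsApproxSolution ν S a b g f' := by
  obtain ⟨gn, fn, h1, h2, h3, h4, h5⟩ := h
  exact ⟨gn, fn, h1, h2, h3, h4, fun x hx => hf hx ▸ h5 x hx⟩

section
include hν hν0 hS

lemma integrableOn_tailDeriv {z : ℝ} (hz : 0 < z) (Y : B) :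
    IntegrableOn (fun t => S t Y) (Ioi 0) (tailDeriv ν z) := by
  have := hν.isProbabilityMeasure_tailDeriv hν0 hz
  refine Integrable.of_bound (C := ‖Y‖) ?_ ?_
  · refine (hS.continuous_max_apply Y).aestronglyMeasurable.congr ?_
    filter_upwards [ae_restrict_mem measurableSet_Ioi] with t ht
    rw [max_eq_left (le_of_lt ht)]
  · filter_upwards [ae_restrict_mem measurableSet_Ioi] with t ht
    exact hS.norm_apply_le (le_of_lt ht) Y

lemma norm_mittagLeffler_le (z : ℝ) (Y : B) : ‖mittagLeffler ν S z Y‖ ≤ ‖Y‖ := by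
  rcases le_or_gt z 0 with hz | hz
  · rw [mittagLeffler_of_nonpos hz]
  · have := hν.isProbabilityMeasure_tailDeriv hν0 hz
    rw [mittagLeffler, if_pos hz]
    refine (norm_integral_le_of_norm_le_const (C := ‖Y‖) ?_).trans (by simp)
    filter_upwards [ae_restrict_mem measurableSet_Ioi] with t ht
    exact hS.norm_apply_le (le_of_lt ht) Y

lemma mittagLeffler_add (z : ℝ) (Y Z : B) :
    mittagLeffler ν S z (Y + Z) = mittagLeffler ν S z Y + mittagLeffler ν S z Z := by
  rcases le_or_gt z 0 with hz | hz
  · simp only [mittagLeffler_of_nonpos hz]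
  · simp only [mittagLeffler, if_pos hz, map_add]
    exact integral_add (integrableOn_tailDeriv hν hν0 hS hz Y)
      (integrableOn_tailDeriv hν hν0 hS hz Z)

end

/-- The Mittag-Leffler operator as a bounded linear operator. -/
noncomputable def mittagLefflerCLM (z : ℝ) : B →L[ℝ] B :=
  LinearMap.mkContinuous
    { toFun := mittagLeffler ν S z
      map_add' := mittagLeffler_add hν hν0 hS z
      map_smul' := fun c Y => by
        rcases le_or_gt z 0 with hz | hz
        · simp only [mittagLeffler_of_nonpos hz, RingHom.id_apply]
        · simp only [mittagLeffler, if_pos hz, map_smul, RingHom.id_apply]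
          exact integral_smul c _ } 1
    fun Y => by rw [one_mul]; exact norm_mittagLeffler_le hν hν0 hS z Y

lemma mittagLefflerCLM_apply (z : ℝ) (Y : B) :
    mittagLefflerCLM hν hν0 hS z Y = mittagLeffler ν S z Y := rfl

include hν hν0 hS in
lemma tendsto_mittagLeffler (z : ℝ) {Yn : ℕ → B} {Y : B} (h : Tendsto Yn atTop (𝓝 Y)) :
    Tendsto (fun n => mittagLeffler ν S z (Yn n)) atTop (𝓝 (mittagLeffler ν S z Y)) :=
  ((mittagLefflerCLM hν hν0 hS z).continuous.tendsto Y).comp h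

variable [CompleteSpace B] {A : B →ₗ.[ℝ] B} (hA : IsGenerator A S)

include hν hν0 hS hA

/-- Integration by parts: `e^{tA}Y - Y = ∫_0^t e^{sA}Z ds` is integrated against the probability
measure `∂_t G(t,[z,∞))`. After Fubini the weight of `e^{sA}Z` is the mass of `(s,∞)`, which is
`G(s,[0,z))` for almost every `s`. -/
lemma mittagLeffler_eq {Y Z : B} (h : (Y, Z) ∈ A.graph) (a x : ℝ) :
    mittagLeffler ν S (x - a) Y = Y + potentialConv ν S a (fun _ => Z) x := by
  rcases le_or_gt x a with hx | hx
  · rw [mittagLeffler_of_nonpos (by linarith), potentialConv_eq_zero hx, add_zero]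
  set z := x - a with hz
  have hz0 : 0 < z := by linarith
  have := hν.isProbabilityMeasure_tailDeriv hν0 hz0
  set μ := (tailDeriv ν z).restrict (Ioi 0) with hμ
  set F : ℝ × ℝ → B := {p : ℝ × ℝ | p.2 < p.1}.indicator fun p => S (max p.2 0) Z with hF
  have hms : MeasurableSet {p : ℝ × ℝ | p.2 < p.1} := measurableSet_lt measurable_snd measurable_fst
  have hFm : StronglyMeasurable F :=
    (stronglyMeasurable_semigroup hS measurable_snd stronglyMeasurable_const).indicator hms
  have hFs : ∀ s, (fun t => F (t, s)) = (Ioi s).indicator fun _ => S (max s 0) Z := fun s => by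
    ext t
    by_cases hst : s < t <;> simp [hF, hst]
  have hFt : ∀ t, (fun s => F (t, s)) = (Iio t).indicator fun s => S (max s 0) Z := fun t => by
    ext s
    by_cases hst : s < t <;> simp [hF, hst]
  have hlaw := integral_law_smul hν hν0 hS (measurableSet_Ico (a := (0 : ℝ)) (b := z))
    (R := z) (fun y hy => hy.2.le) Z
  have hae : ∀ᵐ s ∂(volume.restrict (Ioi (0 : ℝ))),
      μ.real (Ioi s) • S (max s 0) Z = (subordinatorLaw ν s).real (Ico 0 z) • S s Z := by
    filter_upwards [hν.ae_tailDeriv_Ioi hν0 z, ae_restrict_mem measurableSet_Ioi] with s h1 h2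
    rw [h1, max_eq_left (le_of_lt h2)]
  have hinteg : Integrable F (μ.prod (volume.restrict (Ioi 0))) := by
    rw [integrable_prod_iff' hFm.aestronglyMeasurable]
    refine ⟨Eventually.of_forall fun s => ?_, ?_⟩
    · rw [hFs]
      exact (integrable_const _).indicator measurableSet_Ioi
    · refine (Integrable.congr hlaw.1 (hae.mono fun _ h => h.symm)).norm.congr
        (Eventually.of_forall fun s => ?_)
      have h1 : (fun t => ‖F (t, s)‖) = (Ioi s).indicator fun _ => ‖S (max s 0) Z‖ := by
        ext t
        rw [show F (t, s) = _ from congrFun (hFs s) t, norm_indicator_eq_indicator_norm]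
      simp only
      rw [h1, integral_indicator_const _ measurableSet_Ioi, norm_smul,
        Real.norm_of_nonneg measureReal_nonneg, smul_eq_mul]
  have hswap := integral_integral_swap (f := fun t s => F (t, s)) hinteg
  have hleft : ∀ t ∈ Ioi (0 : ℝ), ∫ s in Ioi 0, F (t, s) = S t Y - Y := fun t ht => by
    have ht : 0 < t := ht
    rw [hFt, setIntegral_indicator measurableSet_Iio, Ioi_inter_Iio,
      hS.apply_sub_eq_integral hA h ht.le, intervalIntegral.integral_of_le ht.le,
      integral_Ioc_eq_integral_Ioo]
    exact setIntegral_congr_fun measurableSet_Ioo fun s hs => by simp only [max_eq_left hs.1.le]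
  have h1 : ∫ t, (∫ s in Ioi 0, F (t, s)) ∂μ = mittagLeffler ν S z Y - Y := by
    rw [hμ, setIntegral_congr_fun measurableSet_Ioi hleft,
      integral_sub (integrableOn_tailDeriv hν hν0 hS hz0 Y) (integrable_const _),
      integral_const, probReal_univ, one_smul, mittagLeffler, if_pos hz0]
  have h2 : ∫ s in Ioi 0, ∫ t, F (t, s) ∂μ = potentialConv ν S a (fun _ => Z) x := by
    simp_rw [hFs, integral_indicator_const _ measurableSet_Ioi]
    rw [integral_congr_ae hae, potentialConv]
    simp_rw [setIntegral_const]
    rfl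
  rw [← h2, ← hswap, h1, add_sub_cancel]

variable {a b : ℝ} (hab : a ≤ b)

include hab

lemma mittagLeffler_add_potentialConv_eq {g : ℝ → B} (hg : ContinuousOn g (Icc a b)) {Y Z : B}
    (h : (Y, Z) ∈ A.graph) {x : ℝ} (hx : x ≤ b) :
    mittagLeffler ν S (x - a) Y + potentialConv ν S a g x =
      Y + potentialConv ν S a (fun s => Z + g s) x := by
  have h1 := potentialConv_sub hν hν0 hS hab (continuousOn_const.add hg) hg hx
    (f := fun s => Z + g s)
  have h2 : (fun s => Z + g s) - g = fun _ => Z := by ext s; simp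
  rw [h2] at h1
  rw [mittagLeffler_eq hν hν0 hS hA h, h1]
  abel

theorem isApproxSolutionCaputo {g : ℝ → B} (hg : ContinuousOn g (Icc a b)) (Y : B) :
    IsApproxSolutionCaputo ν A S a b Y g
      fun x => mittagLeffler ν S (x - a) Y + potentialConv ν S a g x := by
  obtain ⟨Yn, Zn, h, hY⟩ := hS.exists_seq_graph hA Y
  refine ⟨Yn, Zn, fun n x => mittagLeffler ν S (x - a) (Yn n) + potentialConv ν S a g x, h, hY,
    fun n => ?_, fun x _ => (tendsto_mittagLeffler hν hν0 hS _ hY).add_const _⟩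
  refine (isApproxSolution_potentialConv hν hν0 hS hab (g := fun x => Zn n + g x)
    (continuousOn_const.add hg)).congr fun x hx => ?_
  simp only
  rw [mittagLeffler_add_potentialConv_eq hν hν0 hS hA hab hg (h n) hx.2, add_sub_cancel_left]

theorem IsApproxSolutionCaputo.ae_eq {g f : ℝ → B} (hg : ContinuousOn g (Icc a b)) {Y : B}
    (hf : IsApproxSolutionCaputo ν A S a b Y g f) :
    f =ᵐ[volume.restrict (Icc a b)]
      fun x => mittagLeffler ν S (x - a) Y + potentialConv ν S a g x := by
  obtain ⟨Yn, Zn, fn, h, hY, hn, hlim⟩ := hf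
  have h1 : ∀ᵐ x ∂(volume.restrict (Icc a b)), ∀ n,
      fn n x - Yn n = potentialConv ν S a (fun x => Zn n + g x) x :=
    ae_all_iff.2 fun n => (hn n).ae_eq hν hν0 hS hab (continuousOn_const.add hg)
  filter_upwards [h1, ae_restrict_mem measurableSet_Icc] with x hx hxab
  refine tendsto_nhds_unique (hlim x hxab)
    (((tendsto_mittagLeffler hν hν0 hS (x - a) hY).add_const _).congr fun n => ?_)
  rw [mittagLeffler_add_potentialConv_eq hν hν0 hS hA hab hg (h n) hxab.2, ← hx n,
    add_sub_cancel]

/-- On the domain of `A` the function is a constant plus a continuous potential. The domain is dense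
and `‖E_z‖ ≤ 1` for all `z`, so a general `Y` is reached by uniform convergence. -/
lemma continuousOn_mittagLeffler (htop : ν univ = ⊤) (Y : B) :
    ContinuousOn (fun x => mittagLeffler ν S (x - a) Y) (Icc a b) := by
  obtain ⟨Yn, Zn, h, hY⟩ := hS.exists_seq_graph hA Y
  have hu : TendstoUniformlyOn (fun n x => mittagLeffler ν S (x - a) (Yn n))
      (fun x => mittagLeffler ν S (x - a) Y) atTop (Icc a b) := by
    rw [Metric.tendstoUniformlyOn_iff]
    intro ε hε
    filter_upwards [Metric.tendsto_nhds.1 hY ε hε] with n hn x _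
    rw [← mittagLefflerCLM_apply hν hν0 hS, ← mittagLefflerCLM_apply hν hν0 hS, dist_eq_norm,
      ← map_sub, mittagLefflerCLM_apply]
    refine (norm_mittagLeffler_le hν hν0 hS _ _).trans_lt ?_
    rwa [← dist_eq_norm, dist_comm]
  refine hu.continuousOn (Frequently.of_forall fun n => ?_)
  simp_rw [mittagLeffler_eq hν hν0 hS hA (h n) a]
  exact continuousOn_const.add
    (continuousOn_potentialConv_of_infinite hν hν0 hS hab htop continuousOn_const)

end GenFrac

namespace GenFrac

/-! ### Smooth functions vanishing on a right half-line -/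

/-- `f` is smooth with all derivatives bounded and vanishes on `[d, ∞)`. -/
structure IsTame (d : ℝ) (f : ℝ → ℝ) : Prop where
  contDiff : ContDiff ℝ ((⊤ : ℕ∞) : WithTop ℕ∞) f
  eq_zero : ∀ x, d ≤ x → f x = 0
  bounded : ∀ j : ℕ, ∃ C, ∀ x, ‖iteratedDeriv j f x‖ ≤ C

/-- The averages `x ↦ ∫ f(x+y) G(t,dy)`. -/
noncomputable def lawAvg (ν : Measure ℝ) (t : ℝ) (f : ℝ → ℝ) (x : ℝ) : ℝ :=
  ∫ y, f (x + y) ∂(subordinatorLaw ν t)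

lemma norm_lawAvg_le {ν : Measure ℝ} {t : ℝ} {f : ℝ → ℝ} (hν : IsOneSidedLevy ν)
    (ht : 0 ≤ t) {c C : ℝ} (hC : ∀ x, c ≤ x → ‖f x‖ ≤ C) {x : ℝ} (hx : c ≤ x) : ‖lawAvg ν t f x‖ ≤ C := by
  have := hν.isProb ht
  refine (norm_integral_le_of_norm_le_const (C := C) ?_).trans (by simp)
  filter_upwards [hν.law_ae_nonneg ht] with y hy using hC _ (by linarith)

namespace IsTame

variable {d : ℝ} {f : ℝ → ℝ}

lemma continuous (hf : IsTame d f) : Continuous f := hf.contDiff.continuous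

lemma hasDerivAt (hf : IsTame d f) (x : ℝ) : HasDerivAt f (deriv f x) x :=
  (hf.contDiff.differentiable (by simp) x).hasDerivAt

lemma exists_norm_le (hf : IsTame d f) : ∃ C, ∀ x, ‖f x‖ ≤ C := by simpa using hf.bounded 0

lemma deriv (hf : IsTame d f) : IsTame d (deriv f) where
  contDiff := (contDiff_infty_iff_deriv.1 hf.contDiff).2
  eq_zero x hx := by
    have h1 : HasDerivWithinAt f (_root_.deriv f x) (Ici x) x := (hf.hasDerivAt x).hasDerivWithinAt
    have h2 : HasDerivWithinAt f 0 (Ici x) x :=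
      (hasDerivWithinAt_const x (Ici x) (0 : ℝ)).congr (fun y hy => hf.eq_zero y (le_trans hx hy))
        (hf.eq_zero x hx)
    exact (uniqueDiffWithinAt_Ici x).eq_deriv _ h1 h2
  bounded j := by simpa [iteratedDeriv_succ'] using hf.bounded (j + 1)

lemma iteratedDeriv (hf : IsTame d f) (j : ℕ) : IsTame d (iteratedDeriv j f) := by
  induction j generalizing f with
  | zero => simpa using hf
  | succ j ih => rw [iteratedDeriv_succ']; exact ih hf.deriv

lemma of_hasCompactSupport (hf : ContDiff ℝ ((⊤ : ℕ∞) : WithTop ℕ∞) f) (hc : HasCompactSupport f)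
    (h0 : ∀ x, d ≤ x → f x = 0) : IsTame d f := by
  refine ⟨hf, h0, fun j => ?_⟩
  have h1 : HasCompactSupport (_root_.iteratedDeriv j f) := by
    induction j with
    | zero => simpa using hc
    | succ j ih => rw [iteratedDeriv_succ]; exact ih.deriv
  obtain ⟨C, hC⟩ := h1.exists_bound_of_continuous
    (hf.continuous_iteratedDeriv j (by exact_mod_cast le_top))
  exact ⟨C, hC⟩

lemma exists_norm_increment_le (hf : IsTame d f) :
    ∃ C, 0 ≤ C ∧ ∀ x y, 0 ≤ y → ‖f (x + y) - f x‖ ≤ C * min 1 y := by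
  obtain ⟨K, hK⟩ := hf.exists_norm_le
  obtain ⟨L, hL⟩ := hf.deriv.exists_norm_le
  have hK0 : 0 ≤ K := (norm_nonneg _).trans (hK 0)
  have hL0 : 0 ≤ L := (norm_nonneg _).trans (hL 0)
  refine ⟨2 * K + L, by positivity, fun x y hy => ?_⟩
  rcases le_total 1 y with h | h
  · rw [min_eq_left h]
    have := (norm_sub_le (f (x + y)) (f x)).trans (add_le_add (hK _) (hK _))
    linarith
  · rw [min_eq_right h]
    have := Convex.norm_image_sub_le_of_norm_hasDerivWithin_le (s := univ) (f := f)
      (f' := _root_.deriv f) (fun x _ => (hf.hasDerivAt x).hasDerivWithinAt) (fun x _ => hL x)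
      convex_univ (mem_univ x) (mem_univ (x + y))
    rw [add_sub_cancel_left, Real.norm_of_nonneg hy] at this
    nlinarith

/-- An operator that commutes with differentiation preserves tame functions. -/
lemma of_comm_deriv {Op : (ℝ → ℝ) → ℝ → ℝ}
    (h0 : ∀ f, IsTame d f → ∀ x, d ≤ x → Op f x = 0)
    (hb : ∀ f, IsTame d f → ∃ C, ∀ x, ‖Op f x‖ ≤ C)
    (hd : ∀ f, IsTame d f → ∀ x, HasDerivAt (Op f) (Op (_root_.deriv f) x) x)
    (hf : IsTame d f) :
    IsTame d (Op f) ∧ ∀ j, _root_.iteratedDeriv j (Op f) = Op (_root_.iteratedDeriv j f) := by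
  have key : ∀ (j : ℕ) (f : ℝ → ℝ), IsTame d f →
      _root_.iteratedDeriv j (Op f) = Op (_root_.iteratedDeriv j f) := by
    intro j
    induction j with
    | zero => intro f _; simp
    | succ j ih =>
      intro f hf
      have : _root_.deriv (Op f) = Op (_root_.deriv f) := funext fun x => (hd f hf x).deriv
      rw [iteratedDeriv_succ', this, ih _ hf.deriv, iteratedDeriv_succ']
  refine ⟨⟨contDiff_of_differentiable_iteratedDeriv fun m _ => ?_, h0 f hf, fun j => ?_⟩,
    fun j => key j f hf⟩
  · rw [key m f hf]
    exact fun x => (hd _ (hf.iteratedDeriv m) x).differentiableAt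
  · rw [key j f hf]
    exact hb _ (hf.iteratedDeriv j)

variable {ν : Measure ℝ} (hν : IsOneSidedLevy ν)
include hν

lemma integrable_increment (hf : IsTame d f) (x : ℝ) : Integrable (fun y => f (x + y) - f x) ν := by
  obtain ⟨C, -, hC⟩ := hf.exists_norm_increment_le
  have := hf.continuous
  exact hν.integrable_of_norm_le (by fun_prop) fun y hy => hC x y hy.le

lemma dualLevyOp (hf : IsTame d f) : IsTame d (dualLevyOp ν f) ∧
    ∀ j, _root_.iteratedDeriv j (GenFrac.dualLevyOp ν f) =
      GenFrac.dualLevyOp ν (_root_.iteratedDeriv j f) := by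
  refine of_comm_deriv (Op := GenFrac.dualLevyOp ν) (fun f hf x hx => ?_) (fun f hf => ?_)
    (fun f hf x => ?_) hf
  · rw [dualLevyOp_eq hν]
    refine integral_eq_zero_of_ae ?_
    filter_upwards [hν.ae_pos] with y hy
    simp [hf.eq_zero x hx, hf.eq_zero (x + y) (by linarith)]
  · obtain ⟨C, -, hC⟩ := hf.exists_norm_increment_le
    refine ⟨∫ y, C * min 1 y ∂ν, fun x => ?_⟩
    rw [dualLevyOp_eq hν]
    refine norm_integral_le_of_norm_le (hν.integrable_min.const_mul C) ?_
    filter_upwards [hν.ae_pos] with y hy using hC x y hy.le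
  · obtain ⟨C, -, hC⟩ := hf.deriv.exists_norm_increment_le
    have hc := hf.continuous
    have hc' := hf.deriv.continuous
    have h1 : GenFrac.dualLevyOp ν f = fun x => ∫ y, (f (x + y) - f x) ∂ν :=
      funext (dualLevyOp_eq hν f)
    rw [h1, dualLevyOp_eq hν]
    refine (hasDerivAt_integral_of_dominated_loc_of_deriv_le (s := univ)
      (F := fun x y => f (x + y) - f x) (F' := fun x y => _root_.deriv f (x + y) - _root_.deriv f x)
      (bound := fun y => C * min 1 y) univ_mem
      (Eventually.of_forall fun x => (by fun_prop : Continuous _).aestronglyMeasurable)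
      (hf.integrable_increment hν x) (by fun_prop : Continuous _).aestronglyMeasurable
      ?_ (hν.integrable_min.const_mul C) ?_).2
    · filter_upwards [hν.ae_pos] with y hy x _ using hC x y hy.le
    · exact Eventually.of_forall fun y x _ =>
        ((hf.hasDerivAt (x + y)).comp_add_const x y).sub (hf.hasDerivAt x)

variable {t : ℝ} (ht : 0 ≤ t)
include ht

lemma integrable_comp_add_law (hf : IsTame d f) (x : ℝ) :
    Integrable (fun y => f (x + y)) (subordinatorLaw ν t) := by
  have := hν.isProb ht
  have := hf.continuous
  obtain ⟨C, hC⟩ := hf.exists_norm_le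
  exact Integrable.of_bound (by fun_prop) C (Eventually.of_forall fun y => hC _)

lemma lawAvg (hf : IsTame d f) : IsTame d (lawAvg ν t f) ∧
    ∀ j, _root_.iteratedDeriv j (GenFrac.lawAvg ν t f) =
      GenFrac.lawAvg ν t (_root_.iteratedDeriv j f) := by
  have := hν.isProb ht
  refine of_comm_deriv (Op := GenFrac.lawAvg ν t) (fun f hf x hx => ?_) (fun f hf => ?_)
    (fun f hf x => ?_) hf
  · refine integral_eq_zero_of_ae ?_
    filter_upwards [hν.law_ae_nonneg ht] with y hy
    exact hf.eq_zero (x + y) (by linarith)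
  · obtain ⟨C, hC⟩ := hf.exists_norm_le
    exact ⟨C, fun x => norm_lawAvg_le hν ht (fun x _ => hC x) le_rfl⟩
  · obtain ⟨C, hC⟩ := hf.deriv.exists_norm_le
    have hc := hf.continuous
    have hc' := hf.deriv.continuous
    exact (hasDerivAt_integral_of_dominated_loc_of_deriv_le (s := univ)
      (F := fun x y => f (x + y)) (F' := fun x y => _root_.deriv f (x + y)) (bound := fun _ => C) univ_mem
      (Eventually.of_forall fun x => (by fun_prop : Continuous _).aestronglyMeasurable)
      (hf.integrable_comp_add_law hν ht x) (by fun_prop : Continuous _).aestronglyMeasurable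
      (Eventually.of_forall fun y x _ => hC _) (integrable_const C)
      (Eventually.of_forall fun y x _ => (hf.hasDerivAt (x + y)).comp_add_const x y)).2

/-- Starting from `x ≥ c`, a jump larger than `d - c` lands where `f` vanishes, so Chernoff's bound
gives exponential decay in `t`, uniformly on `[c,∞)`. -/
lemma norm_lawAvg_le_of_le (hf : IsTame d f) {C : ℝ} (hC : ∀ x, ‖f x‖ ≤ C) {c x : ℝ} (hx : c ≤ x)
    {l : ℝ} (hl : 0 ≤ l) : ‖GenFrac.lawAvg ν t f x‖ ≤
      C * (Real.exp (l * (d - c)) * Real.exp (-(t * laplaceExponent ν l))) := by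
  have := hν.isProb ht
  have hC0 : 0 ≤ C := (norm_nonneg _).trans (hC 0)
  have h1 : GenFrac.lawAvg ν t f x = ∫ y in Iic (d - c), f (x + y) ∂(subordinatorLaw ν t) := by
    rw [GenFrac.lawAvg, setIntegral_eq_integral_of_forall_compl_eq_zero]
    intro y hy
    exact hf.eq_zero _ (by linarith [not_le.1 fun h => hy (mem_Iic.2 h)])
  rw [h1]
  refine (norm_setIntegral_le_of_norm_le_const (measure_lt_top _ _) fun y _ => hC (x + y)).trans ?_
  exact mul_le_mul_of_nonneg_left (hν.law_real_Iic_le ht hl _) hC0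

lemma lawAvg_add (hf : IsTame d f) {s : ℝ} (hs : 0 ≤ s) :
    GenFrac.lawAvg ν s (GenFrac.lawAvg ν t f) = GenFrac.lawAvg ν (s + t) f := by
  have := hν.isProb hs
  have := hν.isProb ht
  ext x
  have hI := hf.integrable_comp_add_law hν (add_nonneg hs ht) x
  rw [hν.law_add hs ht] at hI
  rw [GenFrac.lawAvg, GenFrac.lawAvg, hν.law_add hs ht, integral_conv hI]
  simp only [GenFrac.lawAvg, add_assoc]

end IsTame

lemma lawAvg_zero {ν : Measure ℝ} (hν : IsOneSidedLevy ν) (f : ℝ → ℝ) : lawAvg ν 0 f = f := by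
  ext x
  rw [lawAvg, hν.law_zero, integral_dirac, add_zero]

/-- The dual Lévy operator is the time derivative of the averages at `t = 0`. -/
lemma IsTame.tendstoUniformlyOn_lawAvg {ν : Measure ℝ} (hν : IsOneSidedLevy ν) (hν0 : ν ≠ 0)
    {d : ℝ} {f : ℝ → ℝ} (hf : IsTame d f) (c : ℝ) :
    TendstoUniformlyOn (fun t x => t⁻¹ * (GenFrac.lawAvg ν t f x - f x)) (GenFrac.dualLevyOp ν f)
      (𝓝[>] 0) (Ici c) := by
  obtain ⟨K, hK⟩ := hf.deriv.exists_norm_le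
  -- Reflection turns the averages into the product semigroup for the identity semigroup on `ℝ`,
  -- whose generator is the zero operator. The right endpoint `max (-c) (-d + 1)` makes the window
  -- contain the reflection of `[c,∞)` and keeps it nondegenerate.
  set u : ℝ → ℝ := fun x => f (-x) with hu
  have hd' : ∀ x, HasDerivAt u (-(_root_.deriv f (-x))) x := fun x => by
    have := (hf.hasDerivAt (-x)).scomp x (hasDerivAt_neg x)
    rwa [neg_one_smul] at this
  have hc' := hf.deriv.continuous
  have hC1 : IsC1Kill (-d) K u (fun x => -(_root_.deriv f (-x))) :=
    ⟨hd', by fun_prop, fun x => by simpa using hK (-x), fun x hx => hf.eq_zero _ (by linarith)⟩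
  have hk : IsKill 1 (-d) (max (-c) (-d + 1)) u :=
    ⟨((hf.contDiff.comp contDiff_neg).of_le (by exact_mod_cast le_top)).contDiffOn, hC1.eq_zero⟩
  have hA : IsGenerator ((0 : ℝ →ₗ[ℝ] ℝ).toPMap ⊤) fun _ => ContinuousLinearMap.id ℝ ℝ := by
    intro Y Z
    have h1 : (Y, Z) ∈ ((0 : ℝ →ₗ[ℝ] ℝ).toPMap ⊤).graph ↔ Z = 0 := by
      simp [LinearPMap.mem_graph_iff, eq_comm]
    rw [h1]
    simp only [ContinuousLinearMap.id_apply, sub_self, smul_zero]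
    exact ⟨fun h => h ▸ tendsto_const_nhds, fun h => tendsto_nhds_unique h tendsto_const_nhds⟩
  have hgen := hasGeneratorValue_of_isKill_one hν hν0 isContractionSemigroup_id hA
    (lt_max_of_lt_right (by linarith)) hk (w := fun _ => 0) continuousOn_const
    (fun x _ => by simp [LinearPMap.mem_graph_iff])
  have h2 := hgen.tendsto
  rw [Metric.tendstoUniformlyOn_iff] at h2 ⊢
  intro ε hε
  filter_upwards [h2 ε hε, self_mem_nhdsWithin] with t ht ht0 x hx
  have hx : c ≤ x := hx
  have h3 := ht (-x) (mem_Iic.2 (le_max_of_le_left (by linarith)))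
  rw [zero_sub, hC1.rlDeriv_eq hν, neg_neg, levyOp, productSemigroup_eq hν (le_of_lt ht0)] at h3
  simp only [hu, neg_sub, sub_neg_eq_add, neg_neg, ContinuousLinearMap.id_apply,
    smul_eq_mul] at h3
  rw [dualLevyOp_eq hν]
  simp_rw [add_comm x]
  rw [GenFrac.lawAvg]
  simp_rw [add_comm x]
  exact h3

end GenFrac

namespace GenFrac

/-! ### Existence of solutions in the sense of generalized functions -/

section

variable {B : Type*} [NormedAddCommGroup B]

lemma tendsto_setIntegral_smul [NormedSpace ℝ B] {ι : Type*} {l : Filter ι} [l.IsCountablyGenerated] {s : Set ℝ}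
    (hs : MeasurableSet s) (hfin : volume s ≠ ⊤) {φn : ι → ℝ → ℝ} {φ : ℝ → ℝ} {un : ι → ℝ → B}
    {u : ℝ → B} {C K : ℝ}
    (hφm : ∀ᶠ i in l, AEStronglyMeasurable (φn i) (volume.restrict s))
    (hum : ∀ᶠ i in l, AEStronglyMeasurable (un i) (volume.restrict s))
    (hφ : ∀ᶠ i in l, ∀ x ∈ s, ‖φn i x‖ ≤ C) (hu : ∀ᶠ i in l, ∀ x ∈ s, ‖un i x‖ ≤ K)
    (hφl : ∀ x ∈ s, Tendsto (fun i => φn i x) l (𝓝 (φ x)))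
    (hul : ∀ x ∈ s, Tendsto (fun i => un i x) l (𝓝 (u x))) :
    Tendsto (fun i => ∫ x in s, φn i x • un i x) l (𝓝 (∫ x in s, φ x • u x)) := by
  refine tendsto_integral_filter_of_dominated_convergence (fun _ => C * K) ?_ ?_
    (integrableOn_const hfin) ?_
  · filter_upwards [hφm, hum] with i h1 h2 using h1.smul h2
  · filter_upwards [hφ, hu] with i h1 h2
    filter_upwards [ae_restrict_mem hs] with x hx
    rw [norm_smul]
    exact mul_le_mul (h1 x hx) (h2 x hx) (norm_nonneg _) ((norm_nonneg _).trans (h1 x hx))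
  · filter_upwards [ae_restrict_mem hs] with x hx using (hφl x hx).smul (hul x hx)

lemma eventually_norm_le_of_tendstoUniformlyOn {ι : Type*} {l : Filter ι} {s : Set ℝ}
    {F : ι → ℝ → B} {f : ℝ → B} (h : TendstoUniformlyOn F f l s) {K : ℝ}
    (hK : ∀ x ∈ s, ‖f x‖ ≤ K) : ∀ᶠ i in l, ∀ x ∈ s, ‖F i x‖ ≤ K + 1 := by
  filter_upwards [Metric.tendstoUniformlyOn_iff.1 h 1 one_pos] with i hi x hx
  have h1 := hi x hx
  rw [dist_comm, dist_eq_norm] at h1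
  have h2 : F i x = f x + (F i x - f x) := by abel
  rw [h2]
  exact (norm_add_le _ _).trans (add_le_add (hK x hx) h1.le)

end

variable {ν : Measure ℝ} {B : Type*} [NormedAddCommGroup B] [NormedSpace ℝ B]
  {S : ℝ → B →L[ℝ] B} (hν : IsOneSidedLevy ν) (hν0 : ν ≠ 0) (hS : IsContractionSemigroup S)
  {A : B →ₗ.[ℝ] B} (hA : IsGenerator A S) {a b : ℝ} (hab : a < b) {φ : ℝ → ℝ} (hφ : IsTame b φ)

section
include hν hφ

/-- The averaging operators on test functions and on functions vanishing left of `a` are dual. -/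
lemma setIntegral_smul_average_eq [CompleteSpace B] {t : ℝ} (ht : 0 ≤ t) {u : ℝ → B} (hu : Continuous u) {K : ℝ}
    (hK : ∀ x, ‖u x‖ ≤ K) (h0 : ∀ x ≤ a, u x = 0) :
    ∫ x in Ioo a b, φ x • ∫ y, u (x - y) ∂(subordinatorLaw ν t) =
      ∫ x in Ioo a b, lawAvg ν t φ x • u x := by
  have := hν.isProb ht
  obtain ⟨C, hC⟩ := hφ.exists_norm_le
  have hφc := hφ.continuous
  have hC0 : 0 ≤ C := (norm_nonneg _).trans (hC 0)
  have hK0 : 0 ≤ K := (norm_nonneg _).trans (hK 0)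
  have hae : ∀ᵐ p ∂(volume.prod (subordinatorLaw ν t)), 0 ≤ (p : ℝ × ℝ).2 :=
    Measure.quasiMeasurePreserving_snd.ae (hν.law_ae_nonneg ht)
  have hbd : Integrable (fun p : ℝ × ℝ => (Icc a b).indicator (fun _ => C * K) p.1)
      (volume.prod (subordinatorLaw ν t)) :=
    Integrable.comp_fst (f := (Icc a b).indicator fun _ => C * K)
      ((integrable_indicator_iff measurableSet_Icc).2 (integrableOn_const (by simp))) _
  have hmul : ∀ x y, ‖φ x • u y‖ ≤ C * K := fun x y => by
    rw [norm_smul]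
    exact mul_le_mul (hC x) (hK y) (norm_nonneg _) hC0
  have hi1 : Integrable (fun p : ℝ × ℝ => φ p.1 • u (p.1 - p.2))
      (volume.prod (subordinatorLaw ν t)) := by
    refine hbd.mono' (by fun_prop : Continuous _).aestronglyMeasurable ?_
    filter_upwards [hae] with p hp
    by_cases hx : p.1 ∈ Icc a b
    · rw [indicator_of_mem hx]
      exact hmul _ _
    · rw [indicator_of_notMem hx]
      rcases lt_or_ge p.1 a with h | h
      · rw [h0 _ (by linarith)]; simp
      · rw [hφ.eq_zero _ (not_le.1 fun h' => hx ⟨h, h'⟩).le]; simp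
  have hi2 : Integrable (fun p : ℝ × ℝ => φ (p.1 + p.2) • u p.1)
      (volume.prod (subordinatorLaw ν t)) := by
    refine hbd.mono' (by fun_prop : Continuous _).aestronglyMeasurable ?_
    filter_upwards [hae] with p hp
    by_cases hx : p.1 ∈ Icc a b
    · rw [indicator_of_mem hx]
      exact hmul _ _
    · rw [indicator_of_notMem hx]
      rcases lt_or_ge p.1 a with h | h
      · rw [h0 _ h.le]; simp
      · rw [hφ.eq_zero (p.1 + p.2) (by linarith [not_le.1 fun h' => hx ⟨h, h'⟩])]; simp
  -- The `x`-integrals extend to the whole line: `u` vanishes to the left of `a`, and `φ` to the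
  -- right of `b`. After exchanging integrals, a translation in `x` by `y` moves the jump from `u`
  -- onto `φ`.
  have e1 : ∫ x in Ioo a b, φ x • ∫ y, u (x - y) ∂(subordinatorLaw ν t) =
      ∫ x, ∫ y, φ x • u (x - y) ∂(subordinatorLaw ν t) := by
    simp_rw [integral_smul]
    refine setIntegral_eq_integral_of_forall_compl_eq_zero fun x hx => ?_
    rcases le_or_gt x a with h | h
    · rw [integral_eq_zero_of_ae, smul_zero]
      filter_upwards [hν.law_ae_nonneg ht] with y hy using h0 _ (by linarith)
    · rw [hφ.eq_zero x (not_lt.1 fun h' => hx ⟨h, h'⟩), zero_smul]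
  have e2 : ∫ x in Ioo a b, lawAvg ν t φ x • u x =
      ∫ x, ∫ y, φ (x + y) • u x ∂(subordinatorLaw ν t) := by
    simp_rw [integral_smul_const]
    refine setIntegral_eq_integral_of_forall_compl_eq_zero fun x hx => ?_
    rcases le_or_gt x a with h | h
    · rw [h0 x h, smul_zero]
    · rw [(hφ.lawAvg hν ht).1.eq_zero x (not_lt.1 fun h' => hx ⟨h, h'⟩), zero_smul]
  rw [e1, e2, integral_integral_swap (f := fun x y => φ x • u (x - y)) hi1,
    integral_integral_swap (f := fun x y => φ (x + y) • u x) hi2]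
  refine integral_congr_ae (Eventually.of_forall fun y => ?_)
  simp only
  rw [← integral_sub_right_eq_self (fun x => φ (x + y) • u x) y]
  simp

end

variable [CompleteSpace B]
include hν hν0 hS hA hab

section
include hφ

/-- By duality the pairing of `φ` with `T'_t e^{tA} u` is `S t ⟨u, G_t φ⟩`. Hence `t⁻¹(S t -
1)⟨u,φ⟩` is the pairing of `φ` with the difference quotient of `u`, minus `S t ⟨u, t⁻¹(G_t φ - φ)⟩`.
Both terms converge, which is membership in the graph. -/
lemma pairing_mem_graph_of_isClassicalSolution {g u : ℝ → B} (hg : IsKill 0 a b g)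
    (hu : IsClassicalSolution ν S a b g u) :
    (∫ x in Ioo a b, φ x • u x, -(∫ x in Ioo a b, dualLevyOp ν φ x • u x) -
      ∫ x in Ioo a b, φ x • g x) ∈ A.graph := by
  have huk : IsKill 0 a b u := hu.mem
  have hφc := hφ.continuous
  have hLc := (hφ.dualLevyOp hν).1.continuous
  obtain ⟨C, hC⟩ := hφ.exists_norm_le
  obtain ⟨D, hD⟩ := (hφ.dualLevyOp hν).1.exists_norm_le
  obtain ⟨K, -, hK⟩ := exists_norm_clamp_le hab.le huk.continuousOn_Icc
  obtain ⟨M, -, hM⟩ := exists_norm_clamp_le hab.le hg.continuousOn_Icc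
  have hvc := continuous_clamp hab.le huk.continuousOn_Icc
  have huv : ∀ x ≤ b, clamp a b u x = u x := fun x hx => huk.clamp_eq hab.le hx
  have hsub : Ioo a b ⊆ Iic b := fun x hx => hx.2.le
  have huK : ∀ x ∈ Ioo a b, ‖u x‖ ≤ K := fun x hx => huv x hx.2.le ▸ hK x
  have hum : AEStronglyMeasurable u (volume.restrict (Ioo a b)) :=
    (huk.continuousOn.mono hsub).aestronglyMeasurable measurableSet_Ioo
  have hfin : volume (Ioo a b) ≠ ⊤ := by simp
  have hinteg : ∀ ψ : ℝ → ℝ, Continuous ψ → (∃ C, ∀ x, ‖ψ x‖ ≤ C) →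
      IntegrableOn (fun x => ψ x • u x) (Ioo a b) := fun ψ hψ ⟨C, hC⟩ => by
    refine IntegrableOn.of_bound (by simp) (hψ.aestronglyMeasurable.smul hum) (C * K) ?_
    filter_upwards [ae_restrict_mem measurableSet_Ioo] with x hx
    rw [norm_smul]
    exact mul_le_mul (hC x) (huK x hx) (norm_nonneg _) ((norm_nonneg _).trans (hC x))
  have hWk : ∀ t, 0 ≤ t → IsKill 0 a b (productSemigroup ν S t u) := fun t ht =>
    isKill_productSemigroup hν hS ht hab.le huk
  have hWint : ∀ t, 0 ≤ t → IntegrableOn (fun x => φ x • productSemigroup ν S t u x) (Ioo a b) :=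
    fun t ht => ((hφc.continuousOn.smul (hWk t ht).continuousOn_Icc).integrableOn_Icc).mono_set
      Ioo_subset_Icc_self
  have hdual : ∀ t, 0 ≤ t → ∫ x in Ioo a b, φ x • productSemigroup ν S t u x =
      S t (∫ x in Ioo a b, lawAvg ν t φ x • u x) := fun t ht => by
    have h1 : ∫ x in Ioo a b, lawAvg ν t φ x • u x =
        ∫ x in Ioo a b, lawAvg ν t φ x • clamp a b u x :=
      setIntegral_congr_fun measurableSet_Ioo fun x hx => by simp only [huv x hx.2.le]
    have h2 : ∀ x ∈ Ioo a b, φ x • productSemigroup ν S t u x =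
        S t (φ x • ∫ y, clamp a b u (x - y) ∂(subordinatorLaw ν t)) := fun x hx => by
      rw [productSemigroup_congr (fun y hy => (huv y hy).symm) hx.2.le,
        productSemigroup_eq_apply hν ht hvc.stronglyMeasurable hK, map_smul]
    rw [h1, ← setIntegral_smul_average_eq hν hφ ht hvc hK
      (fun x hx => huk.clamp_eq_zero hab.le hx), setIntegral_congr_fun measurableSet_Ioo h2]
    have h3 : Continuous fun x => ∫ y, clamp a b u (x - y) ∂(subordinatorLaw ν t) := by
      have := continuous_productSemigroup hν (isContractionSemigroup_id (B := B)) ht hvc hK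
      refine this.congr fun x => ?_
      rw [productSemigroup_eq hν ht]
      rfl
    exact (S t).integral_comp_comm
      (((hφc.smul h3).continuousOn.integrableOn_Icc).mono_set Ioo_subset_Icc_self)
  rw [hA]
  have hev : ∀ᶠ t in 𝓝[>] (0 : ℝ), 0 < t := self_mem_nhdsWithin
  have hlim1 : Tendsto (fun t => ∫ x in Ioo a b, φ x •
      (t⁻¹ • (productSemigroup ν S t u x - u x))) (𝓝[>] 0)
      (𝓝 (∫ x in Ioo a b, φ x • -g x)) := by
    refine tendsto_setIntegral_smul measurableSet_Ioo hfin (φn := fun _ => φ) (C := C) (K := M + 1)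
      (Eventually.of_forall fun _ => hφc.aestronglyMeasurable) ?_
      (Eventually.of_forall fun _ x _ => hC x)
      (eventually_norm_le_of_tendstoUniformlyOn (hu.tendsto.mono hsub) fun x hx => ?_)
      (fun x _ => tendsto_const_nhds) fun x hx => hu.tendsto.tendsto_at (hsub hx)
    · filter_upwards [hev] with t ht
      exact ((((hWk t ht.le).continuousOn.mono hsub).aestronglyMeasurable
        measurableSet_Ioo).sub hum).const_smul _
    · rw [norm_neg, ← hg.clamp_eq hab.le hx.2.le]
      exact hM x
  have hlim2 : Tendsto (fun t => ∫ x in Ioo a b, (t⁻¹ * (lawAvg ν t φ x - φ x)) • u x) (𝓝[>] 0)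
      (𝓝 (∫ x in Ioo a b, dualLevyOp ν φ x • u x)) := by
    have hunif := (hφ.tendstoUniformlyOn_lawAvg hν hν0 a).mono
      (fun x (hx : x ∈ Ioo a b) => mem_Ici.2 hx.1.le)
    refine tendsto_setIntegral_smul measurableSet_Ioo hfin (un := fun _ => u) (C := D + 1) (K := K)
      ?_ (Eventually.of_forall fun _ => hum)
      (eventually_norm_le_of_tendstoUniformlyOn hunif fun x _ => hD x)
      (Eventually.of_forall fun _ => huK) (fun x hx => hunif.tendsto_at hx)
      (fun x _ => tendsto_const_nhds)
    filter_upwards [hev] with t ht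
    have := (hφ.lawAvg hν ht.le).1.continuous
    exact (by fun_prop : Continuous fun x => t⁻¹ * (lawAvg ν t φ x - φ x)).aestronglyMeasurable
  have hlim3 : Tendsto (fun t => S (max t 0)
      (∫ x in Ioo a b, (t⁻¹ * (lawAvg ν t φ x - φ x)) • u x)) (𝓝[>] 0)
      (𝓝 (∫ x in Ioo a b, dualLevyOp ν φ x • u x)) := by
    have h1 := (hS.continuous_uncurry.tendsto
      (0, ∫ x in Ioo a b, dualLevyOp ν φ x • u x)).comp
      ((tendsto_nhdsWithin_of_tendsto_nhds tendsto_id).prodMk_nhds hlim2)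
    simpa [hS.zero, Function.comp_def] using h1
  have hlim := hlim1.sub hlim3
  simp_rw [smul_neg, integral_neg] at hlim
  rw [neg_sub_comm]
  refine hlim.congr' ?_
  filter_upwards [hev] with t ht
  have hG := (hφ.lawAvg hν ht.le).1
  have e1 : ∫ x in Ioo a b, φ x • (t⁻¹ • (productSemigroup ν S t u x - u x)) =
      t⁻¹ • (S t (∫ x in Ioo a b, lawAvg ν t φ x • u x) - ∫ x in Ioo a b, φ x • u x) := by
    rw [← hdual t ht.le, ← integral_sub (hWint t ht.le) (hinteg φ hφc ⟨C, hC⟩), ← integral_smul]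
    congr with x
    rw [smul_comm, smul_sub]
  have e2 : ∫ x in Ioo a b, (t⁻¹ * (lawAvg ν t φ x - φ x)) • u x =
      t⁻¹ • ((∫ x in Ioo a b, lawAvg ν t φ x • u x) - ∫ x in Ioo a b, φ x • u x) := by
    rw [← integral_sub (hinteg _ hG.continuous hG.exists_norm_le) (hinteg φ hφc ⟨C, hC⟩),
      ← integral_smul]
    congr with x
    rw [mul_smul, sub_smul]
  rw [e1, e2, max_eq_left ht.le, map_smul, map_sub, ← smul_sub]
  congr 1
  abel

/-- The classical case for the approximations `killApprox`, followed by closedness of `A`. -/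
lemma pairing_mem_graph {g : ℝ → B} (hg : ContinuousOn g (Icc a b)) :
    (∫ x in Ioo a b, φ x • potentialConv ν S a g x,
      -(∫ x in Ioo a b, dualLevyOp ν φ x • potentialConv ν S a g x) -
        ∫ x in Ioo a b, φ x • g x) ∈ A.graph := by
  have hφc := hφ.continuous
  have hLc := (hφ.dualLevyOp hν).1.continuous
  obtain ⟨C, hC⟩ := hφ.exists_norm_le
  obtain ⟨D, hD⟩ := (hφ.dualLevyOp hν).1.exists_norm_le
  obtain ⟨K, -, hK⟩ := exists_norm_clamp_le hab.le hg
  have hk := isKill_killApprox hab.le hg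
  have hsub : Ioo a b ⊆ Iic b := fun x hx => hx.2.le
  have hmeas : ∀ f : ℝ → B, ContinuousOn f (Iic b) →
      AEStronglyMeasurable f (volume.restrict (Ioo a b)) := fun f hf =>
    (hf.mono hsub).aestronglyMeasurable measurableSet_Ioo
  have hlim : ∀ ψ : ℝ → ℝ, Continuous ψ → (∃ C, ∀ x, ‖ψ x‖ ≤ C) → Tendsto
      (fun n => ∫ x in Ioo a b, ψ x • potentialConv ν S a (killApprox a b g n) x) atTop
      (𝓝 (∫ x in Ioo a b, ψ x • potentialConv ν S a g x)) := fun ψ hψ ⟨C, hC⟩ => by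
    refine tendsto_setIntegral_smul measurableSet_Ioo (by simp) (φn := fun _ => ψ) (C := C)
      (K := Real.exp (1 * (b - a)) / laplaceExponent ν 1 * K)
      (Eventually.of_forall fun _ => hψ.aestronglyMeasurable)
      (Eventually.of_forall fun n => hmeas _ (continuousOn_potentialConv hν hν0 hS hab.le (hk n)))
      (Eventually.of_forall fun _ x _ => hC x)
      (Eventually.of_forall fun n x hx => norm_potentialConv_le hν hν0 hS hab.le one_pos
        (hk n).continuousOn_Icc (fun y _ => norm_killApprox_le hK n y) hx.2.le)
      (fun x _ => tendsto_const_nhds) fun x hx => ?_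
    exact tendsto_potentialConv hν hν0 hS hab.le (fun n => (hk n).continuousOn_Icc) hg
      (fun n y _ => norm_killApprox_le hK n y) (fun y hy => tendsto_killApprox g hy) hx.2.le
  refine hS.mem_graph_of_tendsto hA (fun n => pairing_mem_graph_of_isClassicalSolution hν hν0 hS hA
    hab hφ (hk n) (isClassicalSolution_potentialConv hν hν0 hS hab.le (hk n)))
    (hlim φ hφc ⟨C, hC⟩) ((hlim _ hLc ⟨D, hD⟩).neg.sub ?_)
  exact tendsto_setIntegral_smul measurableSet_Ioo (by simp) (φn := fun _ => φ) (C := C) (K := K)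
    (Eventually.of_forall fun _ => hφc.aestronglyMeasurable)
    (Eventually.of_forall fun n => hmeas _ (hk n).continuousOn)
    (Eventually.of_forall fun _ x _ => hC x)
    (Eventually.of_forall fun n x hx => norm_killApprox_le hK n x)
    (fun x _ => tendsto_const_nhds) fun x hx => tendsto_killApprox g ⟨hx.1, hx.2.le⟩

/-- For `Yₙ` in the domain, `(∫φ)(Yₙ, AYₙ)` is added to the pair obtained for the right-hand side
`AYₙ + g`. The terms with `AYₙ`, which need not converge, cancel, so closedness of `A` allows `Yₙ →
Y`. -/
lemma pairing_mem_graph_caputo {g : ℝ → B} (hg : ContinuousOn g (Icc a b)) (Y : B) :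
    ((∫ x in Ioo a b, φ x • (mittagLeffler ν S (x - a) Y + potentialConv ν S a g x - Y)) +
        ∫ x in Ioo a b, φ x • Y,
      -(∫ x in Ioo a b, dualLevyOp ν φ x •
        (mittagLeffler ν S (x - a) Y + potentialConv ν S a g x - Y)) -
        ∫ x in Ioo a b, φ x • g x) ∈ A.graph := by
  have hφc := hφ.continuous
  have hLc := (hφ.dualLevyOp hν).1.continuous
  obtain ⟨C, hC⟩ := hφ.exists_norm_le
  obtain ⟨D, hD⟩ := (hφ.dualLevyOp hν).1.exists_norm_le
  obtain ⟨K, -, hK⟩ := exists_norm_clamp_le hab.le hg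
  obtain ⟨Yn, Zn, hYZ, hY⟩ := hS.exists_seq_graph hA Y
  have hφi : IntegrableOn φ (Ioo a b) :=
    hφc.continuousOn.integrableOn_Icc.mono_set Ioo_subset_Icc_self
  have heq : ∀ n, EqOn
      (fun x => mittagLeffler ν S (x - a) (Yn n) + potentialConv ν S a g x - Yn n)
      (potentialConv ν S a fun s => Zn n + g s) (Icc a b) := fun n x hx => by
    simp only
    rw [mittagLeffler_add_potentialConv_eq hν hν0 hS hA hab.le hg (hYZ n) hx.2,
      add_sub_cancel_left]
  have hgn : ∀ n, ContinuousOn (fun s => Zn n + g s) (Icc a b) := fun n =>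
    continuousOn_const.add hg
  have hlim : ∀ ψ : ℝ → ℝ, Continuous ψ → (∃ C, ∀ x, ‖ψ x‖ ≤ C) → Tendsto
      (fun n => ∫ x in Ioo a b, ψ x •
        (mittagLeffler ν S (x - a) (Yn n) + potentialConv ν S a g x - Yn n)) atTop
      (𝓝 (∫ x in Ioo a b, ψ x •
        (mittagLeffler ν S (x - a) Y + potentialConv ν S a g x - Y))) := fun ψ hψ ⟨C, hC⟩ => by
    refine tendsto_setIntegral_smul measurableSet_Ioo (by simp) (φn := fun _ => ψ) (C := C)
      (K := (‖Y‖ + 1) + Real.exp (1 * (b - a)) / laplaceExponent ν 1 * K + (‖Y‖ + 1))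
      (Eventually.of_forall fun _ => hψ.aestronglyMeasurable)
      (Eventually.of_forall fun n => ?_) (Eventually.of_forall fun _ x _ => hC x) ?_
      (fun x _ => tendsto_const_nhds)
      fun x hx => ((tendsto_mittagLeffler hν hν0 hS _ hY).add_const _).sub hY
    · have h1 := ((integrableOn_potentialConv hν hν0 hS hab.le (hgn n)).congr_fun
        (heq n).symm measurableSet_Icc).mono_set Ioo_subset_Icc_self
      exact h1.aestronglyMeasurable
    · have h1 : ∀ᶠ n in atTop, ‖Yn n‖ < ‖Y‖ + 1 :=
        hY.norm.eventually (gt_mem_nhds (lt_add_one ‖Y‖))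
      filter_upwards [h1] with n hn x hx
      refine (norm_sub_le _ _).trans (add_le_add ((norm_add_le _ _).trans (add_le_add ?_ ?_)) hn.le)
      · exact (norm_mittagLeffler_le hν hν0 hS _ _).trans hn.le
      · exact norm_potentialConv_le hν hν0 hS hab.le one_pos hg
          (fun y hy => clamp_of_mem (g := g) hy ▸ hK y) hx.2.le
  refine hS.mem_graph_of_tendsto hA (fun n => ?_)
    ((hlim φ hφc ⟨C, hC⟩).add (g := fun n => ∫ x in Ioo a b, φ x • Yn n) ?_)
    ((hlim _ hLc ⟨D, hD⟩).neg.sub_const _)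
  · have h1 := pairing_mem_graph hν hν0 hS hA hab hφ (hgn n)
    have h2 := A.graph.add_mem h1 (A.graph.smul_mem (∫ x in Ioo a b, φ x) (hYZ n))
    have h3 : ∀ ψ : ℝ → ℝ, ∫ x in Ioo a b, ψ x •
        (mittagLeffler ν S (x - a) (Yn n) + potentialConv ν S a g x - Yn n) =
        ∫ x in Ioo a b, ψ x • potentialConv ν S a (fun s => Zn n + g s) x := fun ψ =>
      setIntegral_congr_fun measurableSet_Ioo fun x hx =>
        congrArg (ψ x • ·) (heq n (Ioo_subset_Icc_self hx))
    have h4 : ∫ x in Ioo a b, φ x • (Zn n + g x) =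
        (∫ x in Ioo a b, φ x) • Zn n + ∫ x in Ioo a b, φ x • g x := by
      simp_rw [smul_add]
      rw [integral_add (hφi.smul_const _), integral_smul_const]
      exact (hφc.continuousOn.smul hg).integrableOn_Icc.mono_set Ioo_subset_Icc_self
    rw [h3, h3, integral_smul_const]
    convert h2 using 1
    rw [Prod.smul_mk, Prod.mk_add_mk, h4]
    congr 1
    abel
  · simp_rw [integral_smul_const]
    exact hY.const_smul _

end

/-- The solution of the problem with initial value `Y`, shifted to vanish at `a`, is integrable. -/
lemma integrableOn_solution {g : ℝ → B} (hg : ContinuousOn g (Icc a b)) (Y : B) :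
    IntegrableOn (fun x => mittagLeffler ν S (x - a) Y + potentialConv ν S a g x - Y)
      (Icc a b) := by
  obtain ⟨Yn, Zn, hYZ, hY⟩ := hS.exists_seq_graph hA Y
  have hm : AEStronglyMeasurable (fun x => mittagLeffler ν S (x - a) Y)
      (volume.restrict (Icc a b)) := by
    refine aestronglyMeasurable_of_tendsto_ae atTop
      (f := fun n x => mittagLeffler ν S (x - a) (Yn n)) (fun n => ?_)
      (Eventually.of_forall fun x => tendsto_mittagLeffler hν hν0 hS _ hY)
    simp_rw [mittagLeffler_eq hν hν0 hS hA (hYZ n) a]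
    exact aestronglyMeasurable_const.add
      (integrableOn_potentialConv hν hν0 hS hab.le continuousOn_const).aestronglyMeasurable
  have hi : IntegrableOn (fun x => mittagLeffler ν S (x - a) Y) (Icc a b) :=
    IntegrableOn.of_bound (by simp) hm ‖Y‖
      (Eventually.of_forall fun x => norm_mittagLeffler_le hν hν0 hS _ Y)
  exact (hi.add (integrableOn_potentialConv hν hν0 hS hab.le hg)).sub
    (integrableOn_const (by simp))

theorem exists_isDistribSolution {g : ℝ → B} (hg : ContinuousOn g (Icc a b)) (Y : B) :
    ∃ T : 𝓓'(leftHalfLine b, B),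
      (∀ φ : 𝓓(leftHalfLine b, ℝ), T φ = ∫ x in Ioo a b, φ x •
        (mittagLeffler ν S (x - a) Y + potentialConv ν S a g x - Y)) ∧
      IsDistribSolution ν A a b Y g T := by
  set u : ℝ → B := fun x => mittagLeffler ν S (x - a) Y + potentialConv ν S a g x - Y with hu
  have hui : Integrable u (volume.restrict (Ioo a b)) :=
    (integrableOn_solution hν hν0 hS hA hab hg Y).mono_set Ioo_subset_Icc_self
  have hT : ∀ φ : 𝓓(leftHalfLine b, ℝ), TestFunction.integralAgainstBilinCLM
      (ContinuousLinearMap.lsmul ℝ ℝ) (volume.restrict (Ioo a b)) u φ =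
      ∫ x in Ioo a b, φ x • u x := fun φ => by
    rw [TestFunction.integralAgainstBilinCLM_eq_integral
      (hui.locallyIntegrable.locallyIntegrableOn _)]
    rfl
  refine ⟨TestFunction.integralAgainstBilinCLM (ContinuousLinearMap.lsmul ℝ ℝ)
    (volume.restrict (Ioo a b)) u, hT, ⟨fun φ hφ => ?_, fun φ ψ δ hδ hψ => ?_⟩⟩
  · refine (hT φ).trans (setIntegral_eq_zero_of_forall_eq_zero fun x hx => ?_)
    rw [image_eq_zero_of_notMem_tsupport fun h => (lt_asymm (hφ h) hx.1), zero_smul]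
  · have hφt : IsTame b φ := IsTame.of_hasCompactSupport φ.contDiff φ.hasCompactSupport
      fun x hx => image_eq_zero_of_notMem_tsupport fun h => not_lt.2 hx (φ.tsupport_subset h)
    have h1 : ∫ x in Ioo a b, ψ x • u x = ∫ x in Ioo a b, dualLevyOp ν φ x • u x :=
      setIntegral_congr_fun measurableSet_Ioo fun x hx => by
        simp only [hψ x (by linarith [hx.1])]
    have h2 := pairing_mem_graph_caputo hν hν0 hS hA hab hφt hg Y
    change (_ + _, -(TestFunction.integralAgainstBilinCLM _ _ u ψ) - _) ∈ _
    rw [hT, h1]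
    change (TestFunction.integralAgainstBilinCLM _ _ u φ + _, _) ∈ _
    rw [hT]
    exact h2

end GenFrac

namespace GenFrac

/-! ### Uniqueness of solutions in the sense of generalized functions -/

/-- The space of smooth functions with bounded derivatives that vanish on `[d, ∞)`. -/
def tameSubmodule (d : ℝ) : Submodule ℝ (ℝ → ℝ) where
  carrier := {f | IsTame d f}
  zero_mem' := ⟨contDiff_const, fun _ _ => rfl, fun j => ⟨0, fun x => by
    simp [Pi.zero_def]⟩⟩
  add_mem' := fun {f g} hf hg => by
    refine ⟨hf.contDiff.add hg.contDiff, fun x hx => ?_, fun j => ?_⟩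
    · simp [hf.eq_zero x hx, hg.eq_zero x hx]
    · obtain ⟨C, hC⟩ := hf.bounded j
      obtain ⟨D, hD⟩ := hg.bounded j
      refine ⟨C + D, fun x => ?_⟩
      rw [iteratedDeriv_add (hf.contDiff.contDiffAt.of_le (by exact_mod_cast le_top))
        (hg.contDiff.contDiffAt.of_le (by exact_mod_cast le_top))]
      exact (norm_add_le _ _).trans (add_le_add (hC x) (hD x))
  smul_mem' := fun c f hf => by
    refine ⟨hf.contDiff.const_smul c, fun x hx => ?_, fun j => ?_⟩
    · simp [hf.eq_zero x hx]
    · obtain ⟨C, hC⟩ := hf.bounded j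
      refine ⟨‖c‖ * C, fun x => ?_⟩
      rw [iteratedDeriv_const_smul_field, norm_smul]
      exact mul_le_mul_of_nonneg_left (hC x) (norm_nonneg _)

lemma iteratedDeriv_sub_of_tame {d : ℝ} {f g : ℝ → ℝ} (hf : IsTame d f) (hg : IsTame d g) (j : ℕ)
    (x : ℝ) : iteratedDeriv j (f - g) x = iteratedDeriv j f x - iteratedDeriv j g x :=
  iteratedDeriv_sub (hf.contDiff.contDiffAt.of_le (by exact_mod_cast le_top))
        (hg.contDiff.contDiffAt.of_le (by exact_mod_cast le_top))

/-- A smooth function that is `0` on `(-∞, a - 2]` and `1` on `[a - 1, ∞)`. -/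
noncomputable def leftCutoff (a x : ℝ) : ℝ := Real.smoothTransition (x - (a - 2))

lemma contDiff_leftCutoff (a : ℝ) : ContDiff ℝ ((⊤ : ℕ∞) : WithTop ℕ∞) (leftCutoff a) :=
  Real.smoothTransition.contDiff.comp (contDiff_id.sub contDiff_const)

lemma leftCutoff_eq_one {a x : ℝ} (hx : a - 1 ≤ x) : leftCutoff a x = 1 :=
  Real.smoothTransition.one_of_one_le (by linarith)

lemma leftCutoff_eq_zero {a x : ℝ} (hx : x ≤ a - 2) : leftCutoff a x = 0 :=
  Real.smoothTransition.zero_of_nonpos (by linarith)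

/-- The compact interval `[c, d]`. -/
def compactIcc (c d : ℝ) : Compacts ℝ := ⟨Icc c d, isCompact_Icc⟩

/-- Multiplication by a cutoff function, from tame functions to test functions. -/
noncomputable def cutLM (a d : ℝ) :
    tameSubmodule d →ₗ[ℝ] 𝓓_{compactIcc (a - 2) d}(ℝ, ℝ) where
  toFun f := ContDiffMapSupportedIn.of_support_subset
    (f := fun x => leftCutoff a x * (f : ℝ → ℝ) x)
    ((contDiff_leftCutoff a).mul f.2.contDiff) fun x hx => by
      refine ⟨?_, ?_⟩
      · by_contra! h
        exact hx (by simp [leftCutoff_eq_zero h.le])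
      · by_contra! h
        exact hx (by simp [f.2.eq_zero x h.le])
  map_add' f g := by
    ext x
    exact mul_add _ _ _
  map_smul' c f := by
    ext x
    exact mul_left_comm _ _ _

/-- Averages of a test function are not compactly supported on the left, hence the cutoff. By
Leibniz each derivative of the product is controlled by the derivatives of the tame function on
`[a-2,∞)`, those of the cutoff being bounded on `[a-2,d]`. -/
lemma tendsto_cutLM {ι : Type*} {l : Filter ι} {a d : ℝ} {F : ι → tameSubmodule d}
    {G : tameSubmodule d} (h : ∀ j : ℕ, TendstoUniformlyOn
      (fun i => iteratedDeriv j (F i : ℝ → ℝ)) (iteratedDeriv j (G : ℝ → ℝ)) l (Ici (a - 2))) :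
    Tendsto (fun i => cutLM a d (F i)) l (𝓝 (cutLM a d G)) := by
  rw [(ContDiffMapSupportedIn.withSeminorms ℝ ℝ ℝ ⊤ (compactIcc (a - 2) d)).tendsto_nhds]
  intro k ε hε
  have hχ : ∀ j : ℕ, ∃ M, ∀ x ∈ Icc (a - 2) d, ‖iteratedFDeriv ℝ j (leftCutoff a) x‖ ≤ M :=
    fun j => isCompact_Icc.exists_bound_of_continuousOn
      ((contDiff_leftCutoff a).continuous_iteratedFDeriv
        (by exact_mod_cast le_top)).continuousOn
  choose M hM using hχ
  set Q := ∑ j ∈ Finset.range (k + 1), (k.choose j : ℝ) * |M j| with hQ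
  have hQ0 : 0 ≤ Q := Finset.sum_nonneg fun j _ => by positivity
  have hδ : 0 < ε / (2 * (Q + 1)) := by positivity
  have hev : ∀ᶠ i in l, ∀ j ∈ Finset.range (k + 1), ∀ x ∈ Ici (a - 2),
      dist (iteratedDeriv j (G : ℝ → ℝ) x) (iteratedDeriv j (F i : ℝ → ℝ) x) <
        ε / (2 * (Q + 1)) :=
    (Finset.eventually_all _).2 fun j _ => Metric.tendstoUniformlyOn_iff.1 (h j) _ hδ
  filter_upwards [hev] with i hi
  rw [← map_sub]
  refine lt_of_le_of_lt ((ContDiffMapSupportedIn.seminorm_top_le_iff ℝ (half_pos hε).le k _).2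
    fun x hx => ?_) (half_lt_self hε)
  have hx : x ∈ Icc (a - 2) d := hx
  have h1 := norm_iteratedFDeriv_mul_le (N := ((⊤ : ℕ∞) : WithTop ℕ∞)) (contDiff_leftCutoff a)
    (F i - G).2.contDiff x (n := k) (by exact_mod_cast le_top)
  refine h1.trans ?_
  have h2 : ∀ j ∈ Finset.range (k + 1), (k.choose j : ℝ) *
      ‖iteratedFDeriv ℝ j (leftCutoff a) x‖ * ‖iteratedFDeriv ℝ (k - j) ((F i - G :
        tameSubmodule d) : ℝ → ℝ) x‖ ≤ (k.choose j : ℝ) * |M j| * (ε / (2 * (Q + 1))) := by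
    intro j hj
    have e1 : ‖iteratedFDeriv ℝ (k - j) ((F i - G : tameSubmodule d) : ℝ → ℝ) x‖ ≤
        ε / (2 * (Q + 1)) := by
      rw [norm_iteratedFDeriv_eq_norm_iteratedDeriv, Submodule.coe_sub,
        iteratedDeriv_sub_of_tame (F i).2 G.2, ← dist_eq_norm, dist_comm]
      exact (hi (k - j) (Finset.mem_range.2 (by omega)) x hx.1).le
    have e2 := (hM j x hx).trans (le_abs_self _)
    gcongr
  refine (Finset.sum_le_sum h2).trans ?_
  rw [← Finset.sum_mul, ← hQ]
  have : Q * (ε / (2 * (Q + 1))) = ε / 2 * (Q / (Q + 1)) := by field_simp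
  rw [this]
  exact mul_le_of_le_one_right (half_pos hε).le ((div_le_one (by positivity)).2 (by linarith))

/-! ### Averages along the subordinator as a flow of test functions -/

section averages

variable {ν : Measure ℝ} (hν : IsOneSidedLevy ν) {d : ℝ}

/-- The averaging operators on tame functions. -/
noncomputable def tameAvg (t : ℝ) (f : tameSubmodule d) : tameSubmodule d :=
  ⟨lawAvg ν (max t 0) f, (IsTame.lawAvg hν (le_max_right t 0) f.2).1⟩

/-- The dual Lévy operator on tame functions. -/
noncomputable def tameLevy (f : tameSubmodule d) : tameSubmodule d :=
  ⟨dualLevyOp ν f, (IsTame.dualLevyOp hν f.2).1⟩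

lemma coe_tameAvg {t : ℝ} (ht : 0 ≤ t) (f : tameSubmodule d) :
    (tameAvg hν t f : ℝ → ℝ) = lawAvg ν t f := by
  change lawAvg ν (max t 0) f = _
  rw [max_eq_left ht]

lemma iteratedDeriv_tameAvg {t : ℝ} (ht : 0 ≤ t) (f : tameSubmodule d) (j : ℕ) :
    iteratedDeriv j (tameAvg hν t f : ℝ → ℝ) = lawAvg ν t (iteratedDeriv j f) := by
  rw [coe_tameAvg hν ht, (IsTame.lawAvg hν ht f.2).2]

lemma tameAvg_zero (f : tameSubmodule d) : tameAvg hν 0 f = f :=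
  Subtype.ext ((coe_tameAvg hν le_rfl f).trans (lawAvg_zero hν f))

lemma tameAvg_add {s t : ℝ} (hs : 0 ≤ s) (ht : 0 ≤ t) (f : tameSubmodule d) :
    tameAvg hν s (tameAvg hν t f) = tameAvg hν (s + t) f := by
  refine Subtype.ext ?_
  rw [coe_tameAvg hν hs, coe_tameAvg hν ht, coe_tameAvg hν (add_nonneg hs ht)]
  exact IsTame.lawAvg_add hν ht f.2 hs

include hν in
lemma IsTame.norm_lawAvg_add_sub_le {f : ℝ → ℝ} (hf : IsTame d f) {s h : ℝ} (hs : 0 ≤ s)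
    (hh : 0 ≤ h) {c C : ℝ} (hC : ∀ x, c ≤ x → ‖GenFrac.lawAvg ν h f x - f x‖ ≤ C) {x : ℝ}
    (hx : c ≤ x) : ‖GenFrac.lawAvg ν (s + h) f x - GenFrac.lawAvg ν s f x‖ ≤ C := by
  rw [← hf.lawAvg_add hν hh hs]
  have h1 : GenFrac.lawAvg ν s (GenFrac.lawAvg ν h f) x - GenFrac.lawAvg ν s f x =
      GenFrac.lawAvg ν s (fun x => GenFrac.lawAvg ν h f x - f x) x :=
    (integral_sub ((hf.lawAvg hν hh).1.integrable_comp_add_law hν hs x)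
      (hf.integrable_comp_add_law hν hs x)).symm
  rw [h1]
  exact norm_lawAvg_le hν hs hC hx

include hν in
-- The difference quotients at time `0` converge uniformly to a bounded function, hence are bounded
-- for small times. The semigroup property carries this Lipschitz bound to any pair of nearby times.
lemma IsTame.exists_norm_lawAvg_sub_le (hν0 : ν ≠ 0) {f : ℝ → ℝ} (hf : IsTame d f) (c : ℝ) :
    ∃ M r, 0 < r ∧ ∀ s t, 0 ≤ s → 0 ≤ t → |s - t| < r → ∀ x, c ≤ x →
      ‖GenFrac.lawAvg ν s f x - GenFrac.lawAvg ν t f x‖ ≤ M * |s - t| := by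
  obtain ⟨D, hD⟩ := (hf.dualLevyOp hν).1.exists_norm_le
  obtain ⟨r, hr, h⟩ := mem_nhdsGT_iff_exists_Ioo_subset.1 (eventually_norm_le_of_tendstoUniformlyOn
    (hf.tendstoUniformlyOn_lawAvg hν hν0 c) fun x _ => hD x)
  have key : ∀ h', 0 ≤ h' → h' < r → ∀ x, c ≤ x →
      ‖GenFrac.lawAvg ν h' f x - f x‖ ≤ (D + 1) * h' := fun h' h0 hr' x hx => by
    rcases h0.eq_or_lt with rfl | h0
    · simp [lawAvg_zero hν]
    · have := h ⟨h0, hr'⟩ x hx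
      rw [norm_mul, norm_inv, Real.norm_of_nonneg h0.le, inv_mul_le_iff₀ h0] at this
      linarith
  refine ⟨D + 1, r, hr, fun s t hs ht hst x hx => ?_⟩
  rcases le_total s t with hle | hle
  · obtain ⟨h', rfl⟩ := exists_add_of_le hle
    have h0 : 0 ≤ h' := by linarith
    rw [sub_add_cancel_left, abs_neg, abs_of_nonneg h0] at hst ⊢
    rw [norm_sub_rev]
    exact hf.norm_lawAvg_add_sub_le hν hs h0 (key h' h0 hst) hx
  · obtain ⟨h', rfl⟩ := exists_add_of_le hle
    have h0 : 0 ≤ h' := by linarith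
    rw [add_sub_cancel_left, abs_of_nonneg h0] at hst ⊢
    exact hf.norm_lawAvg_add_sub_le hν ht h0 (key h' h0 hst) hx

lemma continuous_cutLM_tameAvg (hν0 : ν ≠ 0) (a : ℝ) (f : tameSubmodule d) :
    Continuous fun t => cutLM a d (tameAvg hν t f) := by
  refine continuous_iff_continuousAt.2 fun t => tendsto_cutLM fun j => ?_
  obtain ⟨M, r, hr, h⟩ := (f.2.iteratedDeriv j).exists_norm_lawAvg_sub_le hν hν0 (a - 2)
  rw [Metric.tendstoUniformlyOn_iff]
  intro ε hε
  have hlim : Tendsto (fun s : ℝ => |max s 0 - max t 0|) (𝓝 t) (𝓝 0) := by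
    have : Continuous fun s : ℝ => |max s 0 - max t 0| := by fun_prop
    simpa using this.tendsto t
  have hlim2 : Tendsto (fun s : ℝ => M * |max s 0 - max t 0|) (𝓝 t) (𝓝 0) := by
    simpa using hlim.const_mul M
  filter_upwards [hlim.eventually (gt_mem_nhds hr), hlim2.eventually (gt_mem_nhds hε)]
    with s h1 h2 x hx
  have e : ∀ s, iteratedDeriv j (tameAvg hν s f : ℝ → ℝ) =
      lawAvg ν (max s 0) (iteratedDeriv j f) := fun s =>
    (IsTame.lawAvg hν (le_max_right s 0) f.2).2 j
  rw [dist_comm, dist_eq_norm, e, e]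
  exact (h _ _ (le_max_right _ _) (le_max_right _ _) h1 x hx).trans_lt h2

lemma tendsto_cutLM_tameAvg_atTop (hν0 : ν ≠ 0) (a : ℝ) (f : tameSubmodule d) :
    Tendsto (fun t => cutLM a d (tameAvg hν t f)) atTop (𝓝 0) := by
  rw [← map_zero (cutLM a d)]
  refine tendsto_cutLM fun j => ?_
  obtain ⟨C, hC⟩ := f.2.bounded j
  have hφ := hν.laplaceExponent_pos hν0 one_pos
  have h1 : Tendsto (fun t => C * (Real.exp (1 * (d - (a - 2))) *
      Real.exp (-(t * laplaceExponent ν 1)))) atTop (𝓝 0) := by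
    simpa using ((Real.tendsto_exp_neg_atTop_nhds_zero.comp
      (tendsto_id.atTop_mul_const hφ)).const_mul (Real.exp (1 * (d - (a - 2))))).const_mul C
  rw [Metric.tendstoUniformlyOn_iff]
  intro ε hε
  filter_upwards [h1.eventually (gt_mem_nhds hε), eventually_ge_atTop 0] with t h2 ht x hx
  have h3 : iteratedDeriv j ((0 : tameSubmodule d) : ℝ → ℝ) x = 0 := by
    simp [Pi.zero_def]
  rw [h3, dist_comm, dist_zero_right, iteratedDeriv_tameAvg hν ht]
  exact ((f.2.iteratedDeriv j).norm_lawAvg_le_of_le hν ht hC hx zero_le_one).trans_lt h2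

lemma tendsto_cutLM_slope (hν0 : ν ≠ 0) (a : ℝ) (f : tameSubmodule d) :
    Tendsto (fun h : ℝ => h⁻¹ • (cutLM a d (tameAvg hν h f) - cutLM a d f)) (𝓝[>] 0)
      (𝓝 (cutLM a d (tameLevy hν f))) := by
  simp_rw [← map_sub, ← map_smul]
  refine tendsto_cutLM fun j => ?_
  have h1 := (f.2.iteratedDeriv j).tendstoUniformlyOn_lawAvg hν hν0 (a - 2)
  have h2 : iteratedDeriv j (tameLevy hν f : ℝ → ℝ) = dualLevyOp ν (iteratedDeriv j f) :=
    (IsTame.dualLevyOp hν f.2).2 j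
  rw [h2]
  refine h1.congr ?_
  filter_upwards [self_mem_nhdsWithin] with h hh x _
  have hh : 0 < h := hh
  rw [Submodule.coe_smul, iteratedDeriv_const_smul_field, Submodule.coe_sub,
    iteratedDeriv_sub_of_tame (tameAvg hν h f).2 f.2, iteratedDeriv_tameAvg hν hh.le, smul_eq_mul]

end averages

variable {ν : Measure ℝ} {B : Type*} [NormedAddCommGroup B] [NormedSpace ℝ B]
  {S : ℝ → B →L[ℝ] B} {A : B →ₗ.[ℝ] B}

lemma compactIcc_subset {b c d : ℝ} (hd : d < b) :
    ((compactIcc c d : Compacts ℝ) : Set ℝ) ⊆ leftHalfLine b := fun _ hx => lt_of_le_of_lt hx.2 hd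

/-- A distribution that solves the homogeneous problem is zero. -/
theorem eq_zero_of_homogeneous (hν : IsOneSidedLevy ν) (hν0 : ν ≠ 0)
    (hS : IsContractionSemigroup S) (hA : IsGenerator A S) {a b : ℝ}
    {T : 𝓓(leftHalfLine b, ℝ) →L[ℝ] B}
    (hvan : ∀ φ : 𝓓(leftHalfLine b, ℝ), tsupport φ ⊆ Iio a → T φ = 0)
    (heq : ∀ (φ ψ : 𝓓(leftHalfLine b, ℝ)) (δ : ℝ), 0 < δ →
      (∀ x, a - δ < x → ψ x = dualLevyOp ν φ x) → (T φ, -T ψ) ∈ A.graph)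
    (φ : 𝓓(leftHalfLine b, ℝ)) : T φ = 0 := by
  -- The support is compact in the open half-line, so some `d < b` lies beyond it. Averaging
  -- preserves vanishing on `[d,∞)`, so all cut functions are test functions with one common compact
  -- set.
  obtain ⟨d, hdb, hφd⟩ : ∃ d < b, ∀ x, d ≤ x → φ x = 0 := by
    rcases (tsupport φ).eq_empty_or_nonempty with h | h
    · exact ⟨b - 1, by linarith, fun x _ => image_eq_zero_of_notMem_tsupport (by simp [h])⟩
    · obtain ⟨m, hm, hmax⟩ := φ.hasCompactSupport.isCompact.exists_isGreatest h
      have hmb : m < b := φ.tsupport_subset hm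
      refine ⟨(m + b) / 2, by linarith, fun x hx => image_eq_zero_of_notMem_tsupport fun h' => ?_⟩
      linarith [hmax h']
  have hφt : IsTame d φ := IsTame.of_hasCompactSupport φ.contDiff φ.hasCompactSupport hφd
  set J := (TestFunction.ofSupportedInCLM ℝ (n := ⊤) (F := ℝ)
    (compactIcc_subset (c := a - 2) hdb)) with hJ
  have hJa : ∀ (f : tameSubmodule d) (x : ℝ), J (cutLM a d f) x = leftCutoff a x * (f : ℝ → ℝ) x :=
    fun f x => rfl
  set Q : tameSubmodule d → B := fun f => T (J (cutLM a d f)) with hQ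
  -- The cutoff is `1` on `[a-1,∞)` and `L_ν` looks only to the right, so there cutting commutes
  -- with `L_ν`; the equation is used with `δ = 1`.
  have hgraph : ∀ f : tameSubmodule d, (Q f, -Q (tameLevy hν f)) ∈ A.graph := fun f => by
    refine heq _ _ 1 one_pos fun x hx => ?_
    rw [hJa, leftCutoff_eq_one hx.le, one_mul, dualLevyOp_eq hν]
    change dualLevyOp ν f x = _
    rw [dualLevyOp_eq hν]
    refine integral_congr_ae ?_
    filter_upwards [hν.ae_pos] with y hy
    rw [hJa, hJa, leftCutoff_eq_one hx.le, leftCutoff_eq_one (by linarith), one_mul, one_mul]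
  set f₀ : tameSubmodule d := ⟨φ, hφt⟩ with hf₀
  -- Cutting alters `φ` only to the left of `a - 1`, where `T` vanishes.
  have hstart : T φ = Q f₀ := by
    rw [← sub_eq_zero, hQ, ← map_sub]
    refine hvan _ ((closure_minimal (t := Iic (a - 1)) (fun x hx => ?_) isClosed_Iic).trans
      fun x hx => mem_Iio.2 (lt_of_le_of_lt (mem_Iic.1 hx) (by linarith)))
    by_contra h
    refine hx ?_
    change φ x - leftCutoff a x * φ x = 0
    rw [leftCutoff_eq_one (not_le.1 h).le, one_mul, sub_self]
  set F : ℝ → B := fun t => S (max t 0) (Q (tameAvg hν t f₀)) with hF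
  have hFc : Continuous F := hS.continuous_uncurry.comp (continuous_id.prodMk
    (T.continuous.comp (J.continuous.comp (continuous_cutLM_tameAvg hν hν0 a f₀))))
  -- The quotient splits into `S h` applied to the quotient of the averages, tending to `Q(L_ν f)`,
  -- and the quotient of `S h` at the fixed vector `Q f`, tending to `A Q f = -Q(L_ν f)`.
  have hslope : ∀ f : tameSubmodule d, Tendsto (fun h : ℝ => h⁻¹ • (S h (Q (tameAvg hν h f)) - Q f))
      (𝓝[>] 0) (𝓝 0) := fun f => by
    have h1 : Tendsto (fun h : ℝ => h⁻¹ • (Q (tameAvg hν h f) - Q f)) (𝓝[>] 0)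
        (𝓝 (Q (tameLevy hν f))) := by
      have := (((T.comp J).continuous.tendsto _).comp (tendsto_cutLM_slope hν hν0 a f))
      refine this.congr fun h => ?_
      simp [hQ]
    have h2 : Tendsto (fun h : ℝ => S (max h 0) (h⁻¹ • (Q (tameAvg hν h f) - Q f))) (𝓝[>] 0)
        (𝓝 (Q (tameLevy hν f))) := by
      have := (hS.continuous_uncurry.tendsto (0, Q (tameLevy hν f))).comp
        ((tendsto_nhdsWithin_of_tendsto_nhds tendsto_id).prodMk_nhds h1)
      simpa [hS.zero, Function.comp_def] using this
    have h3 := (hA _ _).1 (hgraph f)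
    have h4 := h2.add h3
    rw [add_neg_cancel] at h4
    refine h4.congr' ?_
    filter_upwards [self_mem_nhdsWithin] with h hh
    rw [max_eq_left (le_of_lt hh), map_smul, map_sub, ← smul_add, sub_add_sub_cancel]
  -- The slope of `F` at `t` is `S t` applied to the slope at `0` for the averaged function at time
  -- `t`. Only right derivatives are available; with continuity they suffice for constancy.
  have hFd : ∀ t, 0 ≤ t → HasDerivWithinAt F 0 (Ici t) t := fun t ht => by
    rw [← hasDerivWithinAt_Ioi_iff_Ici, hasDerivWithinAt_iff_tendsto_slope' self_notMem_Ioi]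
    have h1 := ((S t).continuous.tendsto _).comp (hslope (tameAvg hν t f₀))
    rw [map_zero] at h1
    have h2 : Tendsto (fun s => s - t) (𝓝[>] t) (𝓝[>] 0) := by
      refine tendsto_nhdsWithin_iff.2 ⟨?_, ?_⟩
      · have : Continuous fun s : ℝ => s - t := by fun_prop
        simpa using (this.tendsto t).mono_left nhdsWithin_le_nhds
      · filter_upwards [self_mem_nhdsWithin] with s hs
        exact mem_Ioi.2 (sub_pos.2 hs)
    refine (h1.comp h2).congr' ?_
    filter_upwards [self_mem_nhdsWithin] with s hs
    have hs : t < s := hs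
    have hst : 0 ≤ s - t := by linarith
    simp only [Function.comp_apply, slope_def_module, hF]
    rw [map_smul, map_sub, tameAvg_add hν hst ht, sub_add_cancel, max_eq_left ht,
      max_eq_left (ht.trans hs.le), ← hS.add_apply ht hst, add_sub_cancel]
  have hconst : ∀ t, 0 ≤ t → F t = T φ := fun t ht => by
    have := constant_of_has_deriv_right_zero (f := F) (a := 0) (b := t) hFc.continuousOn
      (fun x hx => hFd x hx.1) t ⟨ht, le_rfl⟩
    rw [this, hstart, hF]
    simp [hS.zero, tameAvg_zero]
  have hlim : Tendsto (fun t => Q (tameAvg hν t f₀)) atTop (𝓝 0) := by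
    have := ((T.comp J).continuous.tendsto _).comp (tendsto_cutLM_tameAvg_atTop hν hν0 a f₀)
    rwa [map_zero] at this
  refine tendsto_nhds_unique (f := fun _ : ℝ => T φ) (l := atTop) tendsto_const_nhds ?_
  refine (squeeze_zero_norm' ?_ (by simpa using hlim.norm))
  filter_upwards [eventually_ge_atTop 0] with t ht
  rw [← hconst t ht]
  exact hS.norm_apply_le (le_max_right _ _) _

/-- Solutions in the sense of generalized functions are unique. -/
theorem IsDistribSolution.eq (hν : IsOneSidedLevy ν) (hν0 : ν ≠ 0)
    (hS : IsContractionSemigroup S) (hA : IsGenerator A S) {a b : ℝ} {Y : B} {g : ℝ → B}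
    {T T' : 𝓓'(leftHalfLine b, B)} (hT : IsDistribSolution ν A a b Y g T)
    (hT' : IsDistribSolution ν A a b Y g T') : T' = T := by
  ext φ
  rw [← sub_eq_zero]
  refine eq_zero_of_homogeneous hν hν0 hS hA (a := a)
    (T := (show 𝓓(leftHalfLine b, ℝ) →L[ℝ] B from T') - (show 𝓓(leftHalfLine b, ℝ) →L[ℝ] B from T))
    (fun φ hφ => ?_) (fun φ ψ δ hδ hψ => ?_) φ
  · change T' φ - T φ = 0
    rw [hT.vanishing φ hφ, hT'.vanishing φ hφ, sub_zero]
  · have h := A.graph.sub_mem (hT'.equation φ ψ δ hδ hψ) (hT.equation φ ψ δ hδ hψ)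
    change (T' φ - T φ, -(T' ψ - T ψ)) ∈ A.graph
    convert h using 1
    rw [Prod.mk_sub_mk]
    congr 1
    · abel
    · abel

lemma IsUniqueDistribSolution.congr {a b : ℝ} {Y : B} {g u v : ℝ → B}
    (h : IsUniqueDistribSolution ν A a b Y g u) (huv : EqOn u v (Icc a b)) :
    IsUniqueDistribSolution ν A a b Y g v := by
  obtain ⟨hi, T, hT, hsol, huniq⟩ := h
  refine ⟨hi.congr_fun huv measurableSet_Icc, T, fun φ => (hT φ).trans ?_, hsol, huniq⟩
  exact setIntegral_congr_fun measurableSet_Ioo fun x hx =>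
    congrArg (φ x • ·) (huv (Ioo_subset_Icc_self hx))

theorem isUniqueDistribSolution [CompleteSpace B] (hν : IsOneSidedLevy ν) (hν0 : ν ≠ 0)
    (hS : IsContractionSemigroup S) (hA : IsGenerator A S) {a b : ℝ} (hab : a < b) {g : ℝ → B}
    (hg : ContinuousOn g (Icc a b)) (Y : B) :
    IsUniqueDistribSolution ν A a b Y g
      fun x => mittagLeffler ν S (x - a) Y + potentialConv ν S a g x - Y := by
  obtain ⟨T, hT, hsol⟩ := exists_isDistribSolution hν hν0 hS hA hab hg Y
  exact ⟨integrableOn_solution hν hν0 hS hA hab hg Y, T, hT, hsol,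
    fun T' hT' => hsol.eq hν hν0 hS hA hT'⟩

theorem isUniqueDistribSolution_potentialConv [CompleteSpace B] (hν : IsOneSidedLevy ν) (hν0 : ν ≠ 0)
    (hS : IsContractionSemigroup S) (hA : IsGenerator A S) {a b : ℝ} (hab : a < b) {g : ℝ → B}
    (hg : ContinuousOn g (Icc a b)) :
    IsUniqueDistribSolution ν A a b 0 g (potentialConv ν S a g) := by
  refine (isUniqueDistribSolution hν hν0 hS hA hab hg 0).congr fun x _ => ?_
  simp only
  rw [← mittagLefflerCLM_apply hν hν0 hS, map_zero, zero_add, sub_zero]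

end GenFrac

/-! ### Assembly of the theorem -/

theorem mainTheorem5 {B : Type*} [NormedAddCommGroup B] [NormedSpace ℝ B] [CompleteSpace B]
    (ν : Measure ℝ) (hν : GenFrac.IsOneSidedLevy ν) (hν0 : ν ≠ 0)
    (S : ℝ → B →L[ℝ] B) (hS : GenFrac.IsContractionSemigroup S)
    (A : B →ₗ.[ℝ] B) (hA : GenFrac.IsGenerator A S)
    (a b : ℝ) (hab : a < b) :
    -- the measures `G_{(ν)}(t,·)` exist
    (∀ t : ℝ, 0 ≤ t → GenFrac.IsSubordinatorLaw ν t (GenFrac.subordinatorLaw ν t)) ∧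
    -- (i) the operator-valued potential measure and its bound
    (∃ U : Set ℝ → B →L[ℝ] B, GenFrac.IsPotentialMeasure ν S U ∧
      (∀ z l : ℝ, 0 < z → 0 < l →
        ‖U (Icc 0 z)‖ ≤ Real.exp (l * z) / GenFrac.laplaceExponent ν l) ∧
      -- `potentialConv` is the integral `∫_0^{x-a} U(dy) g(x-y)`, as a limit of Riemann sums
      ∀ g : ℝ → B, ContinuousOn g (Icc a b) → ∀ x ∈ Icc a b,
        Tendsto (fun n : ℕ => ∑ i ∈ Finset.range n,
          U (Ico ((i : ℝ) * ((x - a) / n)) (((i : ℝ) + 1) * ((x - a) / n)))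
            (g (x - (i : ℝ) * ((x - a) / n)))) atTop (𝓝 (GenFrac.potentialConv ν S a g x))) ∧
    -- (i) the potential operator is well defined and bounded on `C^k_{kill(a)}([a,b],B)`
    (∀ (k : ℕ) (g : ℝ → B), GenFrac.IsKill k a b g →
      (∀ x ∈ Iic b, IntegrableOn (fun t => GenFrac.productSemigroup ν S t g x) (Ioi 0) ∧
        GenFrac.potentialConv ν S a g x = ∫ t in Ioi 0, GenFrac.productSemigroup ν S t g x) ∧
      GenFrac.IsKill k a b (GenFrac.potentialConv ν S a g) ∧
      ∀ j ≤ k, ∀ l K : ℝ, 0 < l →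
        (∀ x ∈ Icc a b, ‖iteratedDerivWithin j g (Iic b) x‖ ≤ K) →
        ∀ x ∈ Icc a b, ‖iteratedDerivWithin j (GenFrac.potentialConv ν S a g) (Iic b) x‖ ≤
          Real.exp (l * (b - a)) / GenFrac.laplaceExponent ν l * K) ∧
    -- (ii) the generator of `T'_t e^{tA}` acts as `A - D^{(ν)}_{a+}` on regular functions
    (∀ u w : ℝ → B, GenFrac.IsKill 1 a b u → ContinuousOn w (Iic b) →
      (∀ x ∈ Iic b, (u x, w x) ∈ A.graph) →
      GenFrac.HasGeneratorValue ν S a b u (fun x => w x - GenFrac.rlDeriv ν a u x)) ∧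
    -- (ii) unique classical solution
    (∀ g : ℝ → B, GenFrac.IsKill 0 a b g →
      GenFrac.IsClassicalSolution ν S a b g (GenFrac.potentialConv ν S a g) ∧
      ∀ f : ℝ → B, GenFrac.IsClassicalSolution ν S a b g f →
        EqOn f (GenFrac.potentialConv ν S a g) (Iic b)) ∧
    -- (ii) unique generalized solution, by approximation and in the sense of generalized functions
    (∀ g : ℝ → B, ContinuousOn g (Icc a b) →
      (∀ x ∈ Icc a b, IntegrableOn
        (fun t => ∫ y in Ico 0 (x - a), S t (g (x - y)) ∂(GenFrac.subordinatorLaw ν t)) (Ioi 0)) ∧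
      GenFrac.potentialConv ν S a g a = 0 ∧
      GenFrac.IsApproxSolution ν S a b g (GenFrac.potentialConv ν S a g) ∧
      (∀ f : ℝ → B, GenFrac.IsApproxSolution ν S a b g f →
        f =ᵐ[volume.restrict (Icc a b)] GenFrac.potentialConv ν S a g) ∧
      (ν univ = ⊤ → ContinuousOn (GenFrac.potentialConv ν S a g) (Icc a b) ∧
        ∀ f : ℝ → B, GenFrac.IsApproxSolution ν S a b g f → ContinuousOn f (Icc a b) →
          EqOn f (GenFrac.potentialConv ν S a g) (Icc a b)) ∧
      GenFrac.IsUniqueDistribSolution ν A a b 0 g (GenFrac.potentialConv ν S a g)) ∧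
    -- (iii) the Mittag-Leffler operators are well defined
    (∀ z : ℝ, 0 < z → Monotone (GenFrac.tailFun ν z) ∧
      (∀ Y : B, IntegrableOn (fun t => S t Y) (Ioi 0) (GenFrac.tailDeriv ν z)) ∧
      ∃ E : B →L[ℝ] B, ∀ Y : B, E Y = GenFrac.mittagLeffler ν S z Y) ∧
    -- (iii) the problem with initial value `Y`
    (∀ (g : ℝ → B) (Y : B) (f : ℝ → B), ContinuousOn g (Icc a b) →
      (∀ x, f x = GenFrac.mittagLeffler ν S (x - a) Y + GenFrac.potentialConv ν S a g x) →
      f a = Y ∧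
      -- the shifted problem, when `Y` is in the domain of `A` and `Z = A Y`
      (∀ Z : B, (Y, Z) ∈ A.graph →
        (∀ x ∈ Icc a b, f x = Y + GenFrac.potentialConv ν S a (fun s => Z + g s) x) ∧
        GenFrac.IsApproxSolution ν S a b (fun s => Z + g s) (fun x => f x - Y) ∧
        GenFrac.IsUniqueDistribSolution ν A a b 0 (fun s => Z + g s) (fun x => f x - Y)) ∧
      -- arbitrary `Y`
      GenFrac.IsApproxSolutionCaputo ν A S a b Y g f ∧
      (∀ f' : ℝ → B, GenFrac.IsApproxSolutionCaputo ν A S a b Y g f' →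
        f' =ᵐ[volume.restrict (Icc a b)] f) ∧
      (ν univ = ⊤ → ContinuousOn f (Icc a b) ∧
        ∀ f' : ℝ → B, GenFrac.IsApproxSolutionCaputo ν A S a b Y g f' → ContinuousOn f' (Icc a b) →
          EqOn f' f (Icc a b)) ∧
      GenFrac.IsUniqueDistribSolution ν A a b Y g (fun x => f x - Y)) := by
  have hp (g : ℝ → B) (hg : ContinuousOn g (Icc a b)) {x : ℝ} (hx : x ≤ b) :=
    GenFrac.potentialConv_eq_potOp_cutExt hν hν0 hS hab.le hg hx
  refine ⟨fun t ht => hν.isSubordinatorLaw ht,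
    ⟨GenFrac.potU hν hν0 hS, GenFrac.isPotentialMeasure_potU hν hν0 hS,
      fun z l _ hl => GenFrac.norm_potU_Icc_le hν hν0 hS hl,
      fun g hg x hx => GenFrac.tendsto_riemannSum_potU hν hν0 hS hg hx⟩,
    fun k g hg => ⟨fun x hx => GenFrac.integrableOn_productSemigroup hν hν0 hS hab.le
      (hg.of_le k.zero_le) hx, GenFrac.isKill_potentialConv hν hν0 hS hab k hg,
      fun j hj l K hl hK x hx => ?_⟩,
    fun u w hu hw h => GenFrac.hasGeneratorValue_of_isKill_one hν hν0 hS hA hab hu hw h,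
    fun g hg => ⟨GenFrac.isClassicalSolution_potentialConv hν hν0 hS hab.le hg,
      fun f hf => hf.eqOn hν hν0 hS hab.le hg⟩,
    fun g hg => ⟨fun x hx => (hp g hg hx.2).1, GenFrac.potentialConv_eq_zero le_rfl,
      GenFrac.isApproxSolution_potentialConv hν hν0 hS hab.le hg,
      fun f hf => hf.ae_eq hν hν0 hS hab.le hg, fun htop => ?_,
      GenFrac.isUniqueDistribSolution_potentialConv hν hν0 hS hA hab hg⟩,
    fun z hz => ⟨hν.tailFun_mono z, fun Y => GenFrac.integrableOn_tailDeriv hν hν0 hS hz Y,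
      GenFrac.mittagLefflerCLM hν hν0 hS z, fun Y => rfl⟩,
    fun g Y f hg hf => ?_⟩
  · obtain ⟨hk, heq⟩ := GenFrac.iteratedDerivWithin_potentialConv hν hν0 hS hab hj hg
    rw [heq hx.2]
    exact GenFrac.norm_potentialConv_le hν hν0 hS hab.le hl hk.continuousOn_Icc hK hx.2
  · have hc := GenFrac.continuousOn_potentialConv_of_infinite hν hν0 hS hab.le htop hg
    exact ⟨hc, fun f hf hfc => Measure.eqOn_Icc_of_ae_eq volume hab.ne
      (hf.ae_eq hν hν0 hS hab.le hg) hfc hc⟩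
  · obtain rfl : f = fun x =>
        GenFrac.mittagLeffler ν S (x - a) Y + GenFrac.potentialConv ν S a g x := funext hf
    have hu := GenFrac.isUniqueDistribSolution hν hν0 hS hA hab hg Y
    refine ⟨?_, fun Z hZ => ?_, GenFrac.isApproxSolutionCaputo hν hν0 hS hA hab.le hg Y,
      fun f' hf' => hf'.ae_eq hν hν0 hS hA hab.le hg, fun htop => ?_, hu⟩
    · simp only
      rw [GenFrac.mittagLeffler_of_nonpos (by linarith), GenFrac.potentialConv_eq_zero le_rfl,
        add_zero]
    · have hgZ : ContinuousOn (fun s => Z + g s) (Icc a b) := continuousOn_const.add hg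
      have h1 : ∀ x ∈ Icc a b,
          GenFrac.mittagLeffler ν S (x - a) Y + GenFrac.potentialConv ν S a g x =
            Y + GenFrac.potentialConv ν S a (fun s => Z + g s) x := fun x hx =>
        GenFrac.mittagLeffler_add_potentialConv_eq hν hν0 hS hA hab.le hg hZ hx.2
      have h2 : EqOn (GenFrac.potentialConv ν S a fun s => Z + g s) (fun x =>
          GenFrac.mittagLeffler ν S (x - a) Y + GenFrac.potentialConv ν S a g x - Y)
          (Icc a b) := fun x hx => by
        simp only
        rw [h1 x hx, add_sub_cancel_left]
      exact ⟨h1, (GenFrac.isApproxSolution_potentialConv hν hν0 hS hab.le hgZ).congr h2,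
        (GenFrac.isUniqueDistribSolution_potentialConv hν hν0 hS hA hab hgZ).congr h2⟩
    · have hc := (GenFrac.continuousOn_mittagLeffler hν hν0 hS hA hab.le htop Y).add
        (GenFrac.continuousOn_potentialConv_of_infinite hν hν0 hS hab.le htop hg)
      exact ⟨hc, fun f' hf' hfc => Measure.eqOn_Icc_of_ae_eq volume hab.ne
        (hf'.ae_eq hν hν0 hS hA hab.le hg) hfc hc⟩
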